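/- Let $(M,g)$ be a smooth four-dimensional Lorentzian manifold of signature $(-,+,+,+)$, with Levi-Civita connection $\nabla$ and Ricci tensor $R_{kl}$. Consider a solution of mimetic gravity on $M$: smooth functions $\phi$ (the mimetic field) and $\zeta$ (the Lagrange multiplier), a smooth potential $V=V(\phi)$, and a smooth symmetric matter tensor $T_{kl}$ with $\nabla^kT_{kl}=0$, such that $$g^{kl}\nabla_k\phi\nabla_l\phi=-1,\qquad R_{kl}-\tfrac12Rg_{kl}=T_{kl}+2\zeta\nabla_k\phi\nabla_l\phi+g_{kl}V(\phi).$$ Put $u_k=-\nabla_k\phi$, $t=\phi$, and $$\mathscr C_{kl}=2\zeta u_ku_l+\tfrac13g_{kl}(2\zeta-V).$$ Terminology. The field equation *is the field equation of Cotton gravity* if, with this $\mathscr C$, $R_{kl}-\frac12Rg_{kl}=T_{kl}+\mathscr C_{kl}-g_{kl}\mathscr C^r{}_r$ and $\mathscr C$ is a Codazzi tensor: $\nabla_j\mathscr C_{kl}=\nabla_k\mathscr C_{jl}$. The space-time *is GRW* (Generalized Robertson-Walker), with cosmic time $t=\phi$, if around every point there are smooth coordinates $(t,\mathbf x)$, with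 $t=\phi$, in which $ds^2=-dt^2+a(t)^2g^\star_{\mu\nu}(\mathbf x)\,dx^\mu dx^\nu$, where $a>0$ is smooth and $g^\star$ is a smooth positive definite metric. It *is FRW* if in addition such coordinates can be chosen with $g^\star$ of constant sectional curvature. For a function $f$ on $M$, $f=f(t)$ means that near every point $f$ is a function of $t=\phi$ alone. 1. Suppose that $\zeta$ does not vanish identically on any non-empty open set. Then the field equation is the field equation of Cotton gravity if and only if the space-time is GRW, $V=V(t)$ and $\zeta=\zeta(t)$. 2. Suppose that the space-time is FRW (no assumption on the zeros of $\zeta$). Then the field equation is the field equation of Cotton gravity if and only if $\zeta=\zeta(t)$; and this holds whenever the energy density of matter $\mu=T_{kl}u^ku^l$ is homogeneous, $\mu=\mu(t)$ (in particular for a comoving perfect fluid $T_{kl}=(\mu+p)u_ku_l+pg_{kl}$ with $\mu=\mu(t)$, $p=p(t)$). -/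

import Mathlib

open Set Filter Topology
open scoped Manifold ContDiff

noncomputable section

namespace MimeticCotton

/-! ### Tensor calculus in coordinates

A metric on (a subset of) coordinate space is given by the matrix function `G` of its components. -/

/-- Coordinate space `ℝⁿ`. -/
abbrev Coord (n : ℕ) : Type := EuclideanSpace ℝ (Fin n)

/-- The partial derivative `∂ᵢ F`. -/
def pd {n : ℕ} (i : Fin n) (F : Coord n → ℝ) (y : Coord n) : ℝ :=
  fderiv ℝ F y (EuclideanSpace.single i 1)

/-- Christoffel symbols of the Levi-Civita connection,
`Γᵐᵢⱼ = ½ gᵐˡ (∂ᵢ gₗⱼ + ∂ⱼ gₗᵢ - ∂ₗ gᵢⱼ)`. -/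
def christoffel {n : ℕ} (G : Coord n → Matrix (Fin n) (Fin n) ℝ) (m i j : Fin n)
    (y : Coord n) : ℝ :=
  (1 / 2) * ∑ l, (G y)⁻¹ m l *
    (pd i (fun z => G z l j) y + pd j (fun z => G z l i) y - pd l (fun z => G z i j) y)

/-- Riemann tensor
`Rᵐⱼₖₗ = ∂ₖ Γᵐₗⱼ - ∂ₗ Γᵐₖⱼ + Γᵐₖₙ Γⁿₗⱼ - Γᵐₗₙ Γⁿₖⱼ`. -/
def riemann {n : ℕ} (G : Coord n → Matrix (Fin n) (Fin n) ℝ) (m j k l : Fin n)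
    (y : Coord n) : ℝ :=
  pd k (christoffel G m l j) y - pd l (christoffel G m k j) y
    + ∑ r, (christoffel G m k r y * christoffel G r l j y
      - christoffel G m l r y * christoffel G r k j y)

/-- Ricci tensor `Rⱼₗ = Rᵐⱼₘₗ` (positive on round spheres). -/
def ricci {n : ℕ} (G : Coord n → Matrix (Fin n) (Fin n) ℝ) (j l : Fin n) (y : Coord n) : ℝ :=
  ∑ m, riemann G m j m l y

/-- The trace `Cʳᵣ = gᵏˡ Cₖₗ`. -/
def trace {n : ℕ} (G : Coord n → Matrix (Fin n) (Fin n) ℝ)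
    (C : Fin n → Fin n → Coord n → ℝ) (y : Coord n) : ℝ :=
  ∑ k, ∑ l, (G y)⁻¹ k l * C k l y

/-- Einstein tensor `Rₖₗ - ½ R gₖₗ`. -/
def einstein {n : ℕ} (G : Coord n → Matrix (Fin n) (Fin n) ℝ) (k l : Fin n)
    (y : Coord n) : ℝ :=
  ricci G k l y - (1 / 2) * trace G (ricci G) y * G y k l

/-- Covariant derivative of a `(0,2)` tensor,
`∇ⱼ Cₖₗ = ∂ⱼ Cₖₗ - Γᵐⱼₖ Cₘₗ - Γᵐⱼₗ Cₖₘ`. -/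
def cov {n : ℕ} (G : Coord n → Matrix (Fin n) (Fin n) ℝ)
    (C : Fin n → Fin n → Coord n → ℝ) (j k l : Fin n) (y : Coord n) : ℝ :=
  pd j (C k l) y - ∑ m, (christoffel G m j k y * C m l y + christoffel G m j l y * C k m y)

/-- Divergence of a `(0,2)` tensor, `∇ᵏ Tₖₗ = gᵏᵐ ∇ₘ Tₖₗ`. -/
def divergence {n : ℕ} (G : Coord n → Matrix (Fin n) (Fin n) ℝ)
    (T : Fin n → Fin n → Coord n → ℝ) (l : Fin n) (y : Coord n) : ℝ :=
  ∑ k, ∑ m, (G y)⁻¹ k m * cov G T m k l y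

/-! ### Tensor fields on a four-dimensional manifold -/

section Manifold

variable {M : Type*} [TopologicalSpace M] [ChartedSpace (Coord 4) M]

/-- A `(0,2)` tensor field (no regularity). -/
abbrev Tensor2 (M : Type*) [TopologicalSpace M] [ChartedSpace (Coord 4) M] : Type _ :=
  ∀ x : M, LinearMap.BilinForm ℝ (TangentSpace (𝓡 4) x)

/-- The smooth charts of `M` (all charts of the maximal `C^∞` atlas). -/
abbrev charts (M : Type*) [TopologicalSpace M] [ChartedSpace (Coord 4) M] :
    Set (OpenPartialHomeomorph M (Coord 4)) :=
  IsManifold.maximalAtlas (𝓡 4) ∞ M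

/-- The coordinate vector `∂ᵢ` of the chart `e`, at the point with coordinates `y`. -/
def frame (e : OpenPartialHomeomorph M (Coord 4)) (i : Fin 4) (y : Coord 4) :
    TangentSpace (𝓡 4) (e.symm y) :=
  mfderiv (𝓡 4) (𝓡 4) e.symm y (EuclideanSpace.single i (1 : ℝ) : Coord 4)

/-- The components `Cᵢⱼ` of a tensor field in the chart `e`, as functions of the coordinates. -/
def comp (e : OpenPartialHomeomorph M (Coord 4)) (C : Tensor2 M) (i j : Fin 4)
    (y : Coord 4) : ℝ :=
  C (e.symm y) (frame e i y) (frame e j y)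

/-- A tensor field is smooth if its components in all smooth charts are. -/
def SmoothTensor (C : Tensor2 M) : Prop :=
  ∀ e ∈ charts M, ∀ i j, ContDiffOn ℝ ∞ (comp e C i j) e.target

/-- A tensor field is symmetric. -/
def SymmetricTensor (C : Tensor2 M) : Prop :=
  ∀ x v w, C x v w = C x w v

/-- A smooth Lorentzian metric, of signature `(-,+,+,+)`. -/
structure LorentzMetric (M : Type*) [TopologicalSpace M] [ChartedSpace (Coord 4) M] where
  /-- the metric tensor -/
  tensor : Tensor2 M
  smooth : SmoothTensor tensor
  symmetric : SymmetricTensor tensor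
  signature : ∀ x : M, ∃ b : Module.Basis (Fin 4) ℝ (TangentSpace (𝓡 4) x), ∀ i j,
    tensor x (b i) (b j) = if i = j then (if i = 0 then -1 else 1) else 0

/-- The component matrix `gᵢⱼ` of the metric in the chart `e`. -/
def LorentzMetric.mat (g : LorentzMetric M) (e : OpenPartialHomeomorph M (Coord 4))
    (y : Coord 4) : Matrix (Fin 4) (Fin 4) ℝ :=
  Matrix.of fun i j => comp e g.tensor i j y

/-- The differential `∇φ` of a scalar function, as a one-form. -/
def dform (φ : M → ℝ) (x : M) : TangentSpace (𝓡 4) x →ₗ[ℝ] ℝ :=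
  (mfderiv (𝓡 4) 𝓘(ℝ, ℝ) φ x).toLinearMap

/-- A Codazzi tensor: a smooth symmetric tensor field with `∇ⱼ Cₖₗ = ∇ₖ Cⱼₗ`. -/
def IsCodazzi (g : LorentzMetric M) (C : Tensor2 M) : Prop :=
  SmoothTensor C ∧ SymmetricTensor C ∧
    ∀ e ∈ charts M, ∀ y ∈ e.target, ∀ j k l,
      cov (g.mat e) (comp e C) j k l y = cov (g.mat e) (comp e C) k j l y

/-- The field equation of Cotton gravity in the Codazzi parametrization:
`Rₖₗ - ½ R gₖₗ = Tₖₗ + Cₖₗ - gₖₗ Cʳᵣ` with `C` a Codazzi tensor. -/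
def IsCottonEquation (g : LorentzMetric M) (T C : Tensor2 M) : Prop :=
  (∀ e ∈ charts M, ∀ y ∈ e.target, ∀ k l,
    einstein (g.mat e) k l y =
      comp e T k l y + comp e C k l y - g.mat e y k l * trace (g.mat e) (comp e C) y) ∧
  IsCodazzi g C

/-- A solution of mimetic gravity: mimetic field `φ`, Lagrange multiplier `ζ`, potential `V`,
conserved symmetric matter tensor `T`. -/
structure IsMimeticSolution (g : LorentzMetric M) (T : Tensor2 M) (φ ζ : M → ℝ)
    (V : ℝ → ℝ) : Prop where
  smooth_field : ContMDiff (𝓡 4) 𝓘(ℝ, ℝ) ∞ φ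
  smooth_multiplier : ContMDiff (𝓡 4) 𝓘(ℝ, ℝ) ∞ ζ
  smooth_potential : ContDiffOn ℝ ∞ V (range φ)
  smooth_matter : SmoothTensor T
  symmetric_matter : SymmetricTensor T
  /-- `∇ᵏ Tₖₗ = 0` -/
  conserved : ∀ e ∈ charts M, ∀ y ∈ e.target, ∀ l, divergence (g.mat e) (comp e T) l y = 0
  /-- `gᵏˡ ∇ₖφ ∇ₗφ = -1` -/
  unit_gradient : ∀ e ∈ charts M, ∀ y ∈ e.target,
    ∑ k, ∑ l, (g.mat e y)⁻¹ k l * (pd k (φ ∘ e.symm) y * pd l (φ ∘ e.symm) y) = -1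
  /-- `Rₖₗ - ½ R gₖₗ = Tₖₗ + 2 ζ ∇ₖφ ∇ₗφ + gₖₗ V(φ)` -/
  field_equation : ∀ e ∈ charts M, ∀ y ∈ e.target, ∀ k l,
    einstein (g.mat e) k l y =
      comp e T k l y + 2 * ζ (e.symm y) * (pd k (φ ∘ e.symm) y * pd l (φ ∘ e.symm) y)
        + g.mat e y k l * V (φ (e.symm y))

/-- The one-form `uₖ = -∇ₖφ` of the velocity defined by the mimetic field. -/
def velocity (φ : M → ℝ) (x : M) : TangentSpace (𝓡 4) x →ₗ[ℝ] ℝ :=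
  -dform φ x

/-- The perfect-fluid tensor `Cₖₗ = 2 ζ uₖ uₗ + ⅓ gₖₗ (2 ζ - V(φ))`, with `uₖ = -∇ₖφ`. -/
def mimeticTensor (g : LorentzMetric M) (φ ζ : M → ℝ) (V : ℝ → ℝ) : Tensor2 M := fun x =>
  (2 * ζ x) • LinearMap.BilinForm.linMulLin (velocity φ x) (velocity φ x)
    + ((1 / 3) * (2 * ζ x - V (φ x))) • g.tensor x

/-- The spatial coordinates `(x¹, x², x³)` of `(t, x¹, x², x³)`. -/
def spatial (y : Coord 4) : Coord 3 :=
  WithLp.toLp 2 fun μ => y μ.succ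

/-- In the smooth chart `e`, with coordinates `(t, x)`, the zeroth coordinate is the function `τ`
and the metric is `-dt² + a(t)² g⋆(x)`, with `a > 0` and `g⋆` a Riemannian metric. -/
structure IsWarpedChart (g : LorentzMetric M) (τ : M → ℝ)
    (e : OpenPartialHomeomorph M (Coord 4)) (a : ℝ → ℝ)
    (gs : Coord 3 → Matrix (Fin 3) (Fin 3) ℝ) : Prop where
  mem_charts : e ∈ charts M
  time_eq : ∀ y ∈ e.target, τ (e.symm y) = y 0
  smooth_scale : ContDiffOn ℝ ∞ a ((fun y : Coord 4 => y 0) '' e.target)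
  scale_pos : ∀ y ∈ e.target, 0 < a (y 0)
  smooth_space : ∀ μ ν, ContDiffOn ℝ ∞ (fun x => gs x μ ν) (spatial '' e.target)
  posDef_space : ∀ y ∈ e.target, (gs (spatial y)).PosDef
  metric_time : ∀ y ∈ e.target, g.mat e y 0 0 = -1
  metric_mixed : ∀ y ∈ e.target, ∀ μ : Fin 3, g.mat e y 0 μ.succ = 0
  metric_space : ∀ y ∈ e.target, ∀ μ ν : Fin 3,
    g.mat e y μ.succ ν.succ = a (y 0) ^ 2 * gs (spatial y) μ ν

/-- Generalized Robertson-Walker space-time with cosmic time `τ`: around every point there are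
coordinates `(t, x)` with `t = τ` and metric `-dt² + a(t)² g⋆(x)`. -/
def IsGRW (g : LorentzMetric M) (τ : M → ℝ) : Prop :=
  ∀ p : M, ∃ e a gs, p ∈ e.source ∧ IsWarpedChart g τ e a gs

/-- Friedmann-Robertson-Walker space-time with cosmic time `τ`: as before, with `g⋆` of constant
sectional curvature `κ`. -/
def IsFRW (g : LorentzMetric M) (τ : M → ℝ) : Prop :=
  ∀ p : M, ∃ e a gs, p ∈ e.source ∧ IsWarpedChart g τ e a gs ∧
    ∃ κ : ℝ, ∀ y ∈ e.target, ∀ m j k l : Fin 3,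
      riemann gs m j k l (spatial y) =
        κ * ((if m = k then gs (spatial y) l j else 0) - (if m = l then gs (spatial y) k j else 0))

/-- `f = f(t)`: near every point `f` is a function of the cosmic time `τ` alone. -/
def DependsOnlyOnTime (τ f : M → ℝ) : Prop :=
  ∀ p : M, ∃ F : ℝ → ℝ, ∀ᶠ x in 𝓝 p, f x = F (τ x)

/-- `μ = Tₖₗ uᵏ uˡ` is the energy density of `T` for the observers with velocity `uₖ = -∇ₖφ`. -/
def IsEnergyDensity (g : LorentzMetric M) (T : Tensor2 M) (φ μ : M → ℝ) : Prop :=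
  ∀ x (U : TangentSpace (𝓡 4) x), (∀ w, g.tensor x U w = velocity φ x w) → T x U U = μ x

end Manifold

end MimeticCotton

end

open Set Filter Topology
open scoped Manifold ContDiff Matrix

noncomputable section

namespace MimeticCotton

/-! ### Tensor calculus in coordinates, without coordinates -/

section Coordinates

variable {n : ℕ}

/-! Since `g^{kl} ∂ₖφ ∂ₗφ = -1`, the trace of the mimetic tensor `C` is `(2ζ - 4V)/3`, so `C - g tr
C = 2ζ u⊗u + V g`. The mimetic equation is thus always of the Cotton form, and the whole question is
whether `C` is Codazzi (`IsMimeticSolution.isCottonEquation_iff`). That `V` depends on time only is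
automatic.

Flowing along `N = -grad φ` gives charts in which `t = φ` and the metric is `-dt² + h(t, x)`
(`IsMimeticSolution.exists_isGaussianChart`). There `C = 2ζ dt⊗dt + β g` with `β = (2ζ - V)/3`, and
the Codazzi equation reduces to `∂_μ ζ = 0` together with `(∂ₜβ) h + ζ ∂ₜh = 0`
(`IsGaussianChart.codazzi_iff`).

The first condition says `ζ = ζ(t)`, with no assumption on the zeros of `ζ`. Where `ζ ≠ 0`, the
second says that all components of `h` have the same logarithmic time derivative, a function of `t`
only. Written without `ζ`, this relation is closed, so it extends to all points when `{ζ ≠ 0}` is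
dense; integrating it gives `h = a(t)² g⋆(x)`.

Conversely, for `h = a² g⋆` the second condition becomes `2ζ' - V' + 6 (a'/a) ζ = 0`. This is the
time component of `∇ᵏTₖₗ = 0`: once `T` is eliminated by the field equation, the curvature terms
cancel, as the contracted Bianchi identity predicts, and only `ζ` and `V` remain
(`IsWarpedChart.energy_conservation`). Hence a GRW metric with `ζ = ζ(t)` has Codazzi `C`. In the
FRW case the `00` field equation gives `2ζ = 3κ/a² + 3(a'/a)² + V - μ`, so `μ = μ(t)` forces `ζ =
ζ(t)`.

Two pieces of infrastructure are proved on the way. The Codazzi condition is required in every chart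
but verified in special ones, so covariant derivatives must be shown to transform as tensors. The
Gaussian charts require smooth dependence of solutions of differential equations on initial data,
obtained from the inverse function theorem in a space of continuous curves. -/

/-- The coordinate vector `eᵢ` of coordinate space. -/
abbrev ev (i : Fin n) : Coord n := EuclideanSpace.single i 1

theorem coord_eq_sum (v : Coord n) : v = ∑ i, v i • ev i := by
  ext j
  simp [Finset.sum_apply, Pi.single_apply]

/-- A property of vectors that is closed under linear combinations holds if it does for the
coordinate vectors. -/
theorem coord_induction {P : Coord n → Prop} (hev : ∀ i, P (ev i)) (h0 : P 0)
    (hadd : ∀ v w, P v → P w → P (v + w)) (hsmul : ∀ (c : ℝ) v, P v → P (c • v))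
    (v : Coord n) : P v := by
  rw [coord_eq_sum v]
  exact Finset.sum_induction _ P hadd h0 fun i _ => hsmul _ _ (hev i)

/-- The bilinear form `∑ cᵢⱼ pᵢ ⊗ pⱼ`. -/
def sumBil {E : Type*} [NormedAddCommGroup E] [NormedSpace ℝ E] (p : Fin n → E →L[ℝ] ℝ)
    (c : Fin n → Fin n → ℝ) : E →L[ℝ] E →L[ℝ] ℝ :=
  ∑ i, ∑ j, c i j • (p i).smulRight (p j)

theorem differentiableAt_sum_smul {F H ι κ : Type*} [Fintype ι] [Fintype κ]
    [NormedAddCommGroup F] [NormedSpace ℝ F] [NormedAddCommGroup H] [NormedSpace ℝ H]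
    {C : ι → κ → F → ℝ} {v : ι → κ → H} {y : F} (hC : ∀ i j, DifferentiableAt ℝ (C i j) y) :
    DifferentiableAt ℝ (fun z => ∑ i, ∑ j, C i j z • v i j) y := by
  fun_prop

theorem differentiableAt_sumBil {E F : Type*} [NormedAddCommGroup E] [NormedSpace ℝ E]
    [NormedAddCommGroup F] [NormedSpace ℝ F] (p : Fin n → E →L[ℝ] ℝ)
    {C : Fin n → Fin n → F → ℝ} {y : F} (hC : ∀ i j, DifferentiableAt ℝ (C i j) y) :
    DifferentiableAt ℝ (fun z => sumBil p fun i j => C i j z) y := by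
  unfold sumBil
  exact differentiableAt_sum_smul (v := fun i j => (p i).smulRight (p j)) hC

/-- The bilinear form with components `C`. -/
def bil (C : Fin n → Fin n → Coord n → ℝ) (y : Coord n) : Coord n →L[ℝ] Coord n →L[ℝ] ℝ :=
  sumBil (fun i => EuclideanSpace.proj i) fun i j => C i j y

theorem bil_ev (C : Fin n → Fin n → Coord n → ℝ) (y : Coord n) (i j : Fin n) :
    bil C y (ev i) (ev j) = C i j y := by
  simp [bil, sumBil]

theorem differentiableAt_bil {C : Fin n → Fin n → Coord n → ℝ} {y : Coord n}
    (hC : ∀ i j, DifferentiableAt ℝ (C i j) y) : DifferentiableAt ℝ (bil C) y :=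
  differentiableAt_sumBil _ hC

theorem fderiv_clm_apply_apply {E F H : Type*} [NormedAddCommGroup E] [NormedSpace ℝ E]
    [NormedAddCommGroup F] [NormedSpace ℝ F] [NormedAddCommGroup H] [NormedSpace ℝ H]
    {B : E → F →L[ℝ] F →L[ℝ] H} {y : E} (hB : DifferentiableAt ℝ B y)
    {a b : E → F} (ha : DifferentiableAt ℝ a y) (hb : DifferentiableAt ℝ b y) (u : E) :
    fderiv ℝ (fun z => B z (a z) (b z)) y u =
      fderiv ℝ B y u (a y) (b y) + B y (fderiv ℝ a y u) (b y) + B y (a y) (fderiv ℝ b y u) := by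
  rw [fderiv_clm_apply (hB.clm_apply ha) hb, fderiv_clm_apply hB ha]
  simp
  abel

theorem fderiv_bil_ev {C : Fin n → Fin n → Coord n → ℝ} {y : Coord n}
    (hC : ∀ i j, DifferentiableAt ℝ (C i j) y) (k i j : Fin n) :
    fderiv ℝ (bil C) y (ev k) (ev i) (ev j) = pd k (C i j) y := by
  have h := fderiv_clm_apply_apply (differentiableAt_bil hC) (differentiableAt_const (ev i))
    (differentiableAt_const (ev j)) (ev k)
  simp only [bil_ev] at h
  simp at h
  exact h.symm

/-- The Christoffel symbols as a vector-valued bilinear map. -/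
def christoffelMap (G : Coord n → Matrix (Fin n) (Fin n) ℝ) (y : Coord n) :
    Coord n →L[ℝ] Coord n →L[ℝ] Coord n :=
  ∑ i, ∑ j, (EuclideanSpace.proj i : Coord n →L[ℝ] ℝ).smulRight
    ((EuclideanSpace.proj j : Coord n →L[ℝ] ℝ).smulRight (∑ m, christoffel G m i j y • ev m))

theorem christoffelMap_ev (G : Coord n → Matrix (Fin n) (Fin n) ℝ) (y : Coord n) (i j : Fin n) :
    christoffelMap G y (ev i) (ev j) = ∑ m, christoffel G m i j y • ev m := by
  simp [christoffelMap]

/-- The Christoffel symbols with lowered index. -/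
theorem sum_mul_christoffel {G : Coord n → Matrix (Fin n) (Fin n) ℝ} {y : Coord n}
    (hG : IsUnit (G y).det) (l i j : Fin n) :
    ∑ m, G y l m * christoffel G m i j y =
      (1 / 2) * (pd i (fun z => G z l j) y + pd j (fun z => G z l i) y
        - pd l (fun z => G z i j) y) := by
  have h : G y * (G y)⁻¹ = 1 := Matrix.mul_nonsing_inv _ hG
  simp only [christoffel]
  calc _ = (1 / 2) * ∑ r, (∑ m, G y l m * (G y)⁻¹ m r) *
        (pd i (fun z => G z r j) y + pd j (fun z => G z r i) y - pd r (fun z => G z i j) y) := by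
        simp only [Finset.mul_sum, Finset.sum_mul]
        rw [Finset.sum_comm]
        refine Finset.sum_congr rfl fun _ _ => Finset.sum_congr rfl fun _ _ => ?_
        ring
    _ = _ := by
        simp only [← Matrix.mul_apply, h, Matrix.one_apply, ite_mul, one_mul, zero_mul]
        simp

/-- The components of a matrix-valued function. -/
abbrev ent (G : Coord n → Matrix (Fin n) (Fin n) ℝ) (i j : Fin n) (y : Coord n) : ℝ := G y i j

/-- Koszul's formula. -/
theorem koszul {G : Coord n → Matrix (Fin n) (Fin n) ℝ} {y : Coord n}
    (hG : IsUnit (G y).det) (hd : ∀ i j, DifferentiableAt ℝ (ent G i j) y) (l v w : Coord n) :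
    2 * bil (ent G) y l (christoffelMap G y v w) =
      fderiv ℝ (bil (ent G)) y v l w + fderiv ℝ (bil (ent G)) y w l v
        - fderiv ℝ (bil (ent G)) y l v w := by
  induction l using coord_induction with
  | h0 => simp
  | hadd l l' h h' => simp only [map_add, add_apply]; linear_combination h + h'
  | hsmul c l h =>
    simp only [map_smul, smul_apply, smul_eq_mul]; linear_combination c * h
  | hev l =>
  induction v using coord_induction with
  | h0 => simp
  | hadd l l' h h' => simp only [map_add, add_apply]; linear_combination h + h'
  | hsmul c l h =>
    simp only [map_smul, smul_apply, smul_eq_mul]; linear_combination c * h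
  | hev i =>
  induction w using coord_induction with
  | h0 => simp
  | hadd l l' h h' => simp only [map_add, add_apply]; linear_combination h + h'
  | hsmul c l h =>
    simp only [map_smul, smul_apply, smul_eq_mul]; linear_combination c * h
  | hev j =>
  have h := sum_mul_christoffel hG l i j
  simp only [fderiv_bil_ev hd, christoffelMap_ev, map_sum, map_smul, bil_ev, smul_eq_mul]
  simp only [mul_comm (christoffel G _ _ _ _)]
  rw [h]
  ring

/-- The covariant derivative of a `(0,2)` tensor, as a trilinear map. -/
def covMap (G : Coord n → Matrix (Fin n) (Fin n) ℝ) (C : Fin n → Fin n → Coord n → ℝ)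
    (y u v w : Coord n) : ℝ :=
  fderiv ℝ (bil C) y u v w - bil C y (christoffelMap G y u v) w
    - bil C y v (christoffelMap G y u w)

theorem covMap_ev {G : Coord n → Matrix (Fin n) (Fin n) ℝ} {C : Fin n → Fin n → Coord n → ℝ}
    {y : Coord n} (hC : ∀ i j, DifferentiableAt ℝ (C i j) y) (j k l : Fin n) :
    covMap G C y (ev j) (ev k) (ev l) = cov G C j k l y := by
  simp only [covMap, cov, fderiv_bil_ev hC, christoffelMap_ev, map_sum, map_smul, bil_ev,
    sum_apply, smul_apply, smul_eq_mul,
    Finset.sum_add_distrib]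
  ring

/-- Both sides are trilinear. General vectors are needed because a change of chart does not carry
coordinate vectors to coordinate vectors. -/
theorem covMap_comm {G : Coord n → Matrix (Fin n) (Fin n) ℝ} {C : Fin n → Fin n → Coord n → ℝ}
    {y : Coord n} (hC : ∀ i j, DifferentiableAt ℝ (C i j) y)
    (h : ∀ j k l, cov G C j k l y = cov G C k j l y) (u v w : Coord n) :
    covMap G C y u v w = covMap G C y v u w := by
  induction u using coord_induction with
  | h0 => simp [covMap]
  | hadd l l' h h' =>
    simp only [covMap, map_add, add_apply] at *; linear_combination h + h'
  | hsmul c l h =>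
    simp only [covMap, map_smul, smul_apply, smul_eq_mul] at *
    linear_combination c * h
  | hev i =>
  induction v using coord_induction with
  | h0 => simp [covMap]
  | hadd l l' h h' =>
    simp only [covMap, map_add, add_apply] at *; linear_combination h + h'
  | hsmul c l h =>
    simp only [covMap, map_smul, smul_apply, smul_eq_mul] at *
    linear_combination c * h
  | hev j =>
  induction w using coord_induction with
  | h0 => simp [covMap]
  | hadd l l' h h' =>
    simp only [covMap, map_add] at *; linear_combination h + h'
  | hsmul c l h =>
    simp only [covMap, map_smul, smul_eq_mul] at *
    linear_combination c * h
  | hev k => rw [covMap_ev hC, covMap_ev hC, h]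

theorem bil_comm {G : Coord n → Matrix (Fin n) (Fin n) ℝ} {y : Coord n} (hs : (G y).IsSymm)
    (v w : Coord n) : bil (ent G) y v w = bil (ent G) y w v := by
  induction v using coord_induction with
  | h0 => simp
  | hadd l l' h h' => simp only [map_add, add_apply]; rw [h, h']
  | hsmul c l h => simp only [map_smul, smul_apply, h]
  | hev i =>
  induction w using coord_induction with
  | h0 => simp
  | hadd l l' h h' => simp only [map_add, add_apply]; rw [h, h']
  | hsmul c l h => simp only [map_smul, smul_apply, h]
  | hev j => rw [bil_ev, bil_ev]; exact hs.apply j i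

/-- Lets an identity between vectors, such as the transformation law of the Christoffel symbols, be
checked after lowering its index. -/
theorem bil_nondegenerate {G : Coord n → Matrix (Fin n) (Fin n) ℝ} {y : Coord n}
    (hG : IsUnit (G y).det) {v : Coord n} (h : ∀ w, bil (ent G) y w v = 0) : v = 0 := by
  have h1 : Matrix.mulVec (G y) v.ofLp = 0 := by
    funext i
    have := h (ev i)
    rw [coord_eq_sum v] at this
    simp only [map_sum, map_smul, bil_ev, smul_eq_mul] at this
    simpa [Matrix.mulVec, dotProduct, mul_comm] using this
  have h2 : v.ofLp = 0 := by
    have := congrArg ((G y)⁻¹.mulVec) h1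
    rwa [Matrix.mulVec_mulVec, Matrix.nonsing_inv_mul _ hG, Matrix.one_mulVec,
      Matrix.mulVec_zero] at this
  ext i
  exact congrFun h2 i

/-! ### Change of coordinates -/

/-- The derivative of the pull-back of a bilinear form. -/
theorem fderiv_pullback {C C' : Fin n → Fin n → Coord n → ℝ} {ψ : Coord n → Coord n}
    {z : Coord n} (hψ : ContDiffAt ℝ 2 ψ z) (hC : ∀ i j, DifferentiableAt ℝ (C i j) (ψ z))
    (hC' : ∀ i j, DifferentiableAt ℝ (C' i j) z)
    (h : ∀ᶠ x in 𝓝 z, ∀ v w, bil C' x v w = bil C (ψ x) (fderiv ℝ ψ x v) (fderiv ℝ ψ x w))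
    (u v w : Coord n) :
    fderiv ℝ (bil C') z u v w =
      fderiv ℝ (bil C) (ψ z) (fderiv ℝ ψ z u) (fderiv ℝ ψ z v) (fderiv ℝ ψ z w)
        + bil C (ψ z) (fderiv ℝ (fderiv ℝ ψ) z u v) (fderiv ℝ ψ z w)
        + bil C (ψ z) (fderiv ℝ ψ z v) (fderiv ℝ (fderiv ℝ ψ) z u w) := by
  have hψ1 : DifferentiableAt ℝ ψ z := hψ.differentiableAt (by norm_num)
  have hψ2 : DifferentiableAt ℝ (fderiv ℝ ψ) z :=
    (hψ.fderiv_right (m := 1) (by norm_num)).differentiableAt (by norm_num)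
  have hB := differentiableAt_bil hC
  have h1 := fderiv_clm_apply_apply (differentiableAt_bil hC') (differentiableAt_const v)
    (differentiableAt_const w) u
  have hBψ : DifferentiableAt ℝ (fun x => bil C (ψ x)) z :=
    DifferentiableAt.fun_comp' (g := bil C) z hB hψ1
  have h2 := fderiv_clm_apply_apply hBψ
    (hψ2.clm_apply (differentiableAt_const v)) (hψ2.clm_apply (differentiableAt_const w)) u
  have h3 : (fun x => bil C' x v w) =ᶠ[𝓝 z]
      fun x => bil C (ψ x) (fderiv ℝ ψ x v) (fderiv ℝ ψ x w) := h.mono fun x hx => hx v w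
  rw [h3.fderiv_eq, h2, fderiv_clm_apply hψ2 (differentiableAt_const v),
    fderiv_clm_apply hψ2 (differentiableAt_const w),
    fderiv_fun_comp (g := bil C) z hB hψ1] at h1
  simpa using h1.symm

/-- The transformation law of the Christoffel symbols. -/
theorem christoffelMap_pullback {G G' : Coord n → Matrix (Fin n) (Fin n) ℝ}
    {ψ : Coord n → Coord n} {z : Coord n} (hψ : ContDiffAt ℝ 2 ψ z)
    (hd : ∀ i j, DifferentiableAt ℝ (ent G i j) (ψ z))
    (hd' : ∀ i j, DifferentiableAt ℝ (ent G' i j) z)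
    (hG : IsUnit (G (ψ z)).det) (hG' : IsUnit (G' z).det) (hs : (G (ψ z)).IsSymm)
    (h : ∀ᶠ x in 𝓝 z, ∀ v w, bil (ent G') x v w =
      bil (ent G) (ψ x) (fderiv ℝ ψ x v) (fderiv ℝ ψ x w)) 
    (hA : Function.Surjective (fderiv ℝ ψ z)) (v w : Coord n) :
    fderiv ℝ ψ z (christoffelMap G' z v w) =
      christoffelMap G (ψ z) (fderiv ℝ ψ z v) (fderiv ℝ ψ z w)
        + fderiv ℝ (fderiv ℝ ψ) z v w := by
  rw [← sub_eq_zero]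
  refine bil_nondegenerate hG fun l' => ?_
  obtain ⟨l, rfl⟩ := hA l'
  have hsym : fderiv ℝ (fderiv ℝ ψ) z v w = fderiv ℝ (fderiv ℝ ψ) z w v :=
    (hψ.isSymmSndFDerivAt (by simp)).eq v w
  have hsym1 : fderiv ℝ (fderiv ℝ ψ) z v l = fderiv ℝ (fderiv ℝ ψ) z l v :=
    (hψ.isSymmSndFDerivAt (by simp)).eq v l
  have hsym2 : fderiv ℝ (fderiv ℝ ψ) z w l = fderiv ℝ (fderiv ℝ ψ) z l w :=
    (hψ.isSymmSndFDerivAt (by simp)).eq w l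
  -- Koszul's formula in both coordinate systems. The pull-back creates six terms in `D²ψ`; by
  -- symmetry of `D²ψ` and of the metric four of them cancel, and two equal ones give the
  -- inhomogeneous term.
  have k' := koszul hG' hd' l v w
  have k := koszul hG hd (fderiv ℝ ψ z l) (fderiv ℝ ψ z v) (fderiv ℝ ψ z w)
  rw [h.self_of_nhds, fderiv_pullback hψ hd hd' h, fderiv_pullback hψ hd hd' h,
    fderiv_pullback hψ hd hd' h] at k'
  rw [hsym1, hsym2, ← hsym, bil_comm hs (fderiv ℝ (fderiv ℝ ψ) z l w)] at k'
  simp only [map_sub, map_add]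
  linear_combination (1 / 2) * k' - (1 / 2) * k

/-- The covariant derivative transforms as a tensor. -/
theorem covMap_pullback {G G' : Coord n → Matrix (Fin n) (Fin n) ℝ}
    {C C' : Fin n → Fin n → Coord n → ℝ}
    {ψ : Coord n → Coord n} {z : Coord n} (hψ : ContDiffAt ℝ 2 ψ z)
    (hd : ∀ i j, DifferentiableAt ℝ (ent G i j) (ψ z))
    (hd' : ∀ i j, DifferentiableAt ℝ (ent G' i j) z)
    (hC : ∀ i j, DifferentiableAt ℝ (C i j) (ψ z))
    (hC' : ∀ i j, DifferentiableAt ℝ (C' i j) z)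
    (hG : IsUnit (G (ψ z)).det) (hG' : IsUnit (G' z).det) (hs : (G (ψ z)).IsSymm)
    (h : ∀ᶠ x in 𝓝 z, ∀ v w, bil (ent G') x v w =
      bil (ent G) (ψ x) (fderiv ℝ ψ x v) (fderiv ℝ ψ x w))
    (h' : ∀ᶠ x in 𝓝 z, ∀ v w, bil C' x v w = bil C (ψ x) (fderiv ℝ ψ x v) (fderiv ℝ ψ x w))
    (hA : Function.Surjective (fderiv ℝ ψ z)) (u v w : Coord n) :
    covMap G' C' z u v w =
      covMap G C (ψ z) (fderiv ℝ ψ z u) (fderiv ℝ ψ z v) (fderiv ℝ ψ z w) := by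
  simp only [covMap]
  -- The `D²ψ` terms from differentiating the pull-back are cancelled by the inhomogeneous terms of
  -- the Christoffel symbols.
  rw [fderiv_pullback hψ hC hC' h', h'.self_of_nhds, h'.self_of_nhds,
    christoffelMap_pullback hψ hd hd' hG hG' hs h hA,
    christoffelMap_pullback hψ hd hd' hG hG' hs h hA]
  simp only [map_add, add_apply]
  ring

end Coordinates

/-! ### Tensor fields in charts -/

section Charts

variable {M : Type*} [TopologicalSpace M] [ChartedSpace (Coord 4) M]

theorem mdifferentiable_of_mem_charts [IsManifold (𝓡 4) ∞ M]
    {e : OpenPartialHomeomorph M (Coord 4)} (he : e ∈ charts M) :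
    e.MDifferentiable (𝓡 4) (𝓡 4) :=
  ⟨(contMDiffOn_of_mem_maximalAtlas he).mdifferentiableOn (by simp),
    (contMDiffOn_symm_of_mem_maximalAtlas he).mdifferentiableOn (by simp)⟩

theorem contDiffOn_comp_symm [IsManifold (𝓡 4) ∞ M] {e : OpenPartialHomeomorph M (Coord 4)}
    (he : e ∈ charts M) {f : M → ℝ} (hf : ContMDiff (𝓡 4) 𝓘(ℝ, ℝ) ∞ f) :
    ContDiffOn ℝ ∞ (f ∘ e.symm) e.target :=
  (hf.comp_contMDiffOn (contMDiffOn_symm_of_mem_maximalAtlas he)).contDiffOn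

/-- Tangent spaces at equal points are distinct types with the same underlying model space; this
moves the base point while keeping the vectors as elements of `Coord 4`. -/
theorem Tensor2.congr_point (C : Tensor2 M) {x x' : M} (h : x = x') (v w : Coord 4) :
    C x (v : TangentSpace (𝓡 4) x) (w : TangentSpace (𝓡 4) x) =
      C x' (v : TangentSpace (𝓡 4) x') (w : TangentSpace (𝓡 4) x') := by
  subst h
  rfl

theorem bil_eq_of_ev {n : ℕ} {F : Type*} [AddCommGroup F] [Module ℝ F]
    (B : LinearMap.BilinForm ℝ F) (L : Coord n →ₗ[ℝ] F) {C : Fin n → Fin n → Coord n → ℝ}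
    {y : Coord n} (h : ∀ i j, C i j y = B (L (ev i)) (L (ev j))) (v w : Coord n) :
    bil C y v w = B (L v) (L w) := by
  induction v using coord_induction with
  | h0 => simp
  | hadd l l' h h' => simp [h, h']
  | hsmul c l h => simp [h]
  | hev i =>
  induction w using coord_induction with
  | h0 => simp
  | hadd l l' h h' => simp [h, h']
  | hsmul c l h => simp [h]
  | hev j => rw [bil_ev, h]

theorem bil_comp (e : OpenPartialHomeomorph M (Coord 4)) (C : Tensor2 M) (y v w : Coord 4) :
    bil (comp e C) y v w =
      C (e.symm y) (mfderiv (𝓡 4) (𝓡 4) e.symm y v) (mfderiv (𝓡 4) (𝓡 4) e.symm y w) :=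
  bil_eq_of_ev (C (e.symm y)) (mfderiv (𝓡 4) (𝓡 4) e.symm y).toLinearMap (fun _ _ => rfl) v w

theorem dform_frame [IsManifold (𝓡 4) ∞ M] {e : OpenPartialHomeomorph M (Coord 4)}
    (he : e ∈ charts M) {f : M → ℝ} (hf : ContMDiff (𝓡 4) 𝓘(ℝ, ℝ) ∞ f) {y : Coord 4}
    (hy : y ∈ e.target) (i : Fin 4) :
    dform f (e.symm y) (frame e i y) = pd i (f ∘ e.symm) y := by
  have h := mfderiv_comp y ((hf (e.symm y)).mdifferentiableAt (by simp))
    ((mdifferentiable_of_mem_charts he).mdifferentiableAt_symm hy)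
  rw [mfderiv_eq_fderiv] at h
  simp only [pd, h]
  rfl

theorem contDiffAt_transition [IsManifold (𝓡 4) ∞ M] {e e' : OpenPartialHomeomorph M (Coord 4)}
    (he : e ∈ charts M) (he' : e' ∈ charts M) {y : Coord 4} (hy : y ∈ e'.target)
    (hy' : e'.symm y ∈ e.source) : ContDiffAt ℝ ∞ (e ∘ e'.symm) y := by
  have h1 := contMDiffAt_symm_of_mem_maximalAtlas he' hy
  have h2 := contMDiffAt_of_mem_maximalAtlas he hy'
  exact (h2.comp y h1).contDiffAt

/-- Chain rule for `e'.symm = e.symm ∘ (e ∘ e'.symm)`, valid near `y`. -/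
theorem mfderiv_symm_transition [IsManifold (𝓡 4) ∞ M]
    {e e' : OpenPartialHomeomorph M (Coord 4)}
    (he : e ∈ charts M) (he' : e' ∈ charts M) {y : Coord 4} (hy : y ∈ e'.target)
    (hy' : e'.symm y ∈ e.source) (v : Coord 4) :
    (mfderiv (𝓡 4) (𝓡 4) e'.symm y v : Coord 4) =
      mfderiv (𝓡 4) (𝓡 4) e.symm (e (e'.symm y)) (fderiv ℝ (e ∘ e'.symm) y v) := by
  have hev : e'.symm =ᶠ[𝓝 y] e.symm ∘ (e ∘ e'.symm) := by
    have h1 := e'.symm.continuousAt hy (e.open_source.mem_nhds hy')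
    filter_upwards [h1] with x hx
    exact (e.left_inv hx).symm
  rw [hev.mfderiv_eq, mfderiv_comp y (I' := 𝓡 4)]
  · rw [mfderiv_eq_fderiv]
    rfl
  · exact (mdifferentiable_of_mem_charts he).mdifferentiableAt_symm (e.map_source hy')
  · exact ((contDiffAt_transition he he' hy hy').differentiableAt (by simp)).mdifferentiableAt

/-- The transformation law of the components of a tensor field. -/
theorem bil_comp_transition [IsManifold (𝓡 4) ∞ M]
    {e e' : OpenPartialHomeomorph M (Coord 4)}
    (he : e ∈ charts M) (he' : e' ∈ charts M) (C : Tensor2 M) {y : Coord 4} (hy : y ∈ e'.target)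
    (hy' : e'.symm y ∈ e.source) (v w : Coord 4) :
    bil (comp e' C) y v w = bil (comp e C) ((e ∘ e'.symm) y)
      (fderiv ℝ (e ∘ e'.symm) y v) (fderiv ℝ (e ∘ e'.symm) y w) := by
  rw [bil_comp, bil_comp]
  refine (C.congr_point (e.left_inv hy').symm _ _).trans ?_
  rw [mfderiv_symm_transition he he' hy hy' v, mfderiv_symm_transition he he' hy hy' w]
  rfl

theorem bijective_fderiv_transition [IsManifold (𝓡 4) ∞ M]
    {e e' : OpenPartialHomeomorph M (Coord 4)}
    (he : e ∈ charts M) (he' : e' ∈ charts M) {y : Coord 4} (hy : y ∈ e'.target)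
    (hy' : e'.symm y ∈ e.source) : Function.Bijective (fderiv ℝ (e ∘ e'.symm) y) := by
  have h := ((mdifferentiable_of_mem_charts he').symm.trans
    (mdifferentiable_of_mem_charts he)).mfderiv_bijective (x := y) (by simp [hy, hy'])
  rwa [OpenPartialHomeomorph.coe_trans, mfderiv_eq_fderiv] at h

theorem isSymm_mat (g : LorentzMetric M) (e : OpenPartialHomeomorph M (Coord 4)) (y : Coord 4) :
    (g.mat e y).IsSymm := by
  ext i j
  exact g.symmetric _ _ _

theorem LorentzMetric.nondegenerate (g : LorentzMetric M) (x : M)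
    (v : TangentSpace (𝓡 4) x) (h : ∀ w, g.tensor x v w = 0) : v = 0 := by
  obtain ⟨b, hb⟩ := g.signature x
  refine b.repr.map_eq_zero_iff.mp (Finsupp.ext fun i => ?_)
  have h1 := h (b i)
  rw [← b.sum_repr v] at h1
  simp only [map_sum, map_smul, LinearMap.sum_apply, LinearMap.smul_apply, hb, smul_eq_mul,
    mul_ite, mul_zero, Finset.sum_ite_eq', Finset.mem_univ, if_true] at h1
  split_ifs at h1 <;> simpa using h1

/-- The chart identifies tangent spaces with `Coord 4`, so a kernel vector of the component matrix
would be a nonzero tangent vector orthogonal to everything. -/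
theorem isUnit_det_mat [IsManifold (𝓡 4) ∞ M] (g : LorentzMetric M)
    {e : OpenPartialHomeomorph M (Coord 4)} (he : e ∈ charts M) {y : Coord 4}
    (hy : y ∈ e.target) : IsUnit (g.mat e y).det := by
  rw [isUnit_iff_ne_zero]
  intro h0
  obtain ⟨v, hv, hv0⟩ := Matrix.exists_mulVec_eq_zero_iff.mpr h0
  have hbij := (mdifferentiable_of_mem_charts he).symm.mfderiv_bijective (x := y) hy
  have h1 : ∀ w, bil (comp e g.tensor) y w (WithLp.toLp 2 v) = 0 := by
    intro w
    induction w using coord_induction with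
    | h0 => simp
    | hadd l l' h h' => simp [h, h']
    | hsmul c l h => simp [h]
    | hev i =>
    rw [coord_eq_sum (WithLp.toLp 2 v)]
    simp only [map_sum, map_smul, bil_ev, smul_eq_mul]
    have := congrFun hv0 i
    simpa [Matrix.mulVec, dotProduct, mul_comm, LorentzMetric.mat] using this
  have h2 : (mfderiv (𝓡 4) (𝓡 4) e.symm y (WithLp.toLp 2 v : Coord 4)) = 0 := by
    refine g.nondegenerate _ _ fun w => ?_
    obtain ⟨w', rfl⟩ := hbij.2 w
    rw [g.symmetric]
    exact (bil_comp e g.tensor y w' _).symm.trans (h1 w')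
  have h3 : (WithLp.toLp 2 v : Coord 4) = 0 := hbij.1 (h2.trans (map_zero _).symm)
  exact hv (by simpa using congrArg WithLp.ofLp h3)

theorem differentiableAt_comp {C : Tensor2 M} (hC : SmoothTensor C)
    {e : OpenPartialHomeomorph M (Coord 4)} (he : e ∈ charts M) {y : Coord 4}
    (hy : y ∈ e.target) (i j : Fin 4) : DifferentiableAt ℝ (comp e C i j) y :=
  ((hC e he i j).contDiffAt (e.open_target.mem_nhds hy)).differentiableAt (by simp)

/-- The Codazzi equation need only be checked in one chart around each point. -/
theorem isCodazzi_of_local [IsManifold (𝓡 4) ∞ M] {g : LorentzMetric M} {C : Tensor2 M}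
    (hC : SmoothTensor C) (hs : SymmetricTensor C)
    (h : ∀ p : M, ∃ e ∈ charts M, p ∈ e.source ∧ ∀ j k l,
      cov (g.mat e) (comp e C) j k l (e p) = cov (g.mat e) (comp e C) k j l (e p)) :
    IsCodazzi g C := by
  refine ⟨hC, hs, fun e' he' y hy j k l => ?_⟩
  obtain ⟨e, he, hp, hcov⟩ := h (e'.symm y)
  have hψ := contDiffAt_transition he he' hy hp
  have hy2 : e (e'.symm y) ∈ e.target := e.map_source hp
  have hnear : ∀ᶠ x in 𝓝 y, x ∈ e'.target ∧ e'.symm x ∈ e.source :=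
    (e'.open_target.eventually_mem hy).and (e'.symm.continuousAt hy (e.open_source.mem_nhds hp))
  have key := covMap_pullback (G := g.mat e) (G' := g.mat e') (C := comp e C) (C' := comp e' C)
    (hψ.of_le (by norm_cast)) (differentiableAt_comp g.smooth he hy2)
    (differentiableAt_comp g.smooth he' hy)
    (differentiableAt_comp hC he hy2) (differentiableAt_comp hC he' hy)
    (isUnit_det_mat g he hy2) (isUnit_det_mat g he' hy) (isSymm_mat g e _)
    (hnear.mono fun x hx => bil_comp_transition he he' g.tensor hx.1 hx.2)
    (hnear.mono fun x hx => bil_comp_transition he he' C hx.1 hx.2)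
    (bijective_fderiv_transition he he' hy hp).2
  rw [← covMap_ev (differentiableAt_comp hC he' hy), ← covMap_ev (differentiableAt_comp hC he' hy),
    key, key]
  exact covMap_comm (differentiableAt_comp hC he hy2) hcov _ _ _

theorem symmetric_mimeticTensor {g : LorentzMetric M} {φ ζ : M → ℝ} {V : ℝ → ℝ} :
    SymmetricTensor (mimeticTensor g φ ζ V) := by
  intro x v w
  simp only [mimeticTensor, LinearMap.add_apply, LinearMap.smul_apply,
    LinearMap.BilinForm.linMulLin_apply, g.symmetric x v w, smul_eq_mul]
  ring

end Charts

/-! ### The mimetic tensor -/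

section Mimetic

variable {M : Type*} [TopologicalSpace M] [ChartedSpace (Coord 4) M] [IsManifold (𝓡 4) ∞ M]
  {g : LorentzMetric M} {T : Tensor2 M} {φ ζ : M → ℝ} {V : ℝ → ℝ}
  {e : OpenPartialHomeomorph M (Coord 4)}

theorem comp_mimeticTensor (he : e ∈ charts M) (hφ : ContMDiff (𝓡 4) 𝓘(ℝ, ℝ) ∞ φ)
    {y : Coord 4} (hy : y ∈ e.target) (k l : Fin 4) :
    comp e (mimeticTensor g φ ζ V) k l y =
      2 * ζ (e.symm y) * (pd k (φ ∘ e.symm) y * pd l (φ ∘ e.symm) y)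
        + (1 / 3) * (2 * ζ (e.symm y) - V (φ (e.symm y))) * g.mat e y k l := by
  rw [← dform_frame he hφ hy, ← dform_frame he hφ hy]
  simp [comp, mimeticTensor, velocity, LorentzMetric.mat]

theorem IsMimeticSolution.contDiffOn_potential (h : IsMimeticSolution g T φ ζ V)
    (he : e ∈ charts M) : ContDiffOn ℝ ∞ (fun y => V (φ (e.symm y))) e.target :=
  h.smooth_potential.comp (contDiffOn_comp_symm he h.smooth_field) fun _ _ => mem_range_self _

theorem contDiffOn_pd {n : ℕ} {s : Set (Coord n)} (hs : IsOpen s) {f : Coord n → ℝ}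
    (hf : ContDiffOn ℝ ∞ f s) (i : Fin n) : ContDiffOn ℝ ∞ (pd i f) s :=
  (hf.fderiv_of_isOpen hs (m := ∞) (by simp)).clm_apply contDiffOn_const

theorem IsMimeticSolution.smooth_mimeticTensor (h : IsMimeticSolution g T φ ζ V) :
    SmoothTensor (mimeticTensor g φ ζ V) := by
  intro e he i j
  have hφ := contDiffOn_comp_symm he h.smooth_field
  have hζ := contDiffOn_comp_symm he h.smooth_multiplier
  have hV := h.contDiffOn_potential he
  have hi := contDiffOn_pd e.open_target hφ i
  have hj := contDiffOn_pd e.open_target hφ j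
  have hg := g.smooth e he i j
  refine ContDiffOn.congr ?_ fun y hy => comp_mimeticTensor he h.smooth_field hy i j
  exact ((contDiffOn_const.mul hζ).mul (hi.mul hj)).add
    ((contDiffOn_const.mul ((contDiffOn_const.mul hζ).sub hV)).mul hg)

/-- The unit gradient contributes `-2ζ`, and the isotropic part contributes `4 · (2ζ - V)/3`, as
`g^{kl} gₖₗ = 4`. -/
theorem trace_mimeticTensor (h : IsMimeticSolution g T φ ζ V) (he : e ∈ charts M)
    {y : Coord 4} (hy : y ∈ e.target) :
    trace (g.mat e) (comp e (mimeticTensor g φ ζ V)) y =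
      (1 / 3) * (2 * ζ (e.symm y) - 4 * V (φ (e.symm y))) := by
  have h1 := h.unit_gradient e he y hy
  have h2 : ∑ k, ∑ l, (g.mat e y)⁻¹ k l * g.mat e y k l = 4 := by
    have h3 := Matrix.nonsing_inv_mul _ (isUnit_det_mat g he hy)
    have h4 : ∀ k, ∑ l, (g.mat e y)⁻¹ k l * g.mat e y k l = 1 := fun k => by
      have h5 := congrFun (congrFun h3 k) k
      rw [Matrix.mul_apply, Matrix.one_apply_eq] at h5
      rw [← h5]
      exact Finset.sum_congr rfl fun l _ => by rw [(isSymm_mat g e y).apply]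
    simp [h4]
  calc _ = ∑ k, ∑ l, ((2 * ζ (e.symm y)) *
        ((g.mat e y)⁻¹ k l * (pd k (φ ∘ e.symm) y * pd l (φ ∘ e.symm) y))
        + (1 / 3) * (2 * ζ (e.symm y) - V (φ (e.symm y))) *
          ((g.mat e y)⁻¹ k l * g.mat e y k l)) := by
        refine Finset.sum_congr rfl fun k _ => Finset.sum_congr rfl fun l _ => ?_
        rw [comp_mimeticTensor he h.smooth_field hy]
        ring
    _ = _ := by
        simp only [Finset.sum_add_distrib, ← Finset.mul_sum, h1, h2]
        ring

/-- For a mimetic solution, the field equation is that of Cotton gravity as soon as the mimetic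
tensor is Codazzi. -/
theorem IsMimeticSolution.isCottonEquation_iff (h : IsMimeticSolution g T φ ζ V) :
    IsCottonEquation g T (mimeticTensor g φ ζ V) ↔ IsCodazzi g (mimeticTensor g φ ζ V) := by
  refine ⟨fun hc => hc.2, fun hc => ⟨fun e he y hy k l => ?_, hc⟩⟩
  -- The coefficient of `g` works out because `(2ζ - V)/3 - (2ζ - 4V)/3 = V`.
  rw [h.field_equation e he y hy, trace_mimeticTensor h he hy,
    comp_mimeticTensor he h.smooth_field hy]
  ring

end Mimetic

/-! ### Smooth dependence of solutions of differential equations on initial conditions -/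

section Flow

open ContinuousMap

universe u

variable {K : Type*} [TopologicalSpace K] [CompactSpace K]
  {E F : Type u} [NormedAddCommGroup E] [NormedSpace ℝ E] [NormedAddCommGroup F] [NormedSpace ℝ F]

/-- A bounded bilinear map, as a continuous linear map. -/
def bilinCLM {X Y Z : Type*} [NormedAddCommGroup X] [NormedSpace ℝ X] [NormedAddCommGroup Y]
    [NormedSpace ℝ Y] [NormedAddCommGroup Z] [NormedSpace ℝ Z] (b : X → Y → Z)
    (h1 : ∀ x x' y, b (x + x') y = b x y + b x' y) (h2 : ∀ (c : ℝ) x y, b (c • x) y = c • b x y)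
    (h3 : ∀ x y y', b x (y + y') = b x y + b x y') (h4 : ∀ (c : ℝ) x y, b x (c • y) = c • b x y)
    (h5 : ∀ x y, ‖b x y‖ ≤ ‖x‖ * ‖y‖) : X →L[ℝ] Y →L[ℝ] Z :=
  LinearMap.mkContinuous₂ (LinearMap.mk₂ ℝ b h1 h2 h3 h4) 1 (by simpa using h5)

/-- Pointwise application of a family of linear maps to a family of vectors. -/
def applyCLM (K : Type*) [TopologicalSpace K] [CompactSpace K] (E F : Type u)
    [NormedAddCommGroup E] [NormedSpace ℝ E] [NormedAddCommGroup F] [NormedSpace ℝ F] :=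
  bilinCLM
    (fun (A : C(K, E →L[ℝ] F)) (h : C(K, E)) => (⟨fun k => A k (h k), by fun_prop⟩ : C(K, F)))
    (fun A B h => by ext; simp) (fun c A h => by ext; simp) (fun A h h' => by ext; simp)
    (fun c A h => by ext; simp) fun A h => by
      rw [ContinuousMap.norm_le _ (by positivity)]
      intro k
      exact ((A k).le_opNorm _).trans (mul_le_mul (A.norm_coe_le_norm k) (h.norm_coe_le_norm k)
        (norm_nonneg _) (norm_nonneg A))

/-- Compact support makes `f'` uniformly continuous, so the mean value estimate of the remainder is
uniform over the points of `K`. -/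
theorem hasFDerivAt_comp_left {f : E → F} (hf : ContDiff ℝ ∞ f) (hs : HasCompactSupport f)
    (γ : C(K, E)) :
    HasFDerivAt (fun γ : C(K, E) => (⟨f, hf.continuous⟩ : C(E, F)).comp γ)
      (applyCLM K E F
        ((⟨fderiv ℝ f, hf.continuous_fderiv (by simp)⟩ : C(E, E →L[ℝ] F)).comp γ)) γ := by
  have huc : UniformContinuous (fderiv ℝ f) :=
    (hs.fderiv ℝ).uniformContinuous_of_continuous (hf.continuous_fderiv (by simp))
  refine HasFDerivAt.of_isLittleO ?_
  rw [Asymptotics.isLittleO_iff]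
  intro ε hε
  obtain ⟨δ, hδ, hδ'⟩ := Metric.uniformContinuous_iff.mp huc ε hε
  filter_upwards [Metric.ball_mem_nhds γ hδ] with γ' hγ'
  rw [ContinuousMap.norm_le _ (by positivity)]
  intro k
  have hk : γ' k ∈ Metric.ball (γ k) δ :=
    (ContinuousMap.dist_apply_le_dist (f := γ') (g := γ) k).trans_lt hγ'
  have h1 := (convex_ball (γ k) δ).norm_image_sub_le_of_norm_hasFDerivWithin_le' (f := f)
    (f' := fderiv ℝ f) (φ := fderiv ℝ f (γ k)) (C := ε)
    (fun x _ => (hf.differentiable (by simp) x).hasFDerivAt.hasFDerivWithinAt)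
    (fun x hx => (dist_eq_norm (fderiv ℝ f x) _ ▸ (hδ' hx).le))
    (Metric.mem_ball_self hδ) hk
  exact h1.trans (mul_le_mul_of_nonneg_left ((γ' - γ).norm_coe_le_norm k) hε.le)

/-- The derivative of the composition operator is again a composition operator, with `fderiv ℝ f`,
followed by the bounded map `applyCLM`. The target changes from `F` to `E →L[ℝ] F` in the induction,
hence the generalization over `F` and the common universe. -/
theorem contDiff_comp_left_nat (n : ℕ) : ∀ {F : Type u} [NormedAddCommGroup F] [NormedSpace ℝ F]
    {f : E → F} (hf : ContDiff ℝ ∞ f) (_ : HasCompactSupport f),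
    ContDiff ℝ n (fun γ : C(K, E) => (⟨f, hf.continuous⟩ : C(E, F)).comp γ) := by
  induction n with
  | zero =>
    intro F _ _ f hf hs
    exact contDiff_zero.mpr (ContinuousMap.continuous_postcomp _)
  | succ n ih =>
    intro F _ _ f hf hs
    have hd := hasFDerivAt_comp_left (K := K) hf hs
    rw [Nat.cast_succ, contDiff_succ_iff_fderiv]
    refine ⟨fun γ => (hd γ).differentiableAt, by simp, ?_⟩
    rw [show fderiv ℝ _ = _ from funext fun γ => (hd γ).fderiv]
    exact (applyCLM K E F).contDiff.comp
      (ih (hf.fderiv_right (m := ∞) (by simp)) (hs.fderiv ℝ))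

/-- Composition with a smooth map is a smooth operator on spaces of continuous functions. -/
theorem contDiff_comp_left {f : E → F} (hf : ContDiff ℝ ∞ f) (hs : HasCompactSupport f) :
    ContDiff ℝ ∞ (fun γ : C(K, E) => (⟨f, hf.continuous⟩ : C(E, F)).comp γ) :=
  contDiff_infty.mpr fun n => contDiff_comp_left_nat n hf hs

/-! ### The Picard equation on the unit interval, with time rescaled by a parameter -/

open MeasureTheory unitInterval

variable [CompleteSpace E]

/-- The primitive `τ ↦ ∫₀^τ γ` on the unit interval. -/
def primitiveCLM (E : Type u) [NormedAddCommGroup E] [NormedSpace ℝ E] [CompleteSpace E] :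
    C(I, E) →L[ℝ] C(I, E) :=
  LinearMap.mkContinuous
    { toFun := fun γ => ⟨fun τ => ∫ r in (0 : ℝ)..τ, γ (projIcc 0 1 zero_le_one r),
        (intervalIntegral.continuous_primitive (fun a b =>
          (γ.continuous.comp continuous_projIcc).intervalIntegrable a b) 0).comp
          continuous_subtype_val⟩
      map_add' := fun γ γ' => by
        ext τ
        exact intervalIntegral.integral_add
          ((γ.continuous.comp continuous_projIcc).intervalIntegrable _ _)
          ((γ'.continuous.comp continuous_projIcc).intervalIntegrable _ _)
      map_smul' := fun c γ => by
        ext τ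
        exact intervalIntegral.integral_smul c _ } 1 fun γ => by
    rw [ContinuousMap.norm_le _ (by positivity)]
    intro τ
    have h := intervalIntegral.norm_integral_le_of_norm_le_const (a := 0) (b := (τ : ℝ))
      (f := fun r => γ (projIcc 0 1 zero_le_one r)) (C := ‖γ‖)
      fun r _ => γ.norm_coe_le_norm _
    refine h.trans ?_
    rw [mul_comm, sub_zero, abs_of_nonneg τ.2.1]
    exact mul_le_mul_of_nonneg_right τ.2.2 (norm_nonneg _)

/-- If `γ' = s f(γ)` then `Φ = τ f(γ)` satisfies `Φ' = f(γ) + s f'(γ) Φ`. -/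
theorem primitive_variation {f : E → E} (hf : ContDiff ℝ ∞ f) {s : ℝ} {x : E} {γ : C(I, E)}
    (hγ : γ = ContinuousMap.const I x
      + s • primitiveCLM E ((⟨f, hf.continuous⟩ : C(E, E)).comp γ))
    (Φ : C(I, E)) (hΦ : ∀ τ : I, Φ τ = (τ : ℝ) • f (γ τ)) :
    Φ = primitiveCLM E ((⟨f, hf.continuous⟩ : C(E, E)).comp γ)
      + s • primitiveCLM E (applyCLM I E E
        ((⟨fderiv ℝ f, hf.continuous_fderiv (by simp)⟩ : C(E, E →L[ℝ] E)).comp γ) Φ) := by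
  -- Clamping to the unit interval extends the integrands to `ℝ`, so that two-sided derivatives
  -- exist also at the endpoints.
  set pr := projIcc (0 : ℝ) 1 zero_le_one with hpr
  have hprc : Continuous pr := continuous_projIcc
  set γt : ℝ → E := fun τ => x + s • ∫ r in (0 : ℝ)..τ, f (γ (pr r)) with hγt
  have hcont : Continuous fun r => f (γ (pr r)) :=
    hf.continuous.comp (γ.continuous.comp hprc)
  have hγt_eq : ∀ τ : I, γt τ = γ τ := fun τ => by
    conv_rhs => rw [hγ]
    rfl
  have hγt_deriv : ∀ τ, HasDerivAt γt (s • f (γ (pr τ))) τ := fun τ =>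
    ((hcont.integral_hasStrictDerivAt 0 τ).hasDerivAt.const_smul s).const_add x
  have hfc : ∀ τ, HasDerivAt (fun τ => f (γt τ)) (fderiv ℝ f (γt τ) (s • f (γ (pr τ)))) τ :=
    fun τ => (hf.differentiable (by simp) (γt τ)).hasFDerivAt.comp_hasDerivAt τ (hγt_deriv τ)
  have hprod : ∀ τ, HasDerivAt (fun τ : ℝ => τ • f (γt τ))
      (τ • fderiv ℝ f (γt τ) (s • f (γ (pr τ))) + (1 : ℝ) • f (γt τ)) τ := fun τ =>
    (hasDerivAt_id τ).smul (hfc τ)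
  have hγtc : Continuous γt := continuous_iff_continuousAt.mpr fun τ => (hγt_deriv τ).continuousAt
  have hfdc : Continuous fun τ => fderiv ℝ f (γ (pr τ)) :=
    (hf.continuous_fderiv (by simp)).comp (γ.continuous.comp hprc)
  have hvc : Continuous fun r => s • fderiv ℝ f (γ (pr r)) (Φ (pr r)) :=
    (hfdc.clm_apply (Φ.continuous.comp hprc)).const_smul s
  ext τ
  -- The integrand is the derivative of `r • f (γt r)` on the unit interval, so its primitive is
  -- `Φ`.
  have hftc : ∫ r in (0 : ℝ)..τ, (f (γ (pr r)) + s • fderiv ℝ f (γ (pr r)) (Φ (pr r))) =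
      (τ : ℝ) • f (γt τ) - (0 : ℝ) • f (γt 0) := by
    refine intervalIntegral.integral_eq_sub_of_hasDerivAt
      (f := fun r : ℝ => r • f (γt r)) (fun r hr => ?_) ?_
    · rw [uIcc_of_le τ.2.1] at hr
      have hr1 : r ∈ Icc (0 : ℝ) 1 := ⟨hr.1, hr.2.trans τ.2.2⟩
      have h1 : pr r = ⟨r, hr1⟩ := projIcc_of_mem _ hr1
      have h2 : γt r = γ (pr r) := by rw [h1]; exact hγt_eq ⟨r, hr1⟩
      convert hprod r using 1
      rw [h2, hΦ, h1]
      simp only [map_smul, one_smul]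
      rw [smul_comm, add_comm]
    · exact (hcont.add hvc).intervalIntegrable _ _
  rw [intervalIntegral.integral_add (hcont.intervalIntegrable _ _) (hvc.intervalIntegrable _ _),
    intervalIntegral.integral_smul, hγt_eq, zero_smul, sub_zero] at hftc
  rw [hΦ, ← hftc]
  rfl

/-- The map whose local inverse solves `γ' = s f(γ)`, `γ(0) = x` on the unit interval. -/
def picardMap {f : E → E} (hf : Continuous f) (p : ℝ × E × C(I, E)) : ℝ × E × C(I, E) :=
  (p.1, p.2.1, p.2.2 - ContinuousMap.const I p.2.1
    - p.1 • primitiveCLM E ((⟨f, hf⟩ : C(E, E)).comp p.2.2))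

/-- Constant functions. -/
def constCLM (K : Type*) [TopologicalSpace K] [CompactSpace K] (E : Type u)
    [NormedAddCommGroup E] [NormedSpace ℝ E] : E →L[ℝ] C(K, E) :=
  LinearMap.mkContinuous
    { toFun := fun x => ContinuousMap.const K x
      map_add' := fun _ _ => rfl
      map_smul' := fun _ _ => rfl } 1 fun x => by
    rw [ContinuousMap.norm_le _ (by positivity), one_mul]
    exact fun _ => le_rfl

theorem contDiff_picardMap {f : E → E} (hf : ContDiff ℝ ∞ f) (hs : HasCompactSupport f) :
    ContDiff ℝ ∞ (picardMap hf.continuous) := by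
  have h1 : ContDiff ℝ ∞ fun p : ℝ × E × C(I, E) => p.2.1 := contDiff_fst.comp contDiff_snd
  have h2 : ContDiff ℝ ∞ fun p : ℝ × E × C(I, E) => p.2.2 := contDiff_snd.comp contDiff_snd
  exact contDiff_fst.prodMk (h1.prodMk ((h2.sub ((constCLM I E).contDiff.comp h1)).sub
    (contDiff_fst.smul ((primitiveCLM E).contDiff.comp ((contDiff_comp_left hf hs).comp h2)))))

theorem fderiv_picardMap {f : E → E} (hf : ContDiff ℝ ∞ f) (hs : HasCompactSupport f)
    (p v : ℝ × E × C(I, E)) :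
    fderiv ℝ (picardMap hf.continuous) p v =
      (v.1, v.2.1, v.2.2 - constCLM I E v.2.1
        - (p.1 • primitiveCLM E (applyCLM I E E
            ((⟨fderiv ℝ f, hf.continuous_fderiv (by simp)⟩ : C(E, E →L[ℝ] E)).comp p.2.2) v.2.2)
          + v.1 • primitiveCLM E ((⟨f, hf.continuous⟩ : C(E, E)).comp p.2.2))) := by
  have h1 : HasFDerivAt (fun p : ℝ × E × C(I, E) => p.2.1)
      ((ContinuousLinearMap.fst ℝ E C(I, E)).comp (ContinuousLinearMap.snd ℝ ℝ (E × C(I, E)))) p :=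
    ((ContinuousLinearMap.fst ℝ E C(I, E)).comp (ContinuousLinearMap.snd ℝ ℝ (E × C(I, E)))).hasFDerivAt
  have h2 : HasFDerivAt (fun p : ℝ × E × C(I, E) => p.2.2)
      ((ContinuousLinearMap.snd ℝ E C(I, E)).comp (ContinuousLinearMap.snd ℝ ℝ (E × C(I, E)))) p :=
    ((ContinuousLinearMap.snd ℝ E C(I, E)).comp (ContinuousLinearMap.snd ℝ ℝ (E × C(I, E)))).hasFDerivAt
  have h3 := (hasFDerivAt_comp_left (K := I) hf hs p.2.2).comp p h2
  have h4 := (primitiveCLM E).hasFDerivAt.comp p h3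
  have h5 := (hasFDerivAt_fst (𝕜 := ℝ) (p := p)).smul h4
  have h6 := (h2.sub ((constCLM I E).hasFDerivAt.comp p h1)).sub h5
  have h7 := (hasFDerivAt_fst (𝕜 := ℝ) (p := p)).prodMk (h1.prodMk h6)
  have h8 : HasFDerivAt (picardMap hf.continuous) _ p := h7
  rw [h8.fderiv]
  rfl

/-- At parameter `s = 0` the integral term is multiplied by zero, the derivative is triangular with
identity diagonal, and its inverse is explicit. Invertibility is an open condition, so this one
value suffices. -/
theorem isInvertible_fderiv_picardMap {f : E → E} (hf : ContDiff ℝ ∞ f) (hs : HasCompactSupport f)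
    (x₀ : E) (γ : C(I, E)) :
    ∃ A : (ℝ × E × C(I, E)) ≃L[ℝ] (ℝ × E × C(I, E)),
      (A : (ℝ × E × C(I, E)) →L[ℝ] (ℝ × E × C(I, E))) =
        fderiv ℝ (picardMap hf.continuous) (0, x₀, γ) := by
  refine ⟨ContinuousLinearEquiv.ofBijective (fderiv ℝ (picardMap hf.continuous) (0, x₀, γ)) ?_ ?_,
    rfl⟩
  · rw [LinearMap.ker_eq_bot']
    intro v hv
    replace hv : fderiv ℝ (picardMap hf.continuous) (0, x₀, γ) v = 0 := hv
    rw [fderiv_picardMap hf hs] at hv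
    obtain ⟨v1, v2, v3⟩ := v
    simp only [Prod.mk_eq_zero] at hv
    obtain ⟨h1, h2, h3⟩ := hv
    subst h1 h2
    simpa using h3
  · rw [LinearMap.range_eq_top]
    rintro ⟨w1, w2, w3⟩
    refine ⟨(w1, w2, w3 + constCLM I E w2
      + w1 • primitiveCLM E ((⟨f, hf.continuous⟩ : C(E, E)).comp γ)), ?_⟩
    change fderiv ℝ (picardMap hf.continuous) (0, x₀, γ) _ = _
    rw [fderiv_picardMap hf hs]
    simp only [zero_smul, zero_add, Prod.mk.injEq, true_and]
    abel

/-- Smooth dependence on initial conditions: a smooth vector field with compact support has a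
smooth local flow. -/
theorem exists_smooth_flow {f : E → E} (hf : ContDiff ℝ ∞ f) (hs : HasCompactSupport f) (x₀ : E) :
    ∃ (Ψ : ℝ × E → E) (W : Set (ℝ × E)), IsOpen W ∧ ((0 : ℝ), x₀) ∈ W ∧ ContDiffOn ℝ ∞ Ψ W ∧
      (∀ x, ((0 : ℝ), x) ∈ W → Ψ (0, x) = x) ∧ ∀ q ∈ W, fderiv ℝ Ψ q (1, 0) = f (Ψ q) := by
  set H := picardMap hf.continuous with hH
  have hHs : ContDiff ℝ ∞ H := contDiff_picardMap hf hs
  set p₀ : ℝ × E × C(I, E) := (0, x₀, ContinuousMap.const I x₀) with hp₀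
  have hHp₀ : H p₀ = (0, x₀, 0) := by simp [hH, hp₀, picardMap]
  obtain ⟨A₀, hA₀⟩ := isInvertible_fderiv_picardMap hf hs x₀ (ContinuousMap.const I x₀)
  have hd : HasFDerivAt H (A₀ : (ℝ × E × C(I, E)) →L[ℝ] (ℝ × E × C(I, E))) p₀ := by
    rw [hA₀]
    exact (hHs.differentiable (by simp) p₀).hasFDerivAt
  -- The local inverse sends `(s, x, 0)` to `(s, x, γ)`, where `γ(τ)` is the solution from `x` at
  -- time `sτ`. The flow is therefore `γ(1)`, which is read off by `L`.
  set R := hHs.contDiffAt.toOpenPartialHomeomorph H hd (by simp) with hR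
  have hRH : ∀ a ∈ R.target, H (R.symm a) = a := fun a ha => R.right_inv ha
  -- Smoothness of the inverse at a point requires an invertible derivative there, so the domain is
  -- restricted to the open set where it is invertible.
  set O : Set (ℝ × E × C(I, E)) := {p | fderiv ℝ H p ∈ range ((↑) :
    ((ℝ × E × C(I, E)) ≃L[ℝ] (ℝ × E × C(I, E))) →
      ((ℝ × E × C(I, E)) →L[ℝ] (ℝ × E × C(I, E))))} with hO
  have hOo : IsOpen O := ContinuousLinearEquiv.isOpen.preimage (hHs.continuous_fderiv (by simp))
  have hU : IsOpen (R.target ∩ R.symm ⁻¹' O) := R.symm.isOpen_inter_preimage hOo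
  set j : ℝ × E → ℝ × E × C(I, E) := fun q => (q.1, q.2, 0) with hj
  have hjs : ContDiff ℝ ∞ j := contDiff_fst.prodMk (contDiff_snd.prodMk contDiff_const)
  set L : (ℝ × E × C(I, E)) →L[ℝ] E := (ContinuousMap.evalCLM ℝ (1 : I)).comp
    ((ContinuousLinearMap.snd ℝ E C(I, E)).comp (ContinuousLinearMap.snd ℝ ℝ (E × C(I, E)))) with hL
  have key : ∀ q ∈ j ⁻¹' (R.target ∩ R.symm ⁻¹' O), ∃ A : (ℝ × E × C(I, E)) ≃L[ℝ] (ℝ × E × C(I, E)),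
      HasFDerivAt H (A : (ℝ × E × C(I, E)) →L[ℝ] (ℝ × E × C(I, E))) (R.symm (j q)) := by
    rintro q ⟨-, A, hA⟩
    refine ⟨A, ?_⟩
    rw [hA]
    exact (hHs.differentiable (by simp) _).hasFDerivAt
  refine ⟨fun q => L (R.symm (j q)), j ⁻¹' (R.target ∩ R.symm ⁻¹' O),
    hU.preimage hjs.continuous, ⟨?_, ?_⟩, ?_, ?_, ?_⟩
  · change ((0 : ℝ), x₀, (0 : C(I, E))) ∈ R.target
    rw [← hHp₀]
    exact hHs.contDiffAt.image_mem_toOpenPartialHomeomorph_target hd (by simp)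
  · change R.symm ((0 : ℝ), x₀, (0 : C(I, E))) ∈ O
    rw [← hHp₀]
    have h1 : R.symm (R p₀) = p₀ :=
      R.left_inv (hHs.contDiffAt.mem_toOpenPartialHomeomorph_source hd (by simp))
    rw [show H p₀ = R p₀ from rfl, h1]
    exact ⟨A₀, hA₀⟩
  · intro q hq
    obtain ⟨A, hA⟩ := key q hq
    exact (L.contDiff.contDiffAt.comp q ((R.contDiffAt_symm hq.1 hA hHs.contDiffAt).comp q
      hjs.contDiffAt)).contDiffWithinAt
  · intro x hx
    have h1 := hRH _ hx.1
    change L (R.symm (j (0, x))) = x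
    generalize R.symm (j (0, x)) = p at h1
    obtain ⟨s, y, γ⟩ := p
    simp only [hH, picardMap, hj, Prod.mk.injEq] at h1
    obtain ⟨rfl, rfl, h3⟩ := h1
    rw [zero_smul, sub_zero, sub_eq_zero] at h3
    subst h3
    rfl
  · intro q hq
    obtain ⟨A, hA⟩ := key q hq
    have h1 := hRH _ hq.1
    have hsymm := R.hasFDerivAt_symm hq.1 hA
    have hjd : HasFDerivAt j ((ContinuousLinearMap.fst ℝ ℝ E).prod
        ((ContinuousLinearMap.snd ℝ ℝ E).prod 0)) q :=
      hasFDerivAt_fst.prodMk (hasFDerivAt_snd.prodMk (hasFDerivAt_const _ _))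
    have hΨ := L.hasFDerivAt.comp q (hsymm.comp q hjd)
    have hΨ' : fderiv ℝ (fun q => L (R.symm (j q))) q (1, 0) = L (A.symm (1, 0, 0)) := by
      have h2 := hΨ.fderiv
      exact congrArg (fun B => B ((1 : ℝ), (0 : E))) h2
    rw [hΨ']
    change L (A.symm (1, 0, 0)) = f (L (R.symm (j q)))
    have hAf := hA.fderiv
    generalize R.symm (j q) = p at h1 hAf
    obtain ⟨s, y, γ⟩ := p
    simp only [hH, picardMap, hj, Prod.mk.injEq] at h1
    obtain ⟨hs1, hs2, h3⟩ := h1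
    -- As `γ(τ)` is the solution at time `sτ`, its derivative in `s` must be `τ f(γ(τ))`. By
    -- `primitive_variation` this solves the linearized equation, and at `τ = 1` it is `f(γ(1))`.
    set Φ : C(I, E) := ⟨fun τ => (τ : ℝ) • f (γ τ),
      continuous_subtype_val.smul (hf.continuous.comp γ.continuous)⟩ with hΦ
    have hvar := primitive_variation hf (s := s) (x := y) (γ := γ)
      (by rw [sub_sub, sub_eq_zero] at h3; exact h3) Φ fun τ => rfl
    have hAΦ : A (1, 0, Φ) = (1, 0, 0) := by
      have h4 : A (1, 0, Φ) = fderiv ℝ H (s, y, γ) (1, 0, Φ) := by rw [hAf]; rfl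
      rw [h4, fderiv_picardMap hf hs]
      simp only [map_zero, sub_zero, one_smul, Prod.mk.injEq, true_and]
      rw [sub_eq_zero, add_comm]
      exact hvar
    rw [← hAΦ, A.symm_apply_apply]
    change ((1 : I) : ℝ) • f (γ 1) = f (γ 1)
    simp

end Flow

/-! ### Coordinates adapted to a vector field and a time function -/

section FlowBox

/-- The flow of a vector field `N` with `dφ(N) = 1`. -/
theorem exists_flow_of_time {E : Type*} [NormedAddCommGroup E] [NormedSpace ℝ E]
    [FiniteDimensional ℝ E] {U : Set E} (hU : IsOpen U) {y₀ : E} (hy₀ : y₀ ∈ U)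
    {N : E → E} (hN : ContDiffOn ℝ ∞ N U) {φ : E → ℝ} (hφ : ContDiffOn ℝ ∞ φ U)
    (h1 : ∀ y ∈ U, fderiv ℝ φ y (N y) = 1) :
    ∃ (Ψ : ℝ × E → E) (ε : ℝ), 0 < ε ∧ ContDiffOn ℝ ∞ Ψ (Ioo (-ε) ε ×ˢ Metric.ball y₀ ε) ∧
      (∀ x ∈ Metric.ball y₀ ε, Ψ (0, x) = x) ∧ ∀ q ∈ Ioo (-ε) ε ×ˢ Metric.ball y₀ ε,
        Ψ q ∈ U ∧ φ (Ψ q) = φ q.2 + q.1 ∧ fderiv ℝ Ψ q (1, 0) = N (Ψ q) := by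
  have := FiniteDimensional.complete ℝ E
  obtain ⟨r, hr, hrU⟩ := Metric.nhds_basis_closedBall.mem_iff.mp (hU.mem_nhds hy₀)
  -- The cutoff makes the field compactly supported. It equals `1` on the half ball, where the flow
  -- is kept, so there the flow of `f` is that of `N`.
  set χ : ContDiffBump y₀ := ⟨r / 2, r, by positivity, by linarith⟩ with hχ
  set f : E → E := fun y => χ y • N y with hf
  have hsupp : tsupport f ⊆ Metric.closedBall y₀ r := by
    refine (tsupport_smul_subset_left _ _).trans ?_
    rw [χ.tsupport_eq]
  have hfs : ContDiff ℝ ∞ f := contDiff_iff_contDiffAt.mpr fun x => by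
    by_cases hx : x ∈ tsupport f
    · exact χ.contDiff.contDiffAt.smul (hN.contDiffAt (hU.mem_nhds (hrU (hsupp hx))))
    · exact (contDiffAt_const (c := (0 : E))).congr_of_eventuallyEq
        (notMem_tsupport_iff_eventuallyEq.mp hx)
  have hfc : HasCompactSupport f := χ.hasCompactSupport.smul_right
  obtain ⟨Ψ, W, hW, h0W, hΨ, hΨ0, hΨd⟩ := exists_smooth_flow hfs hfc y₀
  have hV : W ∩ Ψ ⁻¹' Metric.ball y₀ (r / 2) ∈ 𝓝 ((0 : ℝ), y₀) := by
    refine (hΨ.continuousOn.isOpen_inter_preimage hW Metric.isOpen_ball).mem_nhds ⟨h0W, ?_⟩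
    rw [mem_preimage, hΨ0 _ h0W]
    exact Metric.mem_ball_self (by positivity)
  obtain ⟨ε, hε, hεV⟩ := Metric.nhds_basis_ball.mem_iff.mp hV
  have hsub : Ioo (-ε) ε ×ˢ Metric.ball y₀ ε ⊆ W ∩ Ψ ⁻¹' Metric.ball y₀ (r / 2) := by
    rw [← ball_prod_same, Real.ball_eq_Ioo, zero_sub, zero_add] at hεV
    exact hεV
  have hfN : ∀ y ∈ Metric.ball y₀ (r / 2), y ∈ U ∧ f y = N y := fun y hy => by
    refine ⟨hrU (Metric.ball_subset_closedBall (Metric.ball_subset_ball (by linarith) hy)), ?_⟩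
    rw [hf]
    simp only
    rw [χ.one_of_mem_closedBall (Metric.ball_subset_closedBall hy), one_smul]
  have hd : ∀ q ∈ Ioo (-ε) ε ×ˢ Metric.ball y₀ ε, Ψ q ∈ U ∧ fderiv ℝ Ψ q (1, 0) = N (Ψ q) :=
    fun q hq => ⟨(hfN _ (hsub hq).2).1, by rw [hΨd q (hsub hq).1, (hfN _ (hsub hq).2).2]⟩
  refine ⟨Ψ, ε, hε, hΨ.mono fun q hq => (hsub hq).1,
    fun x hx => hΨ0 x (hsub ⟨⟨by linarith, hε⟩, hx⟩).1, fun q hq => ⟨(hd q hq).1, ?_, (hd q hq).2⟩⟩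
  obtain ⟨s, x⟩ := q
  -- Along a flow line `φ` grows at rate `dφ(N) = 1`.
  have hder : ∀ t ∈ Ioo (-ε) ε, HasDerivAt (fun t => φ (Ψ (t, x)) - t) 0 t := by
    intro t ht
    have hq' : (t, x) ∈ Ioo (-ε) ε ×ˢ Metric.ball y₀ ε := ⟨ht, hq.2⟩
    have a1 : HasFDerivAt Ψ (fderiv ℝ Ψ (t, x)) (t, x) :=
      ((hΨ.contDiffAt (hW.mem_nhds (hsub hq').1)).differentiableAt (by simp)).hasFDerivAt
    have a2 : HasDerivAt (fun t => Ψ (t, x)) (fderiv ℝ Ψ (t, x) (1, 0)) t :=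
      a1.comp_hasDerivAt t ((hasDerivAt_id t).prodMk (hasDerivAt_const t x))
    have a3 : HasFDerivAt φ (fderiv ℝ φ (Ψ (t, x))) (Ψ (t, x)) :=
      ((hφ.contDiffAt (hU.mem_nhds (hd _ hq').1)).differentiableAt (by simp)).hasFDerivAt
    have a4 := (a3.comp_hasDerivAt t a2).sub (hasDerivAt_id t)
    rw [(hd _ hq').2, h1 _ (hd _ hq').1, sub_self] at a4
    exact a4
  have h0 : (0 : ℝ) ∈ Ioo (-ε) ε := ⟨by linarith, hε⟩
  have hconst := isOpen_Ioo.is_const_of_deriv_eq_zero (isPreconnected_Ioo)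
    (fun t ht => (hder t ht).differentiableAt.differentiableWithinAt)
    (fun t ht => (hder t ht).deriv) hq.1 h0
  simp only at hconst
  rw [hΨ0 x (hsub (show ((0 : ℝ), x) ∈ _ from ⟨h0, hq.2⟩)).1] at hconst
  simp only
  linarith

/-- The open cube with centre `c`. -/
def cube {n : ℕ} (c : Coord n) (ε : ℝ) : Set (Coord n) := {z | ∀ i, |z i - c i| < ε}

theorem isOpen_cube {n : ℕ} (c : Coord n) (ε : ℝ) : IsOpen (cube c ε) := by
  simp only [cube, ofPred_forall]
  exact isOpen_iInter_of_finite fun i => isOpen_lt (by fun_prop) continuous_const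

theorem mem_cube_self {n : ℕ} (c : Coord n) {ε : ℝ} (hε : 0 < ε) : c ∈ cube c ε := by
  intro i
  simpa using hε

theorem convex_cube {n : ℕ} (c : Coord n) (ε : ℝ) : Convex ℝ (cube c ε) := by
  intro x hx y hy a b ha hb hab i
  have h : (a • x + b • y) i - c i = a * (x i - c i) + b * (y i - c i) := by
    simp only [PiLp.add_apply, PiLp.smul_apply, smul_eq_mul]
    linear_combination c i * hab
  have := convex_ball (0 : ℝ) ε (x := x i - c i) (by simpa using hx i)
    (y := y i - c i) (by simpa using hy i) ha hb hab
  rw [h]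
  simpa using this

/-- Cubes are the balls of the sup norm, which induces the same topology as the Euclidean norm. -/
theorem exists_cube_subset {n : ℕ} {c : Coord n} {s : Set (Coord n)} (hs : s ∈ 𝓝 c) :
    ∃ ε > 0, cube c ε ⊆ s := by
  obtain ⟨r, hr, hrs⟩ := Metric.nhds_basis_ball.mem_iff.mp hs
  have h1 : Tendsto (fun z : Fin n → ℝ => (WithLp.toLp 2 z : Coord n)) (𝓝 c.ofLp) (𝓝 c) :=
    (PiLp.continuous_toLp 2 _).tendsto' _ _ rfl
  obtain ⟨ε, hε, hε'⟩ := Metric.nhds_basis_ball.mem_iff.mp (h1 hs)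
  refine ⟨ε, hε, fun z hz => ?_⟩
  have : z.ofLp ∈ Metric.ball c.ofLp ε := by
    rw [Metric.mem_ball, dist_pi_lt_iff hε]
    intro i
    rw [Real.dist_eq]
    exact hz i
  exact hε' this

/-- Coordinates in which `N` is a coordinate vector and `φ` a coordinate function. -/
theorem exists_flow_box {n : ℕ} {U : Set (Coord (n + 1))} (hU : IsOpen U) {y₀ : Coord (n + 1)}
    (hy₀ : y₀ ∈ U) {N : Coord (n + 1) → Coord (n + 1)} (hN : ContDiffOn ℝ ∞ N U)
    {φ : Coord (n + 1) → ℝ} (hφ : ContDiffOn ℝ ∞ φ U)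
    (h1 : ∀ y ∈ U, fderiv ℝ φ y (N y) = 1) :
    ∃ (R : OpenPartialHomeomorph (Coord (n + 1)) (Coord (n + 1))) (c : Coord (n + 1)) (ε : ℝ),
      0 < ε ∧ R.source = cube c ε ∧ R c = y₀ ∧ R.target ⊆ U ∧ ContDiffOn ℝ ∞ R R.source ∧
      ContDiffOn ℝ ∞ R.symm R.target ∧
      ∀ z ∈ R.source, φ (R z) = z 0 ∧ fderiv ℝ R z (ev 0) = N (R z) := by
  obtain ⟨Ψ, δ, hδ, hΨ, hΨ0, hΨq⟩ := exists_flow_of_time hU hy₀ hN hφ h1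
  set Q := Ioo (-δ) δ ×ˢ Metric.ball y₀ δ with hQ
  have hQo : IsOpen Q := isOpen_Ioo.prod Metric.isOpen_ball
  have hball : ∀ x ∈ Metric.ball y₀ δ, x ∈ U := fun x hx => by
    have := (hΨq (0, x) ⟨⟨by simpa using hδ, hδ⟩, hx⟩).1
    rwa [hΨ0 x hx] at this
  have hN0 : N y₀ ≠ 0 := fun h => by
    have := h1 y₀ hy₀
    rw [h, map_zero] at this
    exact zero_ne_one this
  have hev : ev (0 : Fin (n + 1)) ≠ (0 : Coord (n + 1)) := fun h => by
    have := congrArg (fun v : Coord (n + 1) => v 0) h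
    simp at this
  -- `L` carries `e₀` to `N y₀`, so the hyperplane `y₀ + L(ker dz⁰)`, parametrized by `P`, is
  -- transverse to `N` at `y₀`. The flow starts from this hyperplane.
  obtain ⟨L, hL⟩ := SeparatingDual.exists_continuousLinearEquiv_apply_eq (R := ℝ) hev hN0
  set π : Coord (n + 1) →L[ℝ] Coord (n + 1) := ContinuousLinearMap.id ℝ _ -
    (EuclideanSpace.proj 0 : Coord (n + 1) →L[ℝ] ℝ).smulRight (ev 0) with hπ
  have hπev : π (ev 0) = 0 := by simp [hπ]
  set B : Coord (n + 1) →L[ℝ] Coord (n + 1) := (L : Coord (n + 1) →L[ℝ] Coord (n + 1)).comp π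
    with hB
  have hBev : B (ev 0) = 0 := by simp [hB, hπev]
  set P : Coord (n + 1) → Coord (n + 1) := fun z => y₀ + B z with hP
  have hPs : ContDiff ℝ ∞ P := contDiff_const.add B.contDiff
  -- The hyperplane need not be a level set of `φ`. Flowing from `P z` for time `z 0 - φ (P z)`
  -- makes `φ` equal to `z 0` at the end point.
  set κ : Coord (n + 1) → ℝ × Coord (n + 1) := fun z => (z 0 - φ (P z), P z) with hκ
  have hA : IsOpen (P ⁻¹' Metric.ball y₀ δ) := Metric.isOpen_ball.preimage hPs.continuous
  have hκs : ContDiffOn ℝ ∞ κ (P ⁻¹' Metric.ball y₀ δ) := by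
    refine ContDiffOn.prodMk (ContDiffOn.sub ?_ ?_) hPs.contDiffOn
    · exact (EuclideanSpace.proj 0 : Coord (n + 1) →L[ℝ] ℝ).contDiff.contDiffOn
    · exact (hφ.mono hball).comp hPs.contDiffOn fun _ h => h
  set D := P ⁻¹' Metric.ball y₀ δ ∩ κ ⁻¹' Q with hD
  have hDo : IsOpen D := hκs.continuousOn.isOpen_inter_preimage hA hQo
  have hκd : ∀ z ∈ D, HasFDerivAt κ
      (((EuclideanSpace.proj 0 : Coord (n + 1) →L[ℝ] ℝ) - (fderiv ℝ φ (P z)).comp B).prod B) z :=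
    fun z hz => by
    have hPd : HasFDerivAt P B z := B.hasFDerivAt.const_add y₀
    have hφd : HasFDerivAt φ (fderiv ℝ φ (P z)) (P z) :=
      ((hφ.contDiffAt (hU.mem_nhds (hball _ hz.1))).differentiableAt (by simp)).hasFDerivAt
    exact ((EuclideanSpace.proj 0 : Coord (n + 1) →L[ℝ] ℝ).hasFDerivAt.sub
      (hφd.comp z hPd)).prodMk hPd
  set Θ : Coord (n + 1) → Coord (n + 1) := fun z => Ψ (κ z) with hΘ
  have hΘs : ContDiffOn ℝ ∞ Θ D := hΨ.comp (hκs.mono inter_subset_left) fun _ h => h.2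
  have hΘat : ∀ z ∈ D, ContDiffAt ℝ ∞ Θ z := fun z hz => hΘs.contDiffAt (hDo.mem_nhds hz)
  have hΨd : ∀ q ∈ Q, HasFDerivAt Ψ (fderiv ℝ Ψ q) q := fun q hq =>
    ((hΨ.contDiffAt (hQo.mem_nhds hq)).differentiableAt (by simp)).hasFDerivAt
  have hΘd : ∀ z ∈ D, ∀ v, fderiv ℝ Θ z v =
      fderiv ℝ Ψ (κ z) (v 0 - fderiv ℝ φ (P z) (B v), B v) := fun z hz v => by
    have h2 : HasFDerivAt Θ _ z := (hΨd _ hz.2).comp z (hκd z hz)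
    rw [h2.fderiv]
    rfl
  set c : Coord (n + 1) := φ y₀ • ev 0 with hc
  have hPc : P c = y₀ := by simp [hP, hc, hBev]
  have hκc : κ c = (0, y₀) := by
    simp only [hκ, hPc]
    simp [hc]
  have hy₀b : y₀ ∈ Metric.ball y₀ δ := Metric.mem_ball_self hδ
  have h0Q : ((0 : ℝ), y₀) ∈ Q := ⟨⟨by simpa using hδ, hδ⟩, hy₀b⟩
  have hcD : c ∈ D := ⟨by rw [mem_preimage, hPc]; exact hy₀b, by rw [mem_preimage, hκc]; exact h0Q⟩
  have hΘc : Θ c = y₀ := by simp only [hΘ, hκc, hΨ0 _ hy₀b]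
  have hspace : ∀ w, fderiv ℝ Ψ (0, y₀) (0, w) = w := fun w => by
    have a1 : HasFDerivAt (fun x => Ψ ((0 : ℝ), x)) _ y₀ := (hΨd _ h0Q).comp y₀
      ((hasFDerivAt_const (0 : ℝ) y₀).prodMk (hasFDerivAt_id y₀))
    have a2 : (fun x => Ψ ((0 : ℝ), x)) =ᶠ[𝓝 y₀] id := by
      filter_upwards [Metric.isOpen_ball.mem_nhds hy₀b] with x hx using hΨ0 x hx
    have a3 := (a1.congr_of_eventuallyEq a2.symm).unique (hasFDerivAt_id y₀)
    simpa using congrArg (fun A => A w) a3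
  have htime : fderiv ℝ Ψ (0, y₀) (1, 0) = L (ev 0) := by
    rw [(hΨq _ h0Q).2.2, hΨ0 _ hy₀b, hL]
  -- Up to the isomorphism `L`, the derivative at the centre is a shear: it fixes `e₀` and alters
  -- only the zeroth coordinate, which gives injectivity.
  have hΘcv : ∀ v, fderiv ℝ Θ c v = L ((v 0 - fderiv ℝ φ y₀ (B v)) • ev 0 + π v) := fun v => by
    rw [hΘd c hcD, hκc, hPc]
    have : ((v 0 - fderiv ℝ φ y₀ (B v), B v) : ℝ × Coord (n + 1)) =
        (v 0 - fderiv ℝ φ y₀ (B v)) • ((1 : ℝ), (0 : Coord (n + 1))) + (0, B v) := by simp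
    rw [this, map_add, map_smul, htime, hspace, map_add, map_smul]
    rfl
  have hinj : Function.Injective (fderiv ℝ Θ c) := by
    rw [injective_iff_map_eq_zero]
    intro v hv
    rw [hΘcv, map_eq_zero_iff L L.injective] at hv
    have a0 : v 0 - fderiv ℝ φ y₀ (B v) = 0 := by
      have := congrArg (fun v : Coord (n + 1) => v 0) hv
      simpa [hπ] using this
    rw [a0, zero_smul, zero_add] at hv
    have a1 : B v = 0 := by simp [hB, hv]
    rw [a1, map_zero, sub_zero] at a0
    have a2 : v = π v + v 0 • ev 0 := by simp [hπ]
    rw [a2, hv, a0]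
    simp
  set A : Coord (n + 1) ≃L[ℝ] Coord (n + 1) :=
    (LinearEquiv.ofInjectiveEndo (fderiv ℝ Θ c).toLinearMap hinj).toContinuousLinearEquiv with hAdef
  have hAc : (A : Coord (n + 1) →L[ℝ] Coord (n + 1)) = fderiv ℝ Θ c := by
    ext1 v
    rfl
  have hΘdc : HasFDerivAt Θ (A : Coord (n + 1) →L[ℝ] Coord (n + 1)) c := by
    rw [hAc]
    exact ((hΘat c hcD).differentiableAt (by simp)).hasFDerivAt
  set R₀ := (hΘat c hcD).toOpenPartialHomeomorph Θ hΘdc (by simp) with hR₀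
  set O : Set (Coord (n + 1)) := D ∩ fderiv ℝ Θ ⁻¹' range ((↑) :
    (Coord (n + 1) ≃L[ℝ] Coord (n + 1)) → (Coord (n + 1) →L[ℝ] Coord (n + 1))) with hO
  have hOo : IsOpen O :=
    (hΘs.continuousOn_fderiv_of_isOpen hDo (by simp)).isOpen_inter_preimage hDo
      ContinuousLinearEquiv.isOpen
  have hOc : R₀.source ∩ O ∈ 𝓝 c := (R₀.open_source.inter hOo).mem_nhds
    ⟨(hΘat c hcD).mem_toOpenPartialHomeomorph_source hΘdc (by simp), hcD, A, hAc⟩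
  obtain ⟨ε, hε, hεO⟩ := exists_cube_subset hOc
  have hsrc : (R₀.restr (cube c ε)).source = cube c ε := by
    rw [R₀.restr_source' _ (isOpen_cube c ε)]
    exact inter_eq_right.mpr fun z hz => (hεO hz).1
  have hmem : ∀ z ∈ (R₀.restr (cube c ε)).source, z ∈ O := fun z hz => by
    rw [hsrc] at hz
    exact (hεO hz).2
  refine ⟨R₀.restr (cube c ε), c, ε, hε, hsrc, hΘc, fun y hy => ?_, fun z hz => ?_,
    fun y hy => ?_, fun z hz => ?_⟩
  · have hz := hmem _ ((R₀.restr (cube c ε)).map_target hy)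
    rw [← (R₀.restr (cube c ε)).right_inv hy]
    exact (hΨq _ hz.1.2).1
  · exact (hΘat z (hmem z hz).1).contDiffWithinAt
  · obtain ⟨hz, A', hA'⟩ := hmem _ ((R₀.restr (cube c ε)).map_target hy)
    refine ((R₀.restr (cube c ε)).contDiffAt_symm hy (f₀' := A') ?_ (hΘat _ hz)).contDiffWithinAt
    rw [hA']
    exact ((hΘat _ hz).differentiableAt (by simp)).hasFDerivAt
  · obtain ⟨hz, -⟩ := hmem z hz
    refine ⟨?_, ?_⟩
    · change φ (Ψ (κ z)) = z 0
      rw [(hΨq _ hz.2).2.1]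
      simp [hκ]
    · change fderiv ℝ Θ z (ev 0) = N (Θ z)
      rw [hΘd z hz, hBev]
      simpa using (hΨq _ hz.2).2.2

end FlowBox

/-! ### Gaussian charts -/

section Gaussian

variable {M : Type*} [TopologicalSpace M] [ChartedSpace (Coord 4) M]

/-- In the smooth chart `e`, with coordinates `(t, x)`, the zeroth coordinate is the function `τ`
and the metric is `-dt² + h(t, x)`. -/
structure IsGaussianChart (g : LorentzMetric M) (τ : M → ℝ)
    (e : OpenPartialHomeomorph M (Coord 4)) : Prop where
  mem_charts : e ∈ charts M
  time_eq : ∀ y ∈ e.target, τ (e.symm y) = y 0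
  metric_time : ∀ y ∈ e.target, g.mat e y 0 0 = -1
  metric_mixed : ∀ y ∈ e.target, ∀ μ : Fin 3, g.mat e y 0 μ.succ = 0

theorem IsWarpedChart.isGaussianChart {g : LorentzMetric M} {τ : M → ℝ}
    {e : OpenPartialHomeomorph M (Coord 4)} {a : ℝ → ℝ}
    {gs : Coord 3 → Matrix (Fin 3) (Fin 3) ℝ} (h : IsWarpedChart g τ e a gs) :
    IsGaussianChart g τ e :=
  ⟨h.mem_charts, h.time_eq, h.metric_time, h.metric_mixed⟩

theorem contDiffOn_det {n m : ℕ} {s : Set (Coord m)} {A : Coord m → Matrix (Fin n) (Fin n) ℝ}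
    (hA : ∀ i j, ContDiffOn ℝ ∞ (fun y => A y i j) s) : ContDiffOn ℝ ∞ (fun y => (A y).det) s := by
  simp only [Matrix.det_apply]
  exact ContDiffOn.sum fun σ _ => (contDiffOn_prod fun i _ => hA _ _).const_smul _

/-- Cramer's rule: the entries of the adjugate are determinants of matrices with one row replaced by
a unit vector. -/
theorem contDiffOn_inv {n m : ℕ} {s : Set (Coord m)} {A : Coord m → Matrix (Fin n) (Fin n) ℝ}
    (hA : ∀ i j, ContDiffOn ℝ ∞ (fun y => A y i j) s) (hdet : ∀ y ∈ s, IsUnit (A y).det)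
    (i j : Fin n) : ContDiffOn ℝ ∞ (fun y => (A y)⁻¹ i j) s := by
  simp only [Matrix.inv_def, Matrix.smul_apply, Ring.inverse_eq_inv', Matrix.adjugate_apply,
    smul_eq_mul]
  refine ((contDiffOn_det hA).inv fun y hy => (hdet y hy).ne_zero).mul
    (contDiffOn_det fun k l => ?_)
  by_cases hk : k = j
  · subst hk
    simpa using contDiffOn_const
  · simpa [hk] using hA k l

theorem fderiv_eq_sum_pd {n : ℕ} (f : Coord n → ℝ) (y v : Coord n) :
    fderiv ℝ f y v = ∑ i, v i * pd i f y := by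
  conv_lhs => rw [coord_eq_sum v]
  simp only [map_sum, map_smul, smul_eq_mul]
  rfl

variable [IsManifold (𝓡 4) ∞ M] {g : LorentzMetric M} {T : Tensor2 M} {φ ζ : M → ℝ} {V : ℝ → ℝ}

/-- Around every point there are Gaussian coordinates, on a cube, whose time is the mimetic field. -/
theorem IsMimeticSolution.exists_isGaussianChart (h : IsMimeticSolution g T φ ζ V) (p : M) :
    ∃ (e : OpenPartialHomeomorph M (Coord 4)) (c : Coord 4) (ε : ℝ), 0 < ε ∧ p ∈ e.source ∧
      e p = c ∧ e.target = cube c ε ∧ IsGaussianChart g φ e := by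
  set e₀ := chartAt (Coord 4) p with he₀
  have he₀c : e₀ ∈ charts M := IsManifold.chart_mem_maximalAtlas p
  have hφ := contDiffOn_comp_symm he₀c h.smooth_field
  -- `N` is the velocity with raised index. The unit gradient gives `dφ(N) = 1`, and lowering the
  -- index gives `g(N, ·) = -dφ`.
  set N : Coord 4 → Coord 4 := fun y => WithLp.toLp 2 fun k =>
    -∑ l, (g.mat e₀ y)⁻¹ k l * pd l (φ ∘ e₀.symm) y with hN
  have hNs : ContDiffOn ℝ ∞ N e₀.target := by
    rw [contDiffOn_piLp]
    intro k
    exact (ContDiffOn.sum fun l _ => (contDiffOn_inv (fun i j => g.smooth e₀ he₀c i j)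
      (fun y hy => isUnit_det_mat g he₀c hy) k l).mul (contDiffOn_pd e₀.open_target hφ l)).neg
  have hNφ : ∀ y ∈ e₀.target, fderiv ℝ (φ ∘ e₀.symm) y (N y) = 1 := fun y hy => by
    rw [fderiv_eq_sum_pd]
    have h1 := h.unit_gradient e₀ he₀c y hy
    have h2 : ∑ k, N y k * pd k (φ ∘ e₀.symm) y = -∑ k, ∑ l, (g.mat e₀ y)⁻¹ k l *
        (pd k (φ ∘ e₀.symm) y * pd l (φ ∘ e₀.symm) y) := by
      simp only [hN, ← Finset.sum_neg_distrib, Finset.sum_mul]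
      refine Finset.sum_congr rfl fun k _ => Finset.sum_congr rfl fun l _ => ?_
      ring
    rw [h2, h1, neg_neg]
  have hNg : ∀ y ∈ e₀.target, ∀ w,
      bil (comp e₀ g.tensor) y (N y) w = -fderiv ℝ (φ ∘ e₀.symm) y w := fun y hy w => by
    have h1 := Matrix.mul_nonsing_inv _ (isUnit_det_mat g he₀c hy)
    induction w using coord_induction with
    | h0 => simp
    | hadd l l' h h' => rw [map_add, map_add, h, h', neg_add]
    | hsmul c l h => rw [map_smul, map_smul, h, smul_neg]
    | hev i =>
    conv_lhs => rw [coord_eq_sum (N y)]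
    simp only [map_sum, map_smul, sum_apply, smul_apply, bil_ev, smul_eq_mul]
    calc ∑ k, N y k * comp e₀ g.tensor k i y
        = -∑ l, (∑ k, g.mat e₀ y i k * (g.mat e₀ y)⁻¹ k l) * pd l (φ ∘ e₀.symm) y := by
          simp only [hN, Finset.sum_mul, neg_mul, Finset.sum_neg_distrib]
          rw [Finset.sum_comm]
          congr 1
          refine Finset.sum_congr rfl fun l _ => Finset.sum_congr rfl fun k _ => ?_
          have : comp e₀ g.tensor k i y = g.mat e₀ y i k := (isSymm_mat g e₀ y).apply i k
          rw [this]
          ring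
      _ = -fderiv ℝ (φ ∘ e₀.symm) y (ev i) := by
          simp only [← Matrix.mul_apply, h1, Matrix.one_apply, ite_mul, one_mul, zero_mul]
          simp [pd]
  obtain ⟨R, c, ε, hε, hsrc, hRc, htgt, hRs, hRs', hR⟩ :=
    exists_flow_box e₀.open_target (mem_chart_target (Coord 4) p) hNs hφ hNφ
  set e := e₀ ≫ₕ R.symm with he
  have het : e.target = cube c ε := by
    rw [he, OpenPartialHomeomorph.trans_target, ← hsrc]
    exact inter_eq_left.mpr fun z hz => htgt (R.map_source hz)
  have hps : p ∈ e.source := by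
    rw [he, OpenPartialHomeomorph.trans_source]
    refine ⟨mem_chart_source (Coord 4) p, ?_⟩
    rw [mem_preimage, ← hRc]
    exact R.map_source (hsrc ▸ mem_cube_self c hε)
  have hmem : e ∈ charts M := by
    refine e.mem_maximalAtlas_of_contMDiffOn ?_ ?_
    · exact (contMDiffOn_iff_contDiffOn.mpr hRs').comp
        ((contMDiffOn_of_mem_maximalAtlas he₀c).mono inter_subset_left) fun x hx => hx.2
    · exact (contMDiffOn_symm_of_mem_maximalAtlas he₀c).comp
        ((contMDiffOn_iff_contDiffOn.mpr hRs).mono (by rw [het, hsrc])) fun z hz => by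
          rw [het, ← hsrc] at hz
          exact htgt (R.map_source hz)
  -- With `∂₀ = N` and `φ = z⁰`, the first row is `g(∂₀, ∂ᵢ) = -dφ(∂ᵢ) = -δ₀ᵢ`. No separate argument
  -- about geodesics is needed.
  have hg0 : ∀ z ∈ e.target, ∀ i, g.mat e z 0 i = -(if i = 0 then 1 else 0) := fun z hz i => by
    have hz' : z ∈ R.source := by rwa [hsrc, ← het]
    have hzt := htgt (R.map_source hz')
    have hez : e.symm z ∈ e₀.source := e₀.map_target hzt
    have hnear : ∀ᶠ x in 𝓝 z, x ∈ R.source := R.open_source.mem_nhds hz'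
    have h1 : (e₀ ∘ e.symm) =ᶠ[𝓝 z] R := hnear.mono fun x hx =>
      e₀.right_inv (htgt (R.map_source hx))
    have h2 : ((φ ∘ e₀.symm) ∘ R) =ᶠ[𝓝 z] fun x => (EuclideanSpace.proj 0 : Coord 4 →L[ℝ] ℝ) x :=
      hnear.mono fun x hx => (hR x hx).1
    have hRd : DifferentiableAt ℝ R z :=
      (hRs.contDiffAt (R.open_source.mem_nhds hz')).differentiableAt (by simp)
    have hφd : DifferentiableAt ℝ (φ ∘ e₀.symm) (R z) :=
      (hφ.contDiffAt (e₀.open_target.mem_nhds hzt)).differentiableAt (by simp)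
    have h3 := h2.fderiv_eq (𝕜 := ℝ)
    rw [fderiv_comp z hφd hRd, ContinuousLinearMap.fderiv] at h3
    have h4 := congrArg (fun A : Coord 4 →L[ℝ] ℝ => A (ev i)) h3
    have h5 := bil_comp_transition he₀c hmem g.tensor hz hez (ev 0) (ev i)
    rw [bil_ev, h1.fderiv_eq, (hR z hz').2, h1.self_of_nhds, hNg _ hzt] at h5
    have h6 : g.mat e z 0 i = comp e g.tensor 0 i z := rfl
    rw [h6, h5]
    have h7 : fderiv ℝ (φ ∘ e₀.symm) (R z) (fderiv ℝ R z (ev i)) = (ev i : Coord 4) 0 := h4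
    rw [h7]
    simp [eq_comm]
  refine ⟨e, c, ε, hε, hps, ?_, het, hmem, fun y hy => ?_, fun y hy => ?_, fun y hy μ => ?_⟩
  · change R.symm (e₀ p) = c
    rw [← hRc]
    exact R.left_inv (hsrc ▸ mem_cube_self c hε)
  · rw [het, ← hsrc] at hy
    exact (hR y hy).1
  · rw [hg0 y hy]
    simp
  · rw [hg0 y hy]
    simp [Fin.succ_ne_zero]

end Gaussian

/-! ### The Codazzi equation in Gaussian charts -/

section GaussianCodazzi

theorem pd_congr {n : ℕ} {f f' : Coord n → ℝ} {y : Coord n} (h : f =ᶠ[𝓝 y] f') (i : Fin n) :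
    pd i f y = pd i f' y := by
  rw [pd, pd, h.fderiv_eq]

theorem pd_const {n : ℕ} (c : ℝ) (y : Coord n) (i : Fin n) : pd i (fun _ => c) y = 0 := by
  simp [pd]

theorem pd_add {n : ℕ} {f f' : Coord n → ℝ} {y : Coord n} (hf : DifferentiableAt ℝ f y)
    (hf' : DifferentiableAt ℝ f' y) (i : Fin n) :
    pd i (fun x => f x + f' x) y = pd i f y + pd i f' y := by
  simp [pd, fderiv_fun_add hf hf']

theorem pd_sub {n : ℕ} {f f' : Coord n → ℝ} {y : Coord n} (hf : DifferentiableAt ℝ f y)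
    (hf' : DifferentiableAt ℝ f' y) (i : Fin n) :
    pd i (fun x => f x - f' x) y = pd i f y - pd i f' y := by
  simp [pd, fderiv_fun_sub hf hf']

theorem pd_mul {n : ℕ} {f f' : Coord n → ℝ} {y : Coord n} (hf : DifferentiableAt ℝ f y)
    (hf' : DifferentiableAt ℝ f' y) (i : Fin n) :
    pd i (fun x => f x * f' x) y = pd i f y * f' y + f y * pd i f' y := by
  simp [pd, fderiv_fun_mul hf hf']
  ring

theorem pd_const_mul {n : ℕ} {f : Coord n → ℝ} {y : Coord n} (hf : DifferentiableAt ℝ f y)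
    (c : ℝ) (i : Fin n) : pd i (fun x => c * f x) y = c * pd i f y := by
  rw [pd_mul (differentiableAt_const c) hf, pd_const, zero_mul, zero_add]

theorem pd_coord {n : ℕ} (y : Coord n) (i j : Fin n) :
    pd i (fun x => x j) y = if i = j then 1 else 0 := by
  have h : (fun x : Coord n => x j) = (EuclideanSpace.proj j : Coord n →L[ℝ] ℝ) := rfl
  rw [pd, h, ContinuousLinearMap.fderiv]
  simp [eq_comm]

/-- The Levi-Civita connection is metric. -/
theorem pd_metric {n : ℕ} {G : Coord n → Matrix (Fin n) (Fin n) ℝ} {y : Coord n}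
    (hG : IsUnit (G y).det) (hs : ∀ z, (G z).IsSymm) (j k l : Fin n) :
    pd j (fun z => G z k l) y = ∑ m, christoffel G m j k y * G y m l
      + ∑ m, christoffel G m j l y * G y k m := by
  have h1 := sum_mul_christoffel hG l j k
  have h2 := sum_mul_christoffel hG k j l
  have hs' : ∀ a b, (fun z => G z a b) = fun z => G z b a := fun a b =>
    funext fun z => (hs z).apply b a
  rw [hs' l k, hs' l j] at h1
  simp only [mul_comm (christoffel G _ _ _ _)]
  simp only [fun m => (hs y).apply l m]
  rw [h1, h2, hs' j k]
  ring

variable {M : Type*} [TopologicalSpace M] [ChartedSpace (Coord 4) M]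
  {g : LorentzMetric M} {T : Tensor2 M} {φ ζ : M → ℝ} {V : ℝ → ℝ}
  {e : OpenPartialHomeomorph M (Coord 4)}

theorem IsGaussianChart.mat_zero (he : IsGaussianChart g φ e) {y : Coord 4} (hy : y ∈ e.target)
    (i : Fin 4) : g.mat e y 0 i = if i = 0 then -1 else 0 := by
  refine Fin.cases ?_ (fun μ => ?_) i
  · simpa using he.metric_time y hy
  · simpa [Fin.succ_ne_zero] using he.metric_mixed y hy μ

theorem IsGaussianChart.pd_time (he : IsGaussianChart g φ e) {y : Coord 4} (hy : y ∈ e.target)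
    (k : Fin 4) : pd k (φ ∘ e.symm) y = if k = 0 then 1 else 0 := by
  rw [pd_congr (Filter.eventually_of_mem (e.open_target.mem_nhds hy) fun z hz =>
    he.time_eq z hz : φ ∘ e.symm =ᶠ[𝓝 y] fun z => z 0), pd_coord]

theorem IsGaussianChart.pd_mat_zero (he : IsGaussianChart g φ e) {y : Coord 4}
    (hy : y ∈ e.target) (i j : Fin 4) : pd j (fun z => g.mat e z 0 i) y = 0 := by
  rw [pd_congr ((e.open_target.mem_nhds hy |> Filter.eventually_of_mem) fun z hz =>
    he.mat_zero hz i), pd_const]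

variable [IsManifold (𝓡 4) ∞ M]

/-- The components `g₀ᵢ` are constant, so only `-½ ∂₀ gⱼₖ` survives after lowering the index; `g₀₀ =
-1` flips the sign. -/
theorem IsGaussianChart.christoffel_zero (he : IsGaussianChart g φ e) {y : Coord 4}
    (hy : y ∈ e.target) (j k : Fin 4) :
    christoffel (g.mat e) 0 j k y = (1 / 2) * pd 0 (fun z => g.mat e z j k) y := by
  have h := sum_mul_christoffel (isUnit_det_mat g he.mem_charts hy) 0 j k
  rw [he.pd_mat_zero hy, he.pd_mat_zero hy] at h
  simp only [he.mat_zero hy, ite_mul, neg_mul, one_mul, zero_mul, Finset.sum_ite_eq',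
    Finset.mem_univ, if_true] at h
  linarith

theorem differentiableAt_of_contDiffOn {n : ℕ} {s : Set (Coord n)} (hs : IsOpen s)
    {f : Coord n → ℝ} (hf : ContDiffOn ℝ ∞ f s) {y : Coord n} (hy : y ∈ s) :
    DifferentiableAt ℝ f y :=
  (hf.contDiffAt (hs.mem_nhds hy)).differentiableAt (by simp)

/-- The isotropic part `⅓ (2 ζ - V)` of the mimetic tensor. -/
def isotropicPart (φ ζ : M → ℝ) (V : ℝ → ℝ) (x : M) : ℝ := (1 / 3) * (2 * ζ x - V (φ x))

theorem IsMimeticSolution.contDiffOn_isotropicPart (h : IsMimeticSolution g T φ ζ V)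
    (he : e ∈ charts M) : ContDiffOn ℝ ∞ (isotropicPart φ ζ V ∘ e.symm) e.target :=
  contDiffOn_const.mul ((contDiffOn_const.mul (contDiffOn_comp_symm he h.smooth_multiplier)).sub
    (h.contDiffOn_potential he))

/-- The covariant derivative of the mimetic tensor in a Gaussian chart. -/
theorem IsGaussianChart.cov_mimeticTensor (he : IsGaussianChart g φ e)
    (h : IsMimeticSolution g T φ ζ V) {y : Coord 4} (hy : y ∈ e.target) (j k l : Fin 4) :
    cov (g.mat e) (comp e (mimeticTensor g φ ζ V)) j k l y =
      pd j (isotropicPart φ ζ V ∘ e.symm) y * g.mat e y k l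
      + 2 * pd j (ζ ∘ e.symm) y * ((if k = 0 then 1 else 0) * (if l = 0 then 1 else 0))
      - ζ (e.symm y) * (pd 0 (fun z => g.mat e z j k) y * (if l = 0 then 1 else 0)
        + pd 0 (fun z => g.mat e z j l) y * (if k = 0 then 1 else 0)) := by
  set β := isotropicPart φ ζ V ∘ e.symm with hβ
  set Z := ζ ∘ e.symm with hZ
  have hc : ∀ z ∈ e.target, ∀ k l, comp e (mimeticTensor g φ ζ V) k l z =
      2 * ((if k = 0 then 1 else 0) * (if l = 0 then 1 else 0)) * Z z + β z * g.mat e z k l :=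
    fun z hz k l => by
    rw [comp_mimeticTensor he.mem_charts h.smooth_field hz, he.pd_time hz, he.pd_time hz]
    simp only [hZ, hβ, Function.comp_apply, isotropicPart]
    ring
  have hZd : DifferentiableAt ℝ Z y := differentiableAt_of_contDiffOn e.open_target
    (contDiffOn_comp_symm he.mem_charts h.smooth_multiplier) hy
  have hβd : DifferentiableAt ℝ β y := differentiableAt_of_contDiffOn e.open_target
    (h.contDiffOn_isotropicPart he.mem_charts) hy
  have hgd : DifferentiableAt ℝ (fun z => g.mat e z k l) y :=
    differentiableAt_comp g.smooth he.mem_charts hy k l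
  have h1 : pd j (comp e (mimeticTensor g φ ζ V) k l) y =
      2 * ((if k = 0 then 1 else 0) * (if l = 0 then 1 else 0)) * pd j Z y
        + (pd j β y * g.mat e y k l + β y * pd j (fun z => g.mat e z k l) y) := by
    rw [pd_congr (Filter.eventually_of_mem (e.open_target.mem_nhds hy) fun z hz => hc z hz k l),
      pd_add (hZd.const_mul _) (hβd.fun_mul hgd), pd_const_mul hZd, pd_mul hβd hgd]
  have h2 : ∑ m, (christoffel (g.mat e) m j k y * comp e (mimeticTensor g φ ζ V) m l y
      + christoffel (g.mat e) m j l y * comp e (mimeticTensor g φ ζ V) k m y) =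
      2 * Z y * (christoffel (g.mat e) 0 j k y * (if l = 0 then 1 else 0)
        + christoffel (g.mat e) 0 j l y * (if k = 0 then 1 else 0))
      + β y * (∑ m, christoffel (g.mat e) m j k y * g.mat e y m l
        + ∑ m, christoffel (g.mat e) m j l y * g.mat e y k m) := by
    have a1 : ∀ (f : Fin 4 → ℝ), f 0 = ∑ m, f m * (if m = 0 then 1 else 0) := fun f => by simp
    rw [a1 fun m => christoffel (g.mat e) m j k y, a1 fun m => christoffel (g.mat e) m j l y,
      ← Finset.sum_add_distrib, Finset.sum_mul, Finset.sum_mul, ← Finset.sum_add_distrib,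
      Finset.mul_sum, Finset.mul_sum, ← Finset.sum_add_distrib]
    refine Finset.sum_congr rfl fun m _ => ?_
    rw [hc y hy, hc y hy]
    ring
  -- Metric compatibility reduces the contribution of `β g` to `dβ ⊗ g`; the `dt ⊗ dt` part only
  -- sees `Γ⁰`.
  rw [cov, h1, h2, pd_metric (isUnit_det_mat g he.mem_charts hy) (isSymm_mat g e),
    he.christoffel_zero hy, he.christoffel_zero hy]
  simp only [hZ, Function.comp_apply]
  ring

/-- The Codazzi equation for the mimetic tensor in a Gaussian chart. -/
theorem IsGaussianChart.codazzi_iff (he : IsGaussianChart g φ e)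
    (h : IsMimeticSolution g T φ ζ V) {y : Coord 4} (hy : y ∈ e.target)
    (hV : ∀ μ : Fin 3, pd μ.succ (fun z => V (φ (e.symm z))) y = 0) :
    (∀ j k l, cov (g.mat e) (comp e (mimeticTensor g φ ζ V)) j k l y =
      cov (g.mat e) (comp e (mimeticTensor g φ ζ V)) k j l y) ↔
    (∀ μ : Fin 3, pd μ.succ (ζ ∘ e.symm) y = 0) ∧ ∀ μ ν : Fin 3,
      pd 0 (isotropicPart φ ζ V ∘ e.symm) y * g.mat e y μ.succ ν.succ
        + ζ (e.symm y) * pd 0 (fun z => g.mat e z μ.succ ν.succ) y = 0 := by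
  have hZd : DifferentiableAt ℝ (ζ ∘ e.symm) y := differentiableAt_of_contDiffOn e.open_target
    (contDiffOn_comp_symm he.mem_charts h.smooth_multiplier) hy
  have hVd : DifferentiableAt ℝ (fun z => V (φ (e.symm z))) y :=
    differentiableAt_of_contDiffOn e.open_target (h.contDiffOn_potential he.mem_charts) hy
  have hβ : ∀ μ : Fin 3, pd μ.succ (isotropicPart φ ζ V ∘ e.symm) y =
      (2 / 3) * pd μ.succ (ζ ∘ e.symm) y := fun μ => by
    have : isotropicPart φ ζ V ∘ e.symm =
        fun z => (1 / 3) * (2 * (ζ ∘ e.symm) z - V (φ (e.symm z))) := rfl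
    rw [this, pd_const_mul ((hZd.const_mul 2).fun_sub hVd), pd_sub (hZd.const_mul 2) hVd,
      pd_const_mul hZd, hV]
    ring
  have hsym : ∀ a b, g.mat e y a b = g.mat e y b a := fun a b => (isSymm_mat g e y).apply b a
  have hsymd : ∀ a b, pd 0 (fun z => g.mat e z a b) y = pd 0 (fun z => g.mat e z b a) y :=
    fun a b => by
    congr 1
    exact funext fun z => (isSymm_mat g e z).apply b a
  have hm0 : ∀ i, g.mat e y i 0 = if i = 0 then -1 else 0 := fun i => by
    rw [hsym, he.mat_zero hy]
  have hd0 : ∀ i, pd 0 (fun z => g.mat e z 0 i) y = 0 := fun i => he.pd_mat_zero hy i 0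
  have hd0' : ∀ i, pd 0 (fun z => g.mat e z i 0) y = 0 := fun i => by rw [hsymd, hd0]
  simp only [he.cov_mimeticTensor h hy]
  constructor
  · intro hc
    -- The components `μ, 0, 0` give `-∂_μ β + 2 ∂_μ ζ = 0`. As `V` has no spatial derivative, this
    -- is `(4/3) ∂_μ ζ = 0`.
    have hζ : ∀ μ : Fin 3, pd μ.succ (ζ ∘ e.symm) y = 0 := fun μ => by
      have := hc μ.succ 0 0
      simp [hd0, hd0', hm0, hβ, Fin.succ_ne_zero] at this
      linarith
    refine ⟨hζ, fun μ ν => ?_⟩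
    -- Here `∇₀ C_{μν} = (∂₀β) g_{μν}`, while `∇_μ C_{0ν} = -ζ ∂₀ g_{μν}`.
    have := hc 0 μ.succ ν.succ
    simp [hd0, he.mat_zero hy, hβ, hζ, Fin.succ_ne_zero] at this
    linarith
  · rintro ⟨hζ, hh⟩ j k l
    refine Fin.cases ?_ (fun j => ?_) j <;> refine Fin.cases ?_ (fun k => ?_) k <;>
      refine Fin.cases ?_ (fun l => ?_) l
    · rfl
    · rfl
    · simp [hd0, hd0', hm0, hβ, hζ, Fin.succ_ne_zero]
    · have := hh k l
      simp [hd0, he.mat_zero hy, hβ, hζ, Fin.succ_ne_zero]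
      linarith
    · simp [hd0, hd0', hm0, hβ, hζ, Fin.succ_ne_zero]
    · have := hh j l
      simp [hd0, he.mat_zero hy, hβ, hζ, Fin.succ_ne_zero]
      linarith
    · simp [hm0, hβ, hζ, Fin.succ_ne_zero]
      exact Or.inl (hsymd _ _)
    · simp [hβ, hζ, Fin.succ_ne_zero]

end GaussianCodazzi

/-! ### Curvature of a warped product -/

section Warped

/-- The projection to the spatial coordinates, as a continuous linear map. -/
def spatialCLM : Coord 4 →L[ℝ] Coord 3 :=
  LinearMap.toContinuousLinearMap
    { toFun := spatial
      map_add' := fun _ _ => rfl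
      map_smul' := fun _ _ => rfl }

/-- The point with time `t` and spatial coordinates `x`. -/
def spaceTime (t : ℝ) (x : Coord 3) : Coord 4 := WithLp.toLp 2 (Fin.cons t x.ofLp)

theorem spatial_spaceTime (t : ℝ) (x : Coord 3) : spatial (spaceTime t x) = x := rfl

theorem spaceTime_zero (t : ℝ) (x : Coord 3) : spaceTime t x 0 = t := rfl

theorem spaceTime_spatial (y : Coord 4) : spaceTime (y 0) (spatial y) = y := by
  ext i
  refine Fin.cases rfl (fun μ => rfl) i

/-- The scale factor and `g⋆` are smooth only on projections of the chart domain. Openness of the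
projections turns this into genuine differentiability. -/
theorem isOpenMap_spatial : IsOpenMap spatial :=
  spatialCLM.isOpenMap fun x => ⟨spaceTime 0 x, spatial_spaceTime 0 x⟩

theorem isOpenMap_time : IsOpenMap fun y : Coord 4 => y 0 :=
  (EuclideanSpace.proj 0 : Coord 4 →L[ℝ] ℝ).isOpenMap fun t => ⟨spaceTime t 0, rfl⟩

theorem spatial_ev_zero : spatial (ev 0) = 0 := by
  ext μ
  simp [spatial]

theorem spatial_ev_succ (μ : Fin 3) : spatial (ev μ.succ) = ev μ := by
  ext ν
  simp [spatial]

theorem fderiv_comp_spatial {F : Coord 3 → ℝ} {y : Coord 4}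
    (hF : DifferentiableAt ℝ F (spatial y)) (v : Coord 4) :
    fderiv ℝ (fun z => F (spatial z)) y v = fderiv ℝ F (spatial y) (spatial v) := by
  have h : HasFDerivAt (fun z => F (spatial z)) ((fderiv ℝ F (spatial y)).comp spatialCLM) y :=
    hF.hasFDerivAt.comp y spatialCLM.hasFDerivAt
  rw [h.fderiv]
  rfl

theorem differentiableAt_comp_spatial {F : Coord 3 → ℝ} {y : Coord 4}
    (hF : DifferentiableAt ℝ F (spatial y)) : DifferentiableAt ℝ (fun z => F (spatial z)) y :=
  (hF.hasFDerivAt.comp y spatialCLM.hasFDerivAt).differentiableAt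

theorem pd_zero_comp_spatial {F : Coord 3 → ℝ} {y : Coord 4}
    (hF : DifferentiableAt ℝ F (spatial y)) : pd 0 (fun z => F (spatial z)) y = 0 := by
  rw [pd, fderiv_comp_spatial hF, spatial_ev_zero, map_zero]

theorem pd_succ_comp_spatial {F : Coord 3 → ℝ} {y : Coord 4}
    (hF : DifferentiableAt ℝ F (spatial y)) (μ : Fin 3) :
    pd μ.succ (fun z => F (spatial z)) y = pd μ F (spatial y) := by
  rw [pd, fderiv_comp_spatial hF, spatial_ev_succ, pd]

theorem hasFDerivAt_comp_time {f : ℝ → ℝ} {y : Coord 4} (hf : DifferentiableAt ℝ f (y 0)) :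
    HasFDerivAt (fun z : Coord 4 => f (z 0))
      (deriv f (y 0) • (EuclideanSpace.proj 0 : Coord 4 →L[ℝ] ℝ)) y :=
  hf.hasDerivAt.comp_hasFDerivAt y (EuclideanSpace.proj 0 : Coord 4 →L[ℝ] ℝ).hasFDerivAt

theorem pd_zero_comp_time {f : ℝ → ℝ} {y : Coord 4} (hf : DifferentiableAt ℝ f (y 0)) :
    pd 0 (fun z : Coord 4 => f (z 0)) y = deriv f (y 0) := by
  rw [pd, (hasFDerivAt_comp_time hf).fderiv]
  simp

theorem pd_succ_comp_time {f : ℝ → ℝ} {y : Coord 4} (hf : DifferentiableAt ℝ f (y 0))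
    (μ : Fin 3) : pd μ.succ (fun z : Coord 4 => f (z 0)) y = 0 := by
  rw [pd, (hasFDerivAt_comp_time hf).fderiv]
  simp

theorem pd_eqOn {n : ℕ} {S : Set (Coord n)} (hS : IsOpen S) {f f' : Coord n → ℝ}
    (h : ∀ z ∈ S, f z = f' z) {y : Coord n} (hy : y ∈ S) (i : Fin n) : pd i f y = pd i f' y :=
  pd_congr (Filter.eventually_of_mem (hS.mem_nhds hy) h) i

theorem contDiffOn_christoffel {n : ℕ} {S : Set (Coord n)} (hS : IsOpen S)
    {G : Coord n → Matrix (Fin n) (Fin n) ℝ} (hG : ∀ i j, ContDiffOn ℝ ∞ (fun y => G y i j) S)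
    (hdet : ∀ y ∈ S, IsUnit (G y).det) (m i j : Fin n) :
    ContDiffOn ℝ ∞ (christoffel G m i j) S :=
  contDiffOn_const.mul (ContDiffOn.sum fun l _ => (contDiffOn_inv hG hdet m l).mul
    (((contDiffOn_pd hS (hG l j) i).add (contDiffOn_pd hS (hG l i) j)).sub
      (contDiffOn_pd hS (hG i j) l)))

/-- On the open set `S`, the metric `G` is `-dt² + a(t)² g⋆(x)`. -/
structure IsWarpedMetric (G : Coord 4 → Matrix (Fin 4) (Fin 4) ℝ) (S : Set (Coord 4))
    (a : ℝ → ℝ) (gs : Coord 3 → Matrix (Fin 3) (Fin 3) ℝ) : Prop where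
  isOpen : IsOpen S
  smooth_scale : ContDiffOn ℝ ∞ a ((fun y : Coord 4 => y 0) '' S)
  scale_pos : ∀ y ∈ S, 0 < a (y 0)
  smooth_space : ∀ μ ν, ContDiffOn ℝ ∞ (fun x => gs x μ ν) (spatial '' S)
  posDef_space : ∀ y ∈ S, (gs (spatial y)).PosDef
  metric_time : ∀ y ∈ S, G y 0 0 = -1
  metric_mixed : ∀ y ∈ S, ∀ μ : Fin 3, G y 0 μ.succ = 0
  metric_mixed' : ∀ y ∈ S, ∀ μ : Fin 3, G y μ.succ 0 = 0
  metric_space : ∀ y ∈ S, ∀ μ ν : Fin 3,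
    G y μ.succ ν.succ = a (y 0) ^ 2 * gs (spatial y) μ ν

/-! ### Inverse metric and Christoffel symbols of `-dt² + a² g⋆` -/

namespace IsWarpedMetric

variable {G : Coord 4 → Matrix (Fin 4) (Fin 4) ℝ} {S : Set (Coord 4)} {a : ℝ → ℝ}
  {gs : Coord 3 → Matrix (Fin 3) (Fin 3) ℝ} (h : IsWarpedMetric G S a gs) {y : Coord 4}
  (hy : y ∈ S)

include h

theorem isOpen_time : IsOpen ((fun y : Coord 4 => y 0) '' S) := isOpenMap_time _ h.isOpen

theorem isOpen_space : IsOpen (spatial '' S) := isOpenMap_spatial _ h.isOpen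

theorem contDiffOn_deriv : ContDiffOn ℝ ∞ (deriv a) ((fun y : Coord 4 => y 0) '' S) :=
  h.smooth_scale.deriv_of_isOpen h.isOpen_time (by simp)

theorem isUnit_det {x : Coord 3} (hx : x ∈ spatial '' S) : IsUnit (gs x).det := by
  obtain ⟨y, hy, rfl⟩ := hx
  exact (h.posDef_space y hy).det_pos.ne'.isUnit

include hy

theorem differentiableAt_scale : DifferentiableAt ℝ a (y 0) :=
  (h.smooth_scale.contDiffAt (h.isOpen_time.mem_nhds ⟨y, hy, rfl⟩)).differentiableAt (by simp)

theorem differentiableAt_deriv : DifferentiableAt ℝ (deriv a) (y 0) :=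
  (h.contDiffOn_deriv.contDiffAt (h.isOpen_time.mem_nhds ⟨y, hy, rfl⟩)).differentiableAt (by simp)

theorem differentiableAt_space (μ ν : Fin 3) :
    DifferentiableAt ℝ (fun x => gs x μ ν) (spatial y) :=
  differentiableAt_of_contDiffOn h.isOpen_space (h.smooth_space μ ν) ⟨y, hy, rfl⟩

theorem differentiableAt_christoffel (l μ ν : Fin 3) :
    DifferentiableAt ℝ (christoffel gs l μ ν) (spatial y) :=
  differentiableAt_of_contDiffOn h.isOpen_space
    (contDiffOn_christoffel h.isOpen_space h.smooth_space (fun _ hx => h.isUnit_det hx) l μ ν)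
    ⟨y, hy, rfl⟩

theorem symm_space (μ ν : Fin 3) : gs (spatial y) μ ν = gs (spatial y) ν μ := by
  have := (h.posDef_space y hy).isHermitian.apply ν μ
  simpa using this

theorem inv_mul_space (μ ν : Fin 3) :
    ∑ l, (gs (spatial y))⁻¹ μ l * gs (spatial y) l ν = if μ = ν then 1 else 0 := by
  rw [← Matrix.mul_apply, Matrix.nonsing_inv_mul _ (h.isUnit_det ⟨y, hy, rfl⟩), Matrix.one_apply]

theorem trace_space : ∑ μ, ∑ ν, (gs (spatial y))⁻¹ μ ν * gs (spatial y) μ ν = 3 := by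
  have : ∀ μ, ∑ ν, (gs (spatial y))⁻¹ μ ν * gs (spatial y) μ ν = 1 := fun μ => by
    simp only [fun ν => h.symm_space hy μ ν, h.inv_mul_space hy, if_true]
  simp [this]

/-- The inverse metric. -/
theorem inv_eq : (G y)⁻¹ = Matrix.of (Fin.cons (Fin.cons (-1) fun _ => 0)
    fun μ => Fin.cons 0 fun ν => (a (y 0) ^ 2)⁻¹ * (gs (spatial y))⁻¹ μ ν) := by
  have ha := (h.scale_pos y hy).ne'
  refine Matrix.inv_eq_left_inv ?_
  ext i j
  rw [Matrix.mul_apply, Fin.sum_univ_succ]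
  refine Fin.cases ?_ (fun μ => ?_) i <;> refine Fin.cases ?_ (fun ν => ?_) j
  · simp [h.metric_time y hy]
  · simp [h.metric_mixed y hy, (Fin.succ_ne_zero _).symm]
  · simp [h.metric_mixed' y hy, Fin.succ_ne_zero]
  · have h1 : ∑ l, (a (y 0) ^ 2)⁻¹ * (gs (spatial y))⁻¹ μ l * (a (y 0) ^ 2 * gs (spatial y) l ν)
        = if μ = ν then 1 else 0 := by
      rw [← h.inv_mul_space hy μ ν]
      refine Finset.sum_congr rfl fun l _ => ?_
      field_simp
    simp [h.metric_space y hy, Matrix.one_apply, h1]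

theorem inv_zero_zero : (G y)⁻¹ 0 0 = -1 := by rw [h.inv_eq hy]; rfl

theorem inv_zero_succ (μ : Fin 3) : (G y)⁻¹ 0 μ.succ = 0 := by rw [h.inv_eq hy]; rfl

theorem inv_succ_zero (μ : Fin 3) : (G y)⁻¹ μ.succ 0 = 0 := by rw [h.inv_eq hy]; rfl

theorem inv_succ_succ (μ ν : Fin 3) :
    (G y)⁻¹ μ.succ ν.succ = (a (y 0) ^ 2)⁻¹ * (gs (spatial y))⁻¹ μ ν := by rw [h.inv_eq hy]; rfl

theorem pd_time (i : Fin 4) : pd i (fun z => G z 0 0) y = 0 := by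
  rw [pd_eqOn h.isOpen h.metric_time hy, pd_const]

theorem pd_mixed (i : Fin 4) (μ : Fin 3) : pd i (fun z => G z 0 μ.succ) y = 0 := by
  rw [pd_eqOn h.isOpen (fun z hz => h.metric_mixed z hz μ) hy, pd_const]

theorem pd_mixed' (i : Fin 4) (μ : Fin 3) : pd i (fun z => G z μ.succ 0) y = 0 := by
  rw [pd_eqOn h.isOpen (fun z hz => h.metric_mixed' z hz μ) hy, pd_const]

theorem pd_zero_space (μ ν : Fin 3) : pd 0 (fun z => G z μ.succ ν.succ) y =
    2 * (a (y 0) * deriv a (y 0)) * gs (spatial y) μ ν := by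
  have hs := h.differentiableAt_scale hy
  have hg := h.differentiableAt_space hy μ ν
  rw [pd_eqOn h.isOpen (fun z hz => h.metric_space z hz μ ν) hy,
    pd_mul (hasFDerivAt_comp_time (f := fun t => a t ^ 2) (hs.pow 2)).differentiableAt
      (differentiableAt_comp_spatial hg),
    pd_zero_comp_spatial hg, pd_zero_comp_time (f := fun t => a t ^ 2) (hs.pow 2),
    deriv_fun_pow hs]
  push_cast
  ring

theorem pd_succ_space (l μ ν : Fin 3) : pd l.succ (fun z => G z μ.succ ν.succ) y =
    a (y 0) ^ 2 * pd l (fun x => gs x μ ν) (spatial y) := by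
  have hs := h.differentiableAt_scale hy
  have hg := h.differentiableAt_space hy μ ν
  rw [pd_eqOn h.isOpen (fun z hz => h.metric_space z hz μ ν) hy,
    pd_mul (hasFDerivAt_comp_time (f := fun t => a t ^ 2) (hs.pow 2)).differentiableAt
      (differentiableAt_comp_spatial hg),
    pd_succ_comp_spatial hg, pd_succ_comp_time (f := fun t => a t ^ 2) (hs.pow 2)]
  simp

theorem christoffel_time_time (m : Fin 4) : christoffel G m 0 0 y = 0 := by
  rw [christoffel, Fin.sum_univ_succ]
  simp [h.pd_time hy, h.pd_mixed' hy]

theorem christoffel_zero_zero (μ : Fin 3) : christoffel G 0 0 μ.succ y = 0 := by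
  rw [christoffel, Fin.sum_univ_succ]
  simp [h.pd_time hy, h.inv_zero_succ hy]

theorem christoffel_zero_zero' (μ : Fin 3) : christoffel G 0 μ.succ 0 y = 0 := by
  rw [christoffel, Fin.sum_univ_succ]
  simp [h.pd_time hy, h.pd_mixed' hy, h.inv_zero_succ hy]
  exact Or.inr (h.pd_mixed hy 0 μ)

theorem christoffel_zero_space (μ ν : Fin 3) :
    christoffel G 0 μ.succ ν.succ y = a (y 0) * deriv a (y 0) * gs (spatial y) μ ν := by
  rw [christoffel, Fin.sum_univ_succ]
  simp [h.pd_mixed hy, h.inv_zero_succ hy, h.inv_zero_zero hy, h.pd_zero_space hy]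
  ring

/-- Half the inverse metric times its time derivative is the Hubble rate `a'/a` times the identity,
the common value of the mixed Christoffel symbols. -/
theorem sum_inv_mul_pd (l ν : Fin 3) : (1 / 2) * ∑ k : Fin 3, (G y)⁻¹ l.succ k.succ *
    pd 0 (fun z => G z k.succ ν.succ) y = if l = ν then deriv a (y 0) / a (y 0) else 0 := by
  have ha := (h.scale_pos y hy).ne'
  calc _ = deriv a (y 0) / a (y 0) *
        ∑ k, (gs (spatial y))⁻¹ l k * gs (spatial y) k ν := by
        rw [Finset.mul_sum, Finset.mul_sum]
        refine Finset.sum_congr rfl fun k _ => ?_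
        rw [h.inv_succ_succ hy, h.pd_zero_space hy]
        field_simp
    _ = _ := by rw [h.inv_mul_space hy]; simp

theorem christoffel_space_time (l ν : Fin 3) :
    christoffel G l.succ 0 ν.succ y = if l = ν then deriv a (y 0) / a (y 0) else 0 := by
  rw [← h.sum_inv_mul_pd hy, christoffel, Fin.sum_univ_succ]
  simp [h.pd_mixed hy, h.pd_mixed' hy, h.inv_succ_zero hy]

theorem christoffel_space_time' (l ν : Fin 3) :
    christoffel G l.succ ν.succ 0 y = if l = ν then deriv a (y 0) / a (y 0) else 0 := by
  rw [← h.sum_inv_mul_pd hy, christoffel, Fin.sum_univ_succ]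
  simp [h.pd_mixed' hy, h.inv_succ_zero hy]

theorem christoffel_space (l μ ν : Fin 3) :
    christoffel G l.succ μ.succ ν.succ y = christoffel gs l μ ν (spatial y) := by
  have ha := (h.scale_pos y hy).ne'
  rw [christoffel, Fin.sum_univ_succ, h.inv_succ_zero hy, zero_mul, zero_add, christoffel]
  congr 1
  refine Finset.sum_congr rfl fun k _ => ?_
  rw [h.inv_succ_succ hy, h.pd_succ_space hy, h.pd_succ_space hy, h.pd_succ_space hy]
  field_simp

end IsWarpedMetric

end Warped

/-! ### Riemann, Ricci and Einstein tensors of a warped product -/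

section WarpedCurvature

theorem riemann_self {n : ℕ} (G : Coord n → Matrix (Fin n) (Fin n) ℝ) (m j k : Fin n)
    (y : Coord n) : riemann G m j k k y = 0 := by
  simp [riemann]

namespace IsWarpedMetric

variable {G : Coord 4 → Matrix (Fin 4) (Fin 4) ℝ} {S : Set (Coord 4)} {a : ℝ → ℝ}
  {gs : Coord 3 → Matrix (Fin 3) (Fin 3) ℝ} (h : IsWarpedMetric G S a gs) {y : Coord 4}
  (hy : y ∈ S)

include h hy

theorem differentiableAt_hubble : DifferentiableAt ℝ (fun t => deriv a t / a t) (y 0) :=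
  (h.differentiableAt_deriv hy).fun_div (h.differentiableAt_scale hy) (h.scale_pos y hy).ne'

theorem deriv_hubble : deriv (fun t => deriv a t / a t) (y 0) =
    deriv (deriv a) (y 0) / a (y 0) - (deriv a (y 0) / a (y 0)) ^ 2 := by
  have ha := (h.scale_pos y hy).ne'
  rw [deriv_fun_div (h.differentiableAt_deriv hy) (h.differentiableAt_scale hy) ha]
  field_simp

theorem pd_christoffel_time_time (i m : Fin 4) : pd i (christoffel G m 0 0) y = 0 := by
  rw [pd_eqOn h.isOpen (fun z hz => h.christoffel_time_time hz m) hy, pd_const]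

theorem pd_christoffel_zero_zero (i : Fin 4) (μ : Fin 3) :
    pd i (christoffel G 0 0 μ.succ) y = 0 := by
  rw [pd_eqOn h.isOpen (fun z hz => h.christoffel_zero_zero hz μ) hy, pd_const]

theorem pd_christoffel_zero_space (μ ν : Fin 3) : pd 0 (christoffel G 0 μ.succ ν.succ) y =
    (deriv a (y 0) ^ 2 + a (y 0) * deriv (deriv a) (y 0)) * gs (spatial y) μ ν := by
  have hs := h.differentiableAt_scale hy
  have hd := h.differentiableAt_deriv hy
  have hg := h.differentiableAt_space hy μ ν
  rw [pd_eqOn h.isOpen (fun z hz => h.christoffel_zero_space hz μ ν) hy,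
    pd_mul (hasFDerivAt_comp_time (f := fun t => a t * deriv a t)
      (hs.fun_mul hd)).differentiableAt (differentiableAt_comp_spatial hg),
    pd_zero_comp_spatial hg, pd_zero_comp_time (f := fun t => a t * deriv a t) (hs.fun_mul hd),
    deriv_fun_mul hs hd]
  ring

theorem pd_zero_christoffel_space_time' (l ν : Fin 3) :
    pd 0 (christoffel G l.succ ν.succ 0) y =
      if l = ν then deriv (deriv a) (y 0) / a (y 0) - (deriv a (y 0) / a (y 0)) ^ 2 else 0 := by
  rw [pd_eqOn h.isOpen (fun z hz => h.christoffel_space_time' hz l ν) hy]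
  split_ifs
  · rw [pd_zero_comp_time (f := fun t => deriv a t / a t) (h.differentiableAt_hubble hy),
      h.deriv_hubble hy]
  · rw [pd_const]

theorem pd_succ_christoffel_space_time (k l ν : Fin 3) :
    pd k.succ (christoffel G l.succ 0 ν.succ) y = 0 := by
  rw [pd_eqOn h.isOpen (fun z hz => h.christoffel_space_time hz l ν) hy]
  split_ifs
  · rw [pd_succ_comp_time (f := fun t => deriv a t / a t) (h.differentiableAt_hubble hy)]
  · rw [pd_const]

theorem pd_zero_christoffel_space (l μ ν : Fin 3) :
    pd 0 (christoffel G l.succ μ.succ ν.succ) y = 0 := by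
  rw [pd_eqOn h.isOpen (fun z hz => h.christoffel_space hz l μ ν) hy,
    pd_zero_comp_spatial (h.differentiableAt_christoffel hy l μ ν)]

theorem pd_succ_christoffel_space (k l μ ν : Fin 3) :
    pd k.succ (christoffel G l.succ μ.succ ν.succ) y =
      pd k (christoffel gs l μ ν) (spatial y) := by
  rw [pd_eqOn h.isOpen (fun z hz => h.christoffel_space hz l μ ν) hy,
    pd_succ_comp_spatial (h.differentiableAt_christoffel hy l μ ν)]

/-- Only Riemann components whose first and third indices agree are computed here and below: they
are the summands of the Ricci tensor. -/
theorem riemann_time (μ : Fin 3) :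
    riemann G μ.succ 0 μ.succ 0 y = -(deriv (deriv a) (y 0) / a (y 0)) := by
  rw [riemann, Fin.sum_univ_succ, h.pd_christoffel_time_time hy,
    h.pd_zero_christoffel_space_time' hy]
  simp [h.christoffel_time_time hy, h.christoffel_space_time hy, h.christoffel_space_time' hy]
  ring

theorem riemann_mixed (κ μ : Fin 3) : riemann G κ.succ μ.succ κ.succ 0 y = 0 := by
  rw [riemann, Fin.sum_univ_succ, h.pd_succ_christoffel_space_time hy,
    h.pd_zero_christoffel_space hy]
  simp [h.christoffel_time_time hy, h.christoffel_space_time hy, h.christoffel_zero_zero hy,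
    h.christoffel_space hy]
  ring

theorem riemann_zero_space (μ ν : Fin 3) : riemann G 0 μ.succ 0 ν.succ y =
    a (y 0) * deriv (deriv a) (y 0) * gs (spatial y) μ ν := by
  have ha := (h.scale_pos y hy).ne'
  rw [riemann, Fin.sum_univ_succ, h.pd_christoffel_zero_space hy, h.pd_christoffel_zero_zero hy]
  simp [h.christoffel_time_time hy, h.christoffel_space_time hy, h.christoffel_zero_zero hy,
    h.christoffel_zero_space hy, h.symm_space hy ν μ]
  field_simp
  ring

/-- Gauss equation: the extrinsic curvature `a a' g⋆` of the time slices adds the terms in `a'²`. -/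
theorem riemann_space (κ μ ν : Fin 3) : riemann G κ.succ μ.succ κ.succ ν.succ y =
    riemann gs κ μ κ ν (spatial y) + deriv a (y 0) ^ 2 *
      (gs (spatial y) μ ν - if κ = ν then gs (spatial y) μ ν else 0) := by
  have ha := (h.scale_pos y hy).ne'
  rw [riemann, Fin.sum_univ_succ, h.pd_succ_christoffel_space hy, h.pd_succ_christoffel_space hy,
    riemann]
  simp only [h.christoffel_space_time' hy, h.christoffel_zero_space hy, h.christoffel_space hy,
    if_true, h.symm_space hy ν μ]
  by_cases hκ : κ = ν
  · subst hκ
    simp only [if_true, h.symm_space hy κ μ]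
    ring
  · simp only [hκ, if_false]
    field_simp
    ring

theorem ricci_time : ricci G 0 0 y = -3 * (deriv (deriv a) (y 0) / a (y 0)) := by
  rw [ricci, Fin.sum_univ_succ, riemann_self]
  simp [h.riemann_time hy]

theorem ricci_mixed (μ : Fin 3) : ricci G μ.succ 0 y = 0 := by
  rw [ricci, Fin.sum_univ_succ, riemann_self]
  simp [h.riemann_mixed hy]

theorem ricci_space (μ ν : Fin 3) : ricci G μ.succ ν.succ y = ricci gs μ ν (spatial y) +
    (a (y 0) * deriv (deriv a) (y 0) + 2 * deriv a (y 0) ^ 2) * gs (spatial y) μ ν := by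
  rw [ricci, Fin.sum_univ_succ, h.riemann_zero_space hy]
  simp only [h.riemann_space hy, Finset.sum_add_distrib, ← Finset.mul_sum, Finset.sum_sub_distrib]
  simp [ricci]
  ring

theorem trace_eq (C : Fin 4 → Fin 4 → Coord 4 → ℝ) : trace G C y =
    -C 0 0 y + (a (y 0) ^ 2)⁻¹ *
      ∑ μ : Fin 3, ∑ ν : Fin 3, (gs (spatial y))⁻¹ μ ν * C μ.succ ν.succ y := by
  have hk : ∀ k, ∑ l, (G y)⁻¹ k l * C k l y = (G y)⁻¹ k 0 * C k 0 y
      + ∑ ν : Fin 3, (G y)⁻¹ k ν.succ * C k ν.succ y := fun k => Fin.sum_univ_succ _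
  rw [trace, Fin.sum_univ_succ]
  simp only [hk, h.inv_zero_zero hy, h.inv_zero_succ hy, h.inv_succ_zero hy, h.inv_succ_succ hy,
    Finset.mul_sum, mul_assoc]
  simp

theorem sum_inv_mul_ricci : ∑ μ : Fin 3, ∑ ν : Fin 3,
    (gs (spatial y))⁻¹ μ ν * ricci G μ.succ ν.succ y = trace gs (ricci gs) (spatial y) +
      3 * (a (y 0) * deriv (deriv a) (y 0) + 2 * deriv a (y 0) ^ 2) := by
  rw [← h.trace_space hy, Finset.sum_mul, trace, ← Finset.sum_add_distrib]
  refine Finset.sum_congr rfl fun μ _ => ?_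
  rw [Finset.sum_mul, ← Finset.sum_add_distrib]
  refine Finset.sum_congr rfl fun ν _ => ?_
  rw [h.ricci_space hy]
  ring

theorem scalar_eq : trace G (ricci G) y = (a (y 0) ^ 2)⁻¹ * trace gs (ricci gs) (spatial y)
    + 6 * (deriv (deriv a) (y 0) / a (y 0)) + 6 * (deriv a (y 0) / a (y 0)) ^ 2 := by
  have ha := (h.scale_pos y hy).ne'
  rw [h.trace_eq hy, h.sum_inv_mul_ricci hy, h.ricci_time hy]
  field_simp
  ring

/-- The second derivative of `a` cancels between `R₀₀` and the scalar curvature, leaving the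
geometric side of the first Friedmann equation. -/
theorem einstein_time : einstein G 0 0 y =
    (1 / 2) * (a (y 0) ^ 2)⁻¹ * trace gs (ricci gs) (spatial y)
      + 3 * (deriv a (y 0) / a (y 0)) ^ 2 := by
  rw [einstein, h.scalar_eq hy, h.ricci_time hy, h.metric_time y hy]
  ring

theorem einstein_mixed (μ : Fin 3) : einstein G μ.succ 0 y = 0 := by
  rw [einstein, h.ricci_mixed hy, h.metric_mixed' y hy]
  ring

/-- Energy conservation involves the spatial stresses only through their trace. -/
theorem sum_inv_mul_einstein : ∑ μ : Fin 3, ∑ ν : Fin 3,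
    (gs (spatial y))⁻¹ μ ν * einstein G μ.succ ν.succ y =
      -(1 / 2) * trace gs (ricci gs) (spatial y)
        - 6 * (a (y 0) * deriv (deriv a) (y 0)) - 3 * deriv a (y 0) ^ 2 := by
  have ha := (h.scale_pos y hy).ne'
  have h1 : ∑ μ : Fin 3, ∑ ν : Fin 3, (gs (spatial y))⁻¹ μ ν * einstein G μ.succ ν.succ y =
      ∑ μ : Fin 3, ∑ ν : Fin 3, (gs (spatial y))⁻¹ μ ν * ricci G μ.succ ν.succ y
      - (1 / 2) * trace G (ricci G) y * a (y 0) ^ 2 *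
        ∑ μ, ∑ ν, (gs (spatial y))⁻¹ μ ν * gs (spatial y) μ ν := by
    rw [Finset.mul_sum, ← Finset.sum_sub_distrib]
    refine Finset.sum_congr rfl fun μ _ => ?_
    rw [Finset.mul_sum, ← Finset.sum_sub_distrib]
    refine Finset.sum_congr rfl fun ν _ => ?_
    rw [einstein, h.metric_space y hy]
    ring
  rw [h1, h.trace_space hy, h.sum_inv_mul_ricci hy, h.scalar_eq hy]
  field_simp
  ring

end IsWarpedMetric

end WarpedCurvature

/-! ### Conservation of matter in warped charts -/

section Conservation

theorem contDiffOn_trace_ricci {n : ℕ} {S : Set (Coord n)} (hS : IsOpen S)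
    {G : Coord n → Matrix (Fin n) (Fin n) ℝ} (hG : ∀ i j, ContDiffOn ℝ ∞ (fun y => G y i j) S)
    (hdet : ∀ y ∈ S, IsUnit (G y).det) : ContDiffOn ℝ ∞ (trace G (ricci G)) S := by
  have hc := contDiffOn_christoffel hS hG hdet
  refine ContDiffOn.sum fun k _ => ContDiffOn.sum fun l _ => (contDiffOn_inv hG hdet k l).mul
    (ContDiffOn.sum fun m _ => ?_)
  refine ((contDiffOn_pd hS (hc m l k) m).sub (contDiffOn_pd hS (hc m m k) l)).add
    (ContDiffOn.sum fun r _ => ?_)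
  exact ((hc m m r).mul (hc r l k)).sub ((hc m l r).mul (hc r m k))

namespace IsWarpedMetric

variable {G : Coord 4 → Matrix (Fin 4) (Fin 4) ℝ} {S : Set (Coord 4)} {a : ℝ → ℝ}
  {gs : Coord 3 → Matrix (Fin 3) (Fin 3) ℝ} (h : IsWarpedMetric G S a gs) {y : Coord 4}
  (hy : y ∈ S)

include h hy

/-- The balance `ρ' + (a'/a)(3ρ + tr S) = 0` in the absence of momentum density; the mixed
components must vanish on an open set because they are differentiated. -/
theorem divergence_time {T : Fin 4 → Fin 4 → Coord 4 → ℝ}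
    (hT : ∀ z ∈ S, ∀ μ : Fin 3, T μ.succ 0 z = 0) :
    divergence G T 0 y = -pd 0 (T 0 0) y - deriv a (y 0) / a (y 0) * (3 * T 0 0 y +
      (a (y 0) ^ 2)⁻¹ * ∑ μ : Fin 3, ∑ ν : Fin 3,
        (gs (spatial y))⁻¹ μ ν * T μ.succ ν.succ y) := by
  have ha := (h.scale_pos y hy).ne'
  have h00 : cov G T 0 0 0 y = pd 0 (T 0 0) y := by
    simp [cov, h.christoffel_time_time hy]
  have hs : ∀ μ ν : Fin 3, cov G T ν.succ μ.succ 0 y =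
      -(a (y 0) * deriv a (y 0) * gs (spatial y) μ ν * T 0 0 y)
        - deriv a (y 0) / a (y 0) * T μ.succ ν.succ y := fun μ ν => by
    rw [cov, pd_eqOn h.isOpen (fun z hz => hT z hz μ) hy, pd_const, Fin.sum_univ_succ]
    simp [h.christoffel_zero_space hy, h.christoffel_zero_zero' hy, h.christoffel_space_time' hy,
      hT y hy, h.symm_space hy ν μ]
    ring
  have hk : ∀ k, ∑ m, (G y)⁻¹ k m * cov G T m k 0 y = (G y)⁻¹ k 0 * cov G T 0 k 0 y
      + ∑ ν : Fin 3, (G y)⁻¹ k ν.succ * cov G T ν.succ k 0 y := fun k => Fin.sum_univ_succ _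
  have hsum : ∑ μ : Fin 3, ∑ ν : Fin 3, (a (y 0) ^ 2)⁻¹ * (gs (spatial y))⁻¹ μ ν *
      cov G T ν.succ μ.succ 0 y = -(deriv a (y 0) / a (y 0) * (3 * T 0 0 y +
        (a (y 0) ^ 2)⁻¹ * ∑ μ : Fin 3, ∑ ν : Fin 3,
          (gs (spatial y))⁻¹ μ ν * T μ.succ ν.succ y)) := by
    rw [← h.trace_space hy, Finset.sum_mul, Finset.mul_sum, ← Finset.sum_add_distrib,
      Finset.mul_sum, ← Finset.sum_neg_distrib]
    refine Finset.sum_congr rfl fun μ _ => ?_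
    rw [Finset.sum_mul, Finset.mul_sum, ← Finset.sum_add_distrib, Finset.mul_sum,
      ← Finset.sum_neg_distrib]
    refine Finset.sum_congr rfl fun ν _ => ?_
    rw [hs]
    field_simp
    ring
  rw [divergence, Fin.sum_univ_succ]
  simp only [hk, h.inv_zero_zero hy, h.inv_zero_succ hy, h.inv_succ_zero hy, h.inv_succ_succ hy,
    h00, zero_mul, zero_add, Finset.sum_const_zero, add_zero]
  rw [hsum]
  ring

/-- With `sum_inv_mul_einstein` this supplies what the time component of the contracted Bianchi
identity would give; the curvature of `g⋆` is constant in `t`. -/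
theorem pd_einstein_time : pd 0 (einstein G 0 0) y =
    -(deriv a (y 0) / a (y 0)) * (a (y 0) ^ 2)⁻¹ * trace gs (ricci gs) (spatial y)
      + 6 * (deriv a (y 0) / a (y 0)) *
        (deriv (deriv a) (y 0) / a (y 0) - (deriv a (y 0) / a (y 0)) ^ 2) := by
  have ha := (h.scale_pos y hy).ne'
  have hs := h.differentiableAt_scale hy
  have hH := h.differentiableAt_hubble hy
  have hR : DifferentiableAt ℝ (trace gs (ricci gs)) (spatial y) :=
    differentiableAt_of_contDiffOn h.isOpen_space
      (contDiffOn_trace_ricci h.isOpen_space h.smooth_space fun _ hx => h.isUnit_det hx)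
      ⟨y, hy, rfl⟩
  have h1 : DifferentiableAt ℝ (fun t => (1 / 2) * (a t ^ 2)⁻¹) (y 0) :=
    ((hs.fun_pow 2).fun_inv (pow_ne_zero 2 ha)).const_mul _
  have h2 : DifferentiableAt ℝ (fun t => 3 * (deriv a t / a t) ^ 2) (y 0) :=
    (hH.fun_pow 2).const_mul _
  have d1 : deriv (fun t => (1 / 2) * (a t ^ 2)⁻¹) (y 0) =
      -(deriv a (y 0) / a (y 0)) * (a (y 0) ^ 2)⁻¹ := by
    rw [deriv_const_mul _ ((hs.fun_pow 2).fun_inv (pow_ne_zero 2 ha)),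
      deriv_fun_inv'' (hs.fun_pow 2) (pow_ne_zero 2 ha), deriv_fun_pow hs]
    field_simp
    push_cast
    ring
  have d2 : deriv (fun t => 3 * (deriv a t / a t) ^ 2) (y 0) = 6 * (deriv a (y 0) / a (y 0)) *
      (deriv (deriv a) (y 0) / a (y 0) - (deriv a (y 0) / a (y 0)) ^ 2) := by
    rw [deriv_const_mul _ (hH.fun_pow 2), deriv_fun_pow hH, h.deriv_hubble hy]
    push_cast
    ring
  rw [pd_eqOn h.isOpen (fun z hz => h.einstein_time hz) hy,
    pd_add ((hasFDerivAt_comp_time h1).differentiableAt.fun_mul (differentiableAt_comp_spatial hR))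
      (hasFDerivAt_comp_time h2).differentiableAt,
    pd_mul (hasFDerivAt_comp_time h1).differentiableAt (differentiableAt_comp_spatial hR),
    pd_zero_comp_time h1, pd_zero_comp_time h2, pd_zero_comp_spatial hR, d1, d2]
  ring

end IsWarpedMetric

variable {M : Type*} [TopologicalSpace M] [ChartedSpace (Coord 4) M]
  {g : LorentzMetric M} {T : Tensor2 M} {φ ζ : M → ℝ} {V : ℝ → ℝ}
  {e : OpenPartialHomeomorph M (Coord 4)}

theorem IsWarpedChart.isWarpedMetric {a : ℝ → ℝ} {gs : Coord 3 → Matrix (Fin 3) (Fin 3) ℝ}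
    (he : IsWarpedChart g φ e a gs) : IsWarpedMetric (g.mat e) e.target a gs where
  isOpen := e.open_target
  smooth_scale := he.smooth_scale
  scale_pos := he.scale_pos
  smooth_space := he.smooth_space
  posDef_space := he.posDef_space
  metric_time := he.metric_time
  metric_mixed := he.metric_mixed
  metric_mixed' := fun y hy μ => by rw [(isSymm_mat g e y).apply, he.metric_mixed y hy]
  metric_space := he.metric_space

/-- A function of time has no spatial derivatives. -/
theorem IsGaussianChart.pd_succ_eq_zero (he : IsGaussianChart g φ e) {y : Coord 4}
    (hy : y ∈ e.target) {f : M → ℝ} {F : ℝ → ℝ} (hf : ∀ᶠ x in 𝓝 (e.symm y), f x = F (φ x))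
    (μ : Fin 3) : pd μ.succ (f ∘ e.symm) y = 0 := by
  -- Nothing is known about the regularity of `F`, so the chain rule is avoided: `f` is constant on
  -- a spatial line. If `f` is not differentiable, `fderiv` is zero by convention.
  by_cases hd : DifferentiableAt ℝ (f ∘ e.symm) y
  · have hev : ∀ᶠ z in 𝓝 y, (f ∘ e.symm) z = F (z 0) := by
      filter_upwards [(e.continuousAt_symm hy).eventually hf, e.open_target.mem_nhds hy]
        with z hz hzt
      rw [Function.comp_apply, hz, he.time_eq z hzt]
    have hline : Tendsto (fun s : ℝ => y + s • (EuclideanSpace.single μ.succ (1 : ℝ) : Coord 4))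
        (𝓝 0) (𝓝 y) := by
      have : Continuous fun s : ℝ => y + s • (EuclideanSpace.single μ.succ (1 : ℝ) : Coord 4) := by
        fun_prop
      simpa using this.tendsto 0
    have hc : (fun s : ℝ => (f ∘ e.symm) (y + s • (EuclideanSpace.single μ.succ (1 : ℝ) : Coord 4)))
        =ᶠ[𝓝 0] fun _ => F (y 0) := by
      filter_upwards [hline.eventually hev] with s hs
      rw [hs]
      simp [(Fin.succ_ne_zero μ).symm]
    rw [pd, ← hd.lineDeriv_eq_fderiv, lineDeriv, hc.deriv_eq, deriv_const]
  · rw [pd, fderiv_zero_of_not_differentiableAt hd]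
    rfl

theorem IsGaussianChart.pd_succ_potential (he : IsGaussianChart g φ e) {y : Coord 4}
    (hy : y ∈ e.target) (μ : Fin 3) : pd μ.succ (fun z => V (φ (e.symm z))) y = 0 :=
  he.pd_succ_eq_zero (f := V ∘ φ) (F := V) hy (Filter.Eventually.of_forall fun _ => rfl) μ

variable {a : ℝ → ℝ} {gs : Coord 3 → Matrix (Fin 3) (Fin 3) ℝ}

/-- Eliminates `T`, so that its conservation becomes a statement about `a`, `g⋆`, `ζ` and `V`. -/
theorem IsWarpedChart.matter_eq (he : IsWarpedChart g φ e a gs)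
    (h : IsMimeticSolution g T φ ζ V) {y : Coord 4} (hy : y ∈ e.target) (k l : Fin 4) :
    comp e T k l y = einstein (g.mat e) k l y - 2 * ζ (e.symm y) *
      ((if k = 0 then 1 else 0) * (if l = 0 then 1 else 0))
        - g.mat e y k l * V (φ (e.symm y)) := by
  rw [h.field_equation e he.mem_charts y hy, he.isGaussianChart.pd_time hy,
    he.isGaussianChart.pd_time hy]
  ring

variable [IsManifold (𝓡 4) ∞ M]

/-- Energy conservation in a warped chart. -/
theorem IsWarpedChart.energy_conservation (he : IsWarpedChart g φ e a gs)
    (h : IsMimeticSolution g T φ ζ V) {y : Coord 4} (hy : y ∈ e.target) :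
    2 * pd 0 (ζ ∘ e.symm) y - pd 0 (fun z => V (φ (e.symm z))) y
      + 6 * (deriv a (y 0) / a (y 0)) * ζ (e.symm y) = 0 := by
  have hw := he.isWarpedMetric
  have ha := (hw.scale_pos y hy).ne'
  have hT : ∀ z ∈ e.target, ∀ μ : Fin 3, comp e T μ.succ 0 z = 0 := fun z hz μ => by
    rw [he.matter_eq h hz, hw.einstein_mixed hz, hw.metric_mixed' z hz]
    simp
  have hZd : DifferentiableAt ℝ (ζ ∘ e.symm) y := differentiableAt_of_contDiffOn e.open_target
    (contDiffOn_comp_symm he.mem_charts h.smooth_multiplier) hy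
  have hVd : DifferentiableAt ℝ (fun z => V (φ (e.symm z))) y :=
    differentiableAt_of_contDiffOn e.open_target (h.contDiffOn_potential he.mem_charts) hy
  have hTd : DifferentiableAt ℝ (comp e T 0 0) y :=
    differentiableAt_comp h.smooth_matter he.mem_charts hy 0 0
  have hE : pd 0 (einstein (g.mat e) 0 0) y = pd 0 (comp e T 0 0) y + 2 * pd 0 (ζ ∘ e.symm) y
      - pd 0 (fun z => V (φ (e.symm z))) y := by
    rw [← pd_const_mul hZd, ← pd_add hTd (hZd.const_mul 2),
      ← pd_sub (hTd.fun_add (hZd.const_mul 2)) hVd]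
    refine pd_eqOn e.open_target (fun z hz => ?_) hy 0
    rw [he.matter_eq h hz, hw.metric_time z hz]
    simp only [if_true, Function.comp_apply]
    ring
  have hS : ∑ μ : Fin 3, ∑ ν : Fin 3, (gs (spatial y))⁻¹ μ ν * comp e T μ.succ ν.succ y =
      -(1 / 2) * trace gs (ricci gs) (spatial y) - 6 * (a (y 0) * deriv (deriv a) (y 0))
        - 3 * deriv a (y 0) ^ 2 - a (y 0) ^ 2 * V (φ (e.symm y)) * 3 := by
    rw [← hw.sum_inv_mul_einstein hy, ← hw.trace_space hy, Finset.mul_sum,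
      ← Finset.sum_sub_distrib]
    refine Finset.sum_congr rfl fun μ _ => ?_
    rw [Finset.mul_sum, ← Finset.sum_sub_distrib]
    refine Finset.sum_congr rfl fun ν _ => ?_
    rw [he.matter_eq h hy, hw.metric_space y hy]
    simp [Fin.succ_ne_zero]
    ring
  have hdiv := h.conserved e he.mem_charts y hy 0
  rw [hw.divergence_time hy hT, hS, he.matter_eq h hy 0 0, hw.einstein_time hy,
    hw.metric_time y hy] at hdiv
  rw [hw.pd_einstein_time hy] at hE
  simp only [if_true] at hdiv
  have k1 : (a (y 0) ^ 2)⁻¹ * (a (y 0) * deriv (deriv a) (y 0)) =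
      deriv (deriv a) (y 0) / a (y 0) := by
    field_simp
  have k2 : (a (y 0) ^ 2)⁻¹ * deriv a (y 0) ^ 2 = (deriv a (y 0) / a (y 0)) ^ 2 := by
    field_simp
  have k3 : (a (y 0) ^ 2)⁻¹ * a (y 0) ^ 2 = 1 := inv_mul_cancel₀ (pow_ne_zero 2 ha)
  -- All terms in the curvature of `g⋆` and in the derivatives of `a` alone cancel; only the
  -- coupling of `a'/a` to `ζ` survives.
  linear_combination -hE + hdiv - deriv a (y 0) / a (y 0) * (6 * k1 + 3 * k2 +
    3 * V (φ (e.symm y)) * k3)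

/-- If the multiplier depends on time only, the mimetic tensor of a warped space-time is Codazzi. -/
theorem IsMimeticSolution.isCodazzi_of_isGRW (h : IsMimeticSolution g T φ ζ V) (hg : IsGRW g φ)
    (hζ : DependsOnlyOnTime φ ζ) : IsCodazzi g (mimeticTensor g φ ζ V) := by
  refine isCodazzi_of_local h.smooth_mimeticTensor symmetric_mimeticTensor fun p => ?_
  obtain ⟨e, a, gs, hp, he⟩ := hg p
  have hy := e.map_source hp
  refine ⟨e, he.mem_charts, hp, ?_⟩
  refine (he.isGaussianChart.codazzi_iff h hy
    fun μ => he.isGaussianChart.pd_succ_potential hy μ).2 ⟨fun μ => ?_, fun μ ν => ?_⟩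
  · obtain ⟨F, hF⟩ := hζ (e.symm (e p))
    exact he.isGaussianChart.pd_succ_eq_zero hy hF μ
  · have hZd : DifferentiableAt ℝ (ζ ∘ e.symm) (e p) := differentiableAt_of_contDiffOn
      e.open_target (contDiffOn_comp_symm he.mem_charts h.smooth_multiplier) hy
    have hVd : DifferentiableAt ℝ (fun z => V (φ (e.symm z))) (e p) :=
      differentiableAt_of_contDiffOn e.open_target (h.contDiffOn_potential he.mem_charts) hy
    have hβ : isotropicPart φ ζ V ∘ e.symm =
        fun z => (1 / 3) * (2 * (ζ ∘ e.symm) z - V (φ (e.symm z))) := rfl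
    -- As `∂ₜh = 2 (a'/a) h`, the remaining Codazzi condition is `h_{μν}/3` times energy
    -- conservation.
    have hc := he.energy_conservation h hy
    have ha := (he.scale_pos _ hy).ne'
    rw [hβ, pd_const_mul ((hZd.const_mul 2).fun_sub hVd), pd_sub (hZd.const_mul 2) hVd,
      pd_const_mul hZd, he.isWarpedMetric.pd_zero_space hy, he.metric_space _ hy]
    field_simp at hc
    linear_combination (1 / 3) * a (e p 0) * gs (spatial (e p)) μ ν * hc

end Conservation

/-! ### Homogeneous energy density in Friedmann-Robertson-Walker space-times -/

section Friedmann

/-- The factor `2` is `n - 1` in dimension `n = 3`. -/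
theorem ricci_of_constant_curvature {G : Coord 3 → Matrix (Fin 3) (Fin 3) ℝ} {x : Coord 3} {κ : ℝ}
    (h : ∀ m j k l : Fin 3, riemann G m j k l x =
      κ * ((if m = k then G x l j else 0) - (if m = l then G x k j else 0))) (j l : Fin 3) :
    ricci G j l x = 2 * κ * G x l j := by
  simp only [ricci, h, if_true, ← Finset.mul_sum, Finset.sum_sub_distrib]
  simp
  ring

variable {M : Type*} [TopologicalSpace M] [ChartedSpace (Coord 4) M]
  {g : LorentzMetric M} {T : Tensor2 M} {φ ζ : M → ℝ} {V : ℝ → ℝ}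
  {e : OpenPartialHomeomorph M (Coord 4)}

theorem IsFRW.isGRW (h : IsFRW g φ) : IsGRW g φ := fun p =>
  let ⟨e, a, gs, hp, he, _⟩ := h p
  ⟨e, a, gs, hp, he⟩

variable [IsManifold (𝓡 4) ∞ M]

/-- In a Gaussian chart, `∂ₜ` is the velocity of the comoving observers. -/
theorem IsGaussianChart.velocity_eq (he : IsGaussianChart g φ e)
    (hφ : ContMDiff (𝓡 4) 𝓘(ℝ, ℝ) ∞ φ) {y : Coord 4} (hy : y ∈ e.target)
    (w : TangentSpace (𝓡 4) (e.symm y)) :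
    g.tensor (e.symm y) (frame e 0 y) w = velocity φ (e.symm y) w := by
  obtain ⟨w, rfl⟩ :=
    ((mdifferentiable_of_mem_charts he.mem_charts).symm.mfderiv_bijective (x := y) hy).2 w
  have h : (g.tensor (e.symm y) (frame e 0 y)).comp (mfderiv (𝓡 4) (𝓡 4) e.symm y).toLinearMap =
      (velocity φ (e.symm y)).comp (mfderiv (𝓡 4) (𝓡 4) e.symm y).toLinearMap := by
    refine (EuclideanSpace.basisFun (Fin 4) ℝ).toBasis.ext fun i => ?_
    have h1 : g.tensor (e.symm y) (frame e 0 y) (frame e i y) = g.mat e y 0 i := rfl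
    have h2 : velocity φ (e.symm y) (frame e i y) = -pd i (φ ∘ e.symm) y := by
      rw [← dform_frame he.mem_charts hφ hy]
      rfl
    have h3 : g.tensor (e.symm y) (frame e 0 y) (frame e i y) =
        velocity φ (e.symm y) (frame e i y) := by
      rw [h1, h2, he.mat_zero hy, he.pd_time hy]
      split_ifs <;> simp
    rw [OrthonormalBasis.coe_toBasis, EuclideanSpace.basisFun_apply]
    exact h3
  exact LinearMap.congr_fun h w

/-- In a Friedmann-Robertson-Walker space-time with homogeneous energy density, the multiplier
depends on time only. -/
theorem IsMimeticSolution.dependsOnlyOnTime_of_isFRW (h : IsMimeticSolution g T φ ζ V)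
    (hg : IsFRW g φ) {μ : M → ℝ} (hμ : IsEnergyDensity g T φ μ)
    (hμt : DependsOnlyOnTime φ μ) : DependsOnlyOnTime φ ζ := by
  intro p
  obtain ⟨e, a, gs, hp, he, κ, hκ⟩ := hg p
  obtain ⟨F, hF⟩ := hμt p
  -- The `00` field equation `G₀₀ = μ + 2ζ - V` solved for `ζ`. Constant curvature enters through
  -- `R⋆ = 6κ`; in a general GRW metric `R⋆` may vary in space.
  refine ⟨fun t => (1 / 2) * (3 * κ * (a t ^ 2)⁻¹ + 3 * (deriv a t / a t) ^ 2 + V t - F t), ?_⟩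
  filter_upwards [hF, e.open_source.mem_nhds hp] with x hx hxs
  have hy := e.map_source hxs
  have hxy := e.left_inv hxs
  have hw := he.isWarpedMetric
  have hT : comp e T 0 0 (e x) = μ (e.symm (e x)) :=
    hμ _ _ (he.isGaussianChart.velocity_eq h.smooth_field hy)
  have hR : trace gs (ricci gs) (spatial (e x)) = 6 * κ := by
    rw [trace, show 6 * κ = 3 * (2 * κ) by ring, ← hw.trace_space hy, Finset.sum_mul]
    refine Finset.sum_congr rfl fun k _ => ?_
    rw [Finset.sum_mul]
    refine Finset.sum_congr rfl fun l _ => ?_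
    rw [ricci_of_constant_curvature (hκ _ hy), hw.symm_space hy l k]
    ring
  have h1 := he.matter_eq h hy 0 0
  rw [hw.einstein_time hy, hR, hw.metric_time _ hy, hT, ← he.time_eq _ hy, hxy, hx] at h1
  simp only [if_true] at h1
  linarith

end Friedmann

/-! ### Space-times with Codazzi mimetic tensor -/

section Converse

/-- On a convex set, a function is constant along the coordinates in which its partial derivatives
vanish. -/
theorem eq_of_pd_eq_zero {n : ℕ} {S : Set (Coord n)} (hS : IsOpen S) (hc : Convex ℝ S)
    {f : Coord n → ℝ} (hf : ContDiffOn ℝ ∞ f S) {y z : Coord n} (hy : y ∈ S) (hz : z ∈ S)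
    (h : ∀ i, y i ≠ z i → ∀ x ∈ S, pd i f x = 0) : f y = f z := by
  obtain ⟨x, hx, hx'⟩ := domain_mvt (fun x hx =>
    (differentiableAt_of_contDiffOn hS hf hx).hasFDerivAt.hasFDerivWithinAt) hc hz hy
  rw [← sub_eq_zero, hx', fderiv_eq_sum_pd]
  refine Finset.sum_eq_zero fun i _ => ?_
  by_cases hi : y i = z i
  · simp [hi]
  · rw [h i hi x (hc.segment_subset hz hy hx), mul_zero]

theorem contDiff_spaceTime : ContDiff ℝ ∞ fun q : ℝ × Coord 3 => spaceTime q.1 q.2 := by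
  rw [contDiff_piLp]
  intro i
  refine Fin.cases contDiff_fst (fun μ => ?_) i
  exact (EuclideanSpace.proj μ : Coord 3 →L[ℝ] ℝ).contDiff.comp contDiff_snd

theorem hasDerivAt_comp_spaceTime {f : Coord 4 → ℝ} {t : ℝ} {x : Coord 3}
    (hf : DifferentiableAt ℝ f (spaceTime t x)) :
    HasDerivAt (fun s => f (spaceTime s x)) (pd 0 f (spaceTime t x)) t := by
  have h1 : (fun s => spaceTime s x) = fun s => s • (ev 0 : Coord 4) + spaceTime 0 x := by
    funext s
    ext i
    refine Fin.cases ?_ (fun μ => ?_) i <;> simp [spaceTime]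
  have h2 : HasDerivAt (fun s => spaceTime s x) (ev 0) t := by
    rw [h1]
    simpa using ((hasDerivAt_id t).smul_const (ev 0 : Coord 4)).add_const (spaceTime 0 x)
  exact hf.hasFDerivAt.comp_hasDerivAt t h2

/-- The reason for cubical chart domains: a cube is a product, hence stable under combining the time
of one point with the position of another. -/
theorem spaceTime_mem_cube {c : Coord 4} {ε : ℝ} {y z : Coord 4} (hy : y ∈ cube c ε)
    (hz : z ∈ cube c ε) : spaceTime (y 0) (spatial z) ∈ cube c ε := fun i =>
  Fin.cases (hy 0) (fun μ => hz μ.succ) i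

/-- A vector orthogonal to a unit timelike vector is spacelike. -/
theorem spacelike_of_orthogonal {p q : Fin 4 → ℝ}
    (hp : ∑ i, (if i = 0 then -1 else 1) * (p i * p i) = -1)
    (hpq : ∑ i, (if i = 0 then -1 else 1) * (p i * q i) = 0) (hq : q ≠ 0) :
    0 < ∑ i, (if i = 0 then -1 else 1) * (q i * q i) := by
  simp only [Fin.sum_univ_succ, if_true, Fin.succ_ne_zero, if_false] at *
  simp at *
  have cs : (p 1 * q 1 + p 2 * q 2 + p 3 * q 3) ^ 2 ≤
      (p 1 ^ 2 + p 2 ^ 2 + p 3 ^ 2) * (q 1 ^ 2 + q 2 ^ 2 + q 3 ^ 2) := by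
    nlinarith [sq_nonneg (p 1 * q 2 - p 2 * q 1), sq_nonneg (p 1 * q 3 - p 3 * q 1),
      sq_nonneg (p 2 * q 3 - p 3 * q 2)]
  have hp0 : 1 ≤ p 0 ^ 2 := by
    nlinarith [sq_nonneg (p 1), sq_nonneg (p 2), sq_nonneg (p 3)]
  -- Cauchy–Schwarz with `p·q = p₀q₀` and `|p|² = p₀² - 1`. If `|q|² - q₀²` were nonpositive, `p₀² ≥
  -- 1` would then force `q₀ = 0` and `|q| = 0`.
  have hkey : q 1 ^ 2 + q 2 ^ 2 + q 3 ^ 2 ≤ p 0 ^ 2 * (q 1 ^ 2 + q 2 ^ 2 + q 3 ^ 2 - q 0 ^ 2) := by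
    have e1 : p 1 * q 1 + p 2 * q 2 + p 3 * q 3 = p 0 * q 0 := by linarith
    have e2 : p 1 ^ 2 + p 2 ^ 2 + p 3 ^ 2 = p 0 ^ 2 - 1 := by linarith
    rw [e1, e2] at cs
    linarith
  by_contra! hle
  have hd : p 0 ^ 2 * (q 1 ^ 2 + q 2 ^ 2 + q 3 ^ 2 - q 0 ^ 2) ≤
      1 * (q 1 ^ 2 + q 2 ^ 2 + q 3 ^ 2 - q 0 ^ 2) :=
    mul_le_mul_of_nonpos_right hp0 (by linarith)
  refine hq (funext fun i => ?_)
  have h0 : q 0 ^ 2 ≤ 0 := by linarith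
  have h123 : q 1 ^ 2 + q 2 ^ 2 + q 3 ^ 2 ≤ 0 := by linarith
  have := sq_nonneg (q 1)
  have := sq_nonneg (q 2)
  have := sq_nonneg (q 3)
  have hall : ∀ i, q i ^ 2 ≤ 0 := fun i => by
    fin_cases i <;> simp only [Fin.mk_one, Fin.zero_eta, Fin.reduceFinMk] <;> linarith
  exact pow_eq_zero_iff two_ne_zero |>.1 (le_antisymm (hall i) (sq_nonneg _))

variable {M : Type*} [TopologicalSpace M] [ChartedSpace (Coord 4) M]
  {g : LorentzMetric M} {T : Tensor2 M} {φ ζ : M → ℝ} {V : ℝ → ℝ}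
  {e : OpenPartialHomeomorph M (Coord 4)}

theorem LorentzMetric.spacelike_of_orthogonal (g : LorentzMetric M) (x : M)
    {u v : TangentSpace (𝓡 4) x} (hu : g.tensor x u u = -1) (huv : g.tensor x u v = 0)
    (hv : v ≠ 0) : 0 < g.tensor x v v := by
  obtain ⟨b, hb⟩ := g.signature x
  have h : ∀ w w', g.tensor x w w' =
      ∑ i, (if i = 0 then -1 else 1) * (b.repr w i * b.repr w' i) := fun w w' => by
    conv_lhs => rw [← b.sum_repr w, ← b.sum_repr w']
    simp only [map_sum, map_smul, LinearMap.sum_apply, LinearMap.smul_apply, hb, smul_eq_mul,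
      mul_ite, mul_zero, Finset.sum_ite_eq', Finset.mem_univ, if_true]
    refine Finset.sum_congr rfl fun i _ => ?_
    split_ifs <;> ring
  rw [h] at hu huv ⊢
  refine MimeticCotton.spacelike_of_orthogonal hu huv fun h0 => hv ?_
  exact b.repr.map_eq_zero_iff.mp (Finsupp.ext fun i => congrFun h0 i)

variable [IsManifold (𝓡 4) ∞ M]

/-- The spatial part of the metric in a Gaussian chart is a Riemannian metric. -/
theorem IsGaussianChart.posDef_space (he : IsGaussianChart g φ e) {y : Coord 4}
    (hy : y ∈ e.target) :
    ((g.mat e y).submatrix Fin.succ Fin.succ : Matrix (Fin 3) (Fin 3) ℝ).PosDef := by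
  refine Matrix.PosDef.of_dotProduct_mulVec_pos ?_ fun {x} hx => ?_
  · ext μ ν
    simpa using (isSymm_mat g e y).apply _ _
  · set v : Coord 4 := spaceTime 0 (WithLp.toLp 2 x) with hv
    have hbij := (mdifferentiable_of_mem_charts he.mem_charts).symm.mfderiv_bijective (x := y) hy
    have h1 : bil (comp e g.tensor) y v v =
        star x ⬝ᵥ (g.mat e y).submatrix Fin.succ Fin.succ *ᵥ x := by
      have v0 : v 0 = 0 := rfl
      have v1 : v 1 = x 0 := rfl
      have v2 : v 2 = x 1 := rfl
      have v3 : v 3 = x 2 := rfl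
      simp [bil, sumBil, Fin.sum_univ_succ, v0, v1, v2, v3, Matrix.mulVec, dotProduct,
        LorentzMetric.mat]
      ring
    have h2 : bil (comp e g.tensor) y (ev 0) v = 0 := by
      rw [coord_eq_sum v]
      simp only [map_sum, map_smul, bil_ev, smul_eq_mul]
      refine Finset.sum_eq_zero fun i _ => ?_
      refine Fin.cases ?_ (fun μ => ?_) i
      · simp [hv, spaceTime]
      · exact mul_eq_zero_of_right _ (he.metric_mixed y hy μ)
    rw [← h1, bil_comp]
    refine g.spacelike_of_orthogonal (e.symm y) (u := frame e 0 y) (he.metric_time y hy) ?_ ?_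
    · rw [bil_comp] at h2
      exact h2
    · intro h0
      have h3 : v = 0 := hbij.1 (h0.trans (map_zero _).symm)
      refine hx (funext fun μ => ?_)
      exact congrArg (fun w : Coord 4 => w μ.succ) h3

end Converse

/-! ### From the Codazzi equation to a warped product -/

section CottonToWarped

/-- A continuous relation that holds where the multiplier does not vanish holds everywhere. -/
theorem eq_of_dense_multiplier {M : Type*} [TopologicalSpace M] {ζ : M → ℝ}
    {e : OpenPartialHomeomorph M (Coord 4)} (hζ : Dense {x : M | ζ x ≠ 0}) {f f' : Coord 4 → ℝ}
    (hf : ContinuousOn f e.target) (hf' : ContinuousOn f' e.target)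
    (h : ∀ y ∈ e.target, ζ (e.symm y) ≠ 0 → f y = f' y) {y : Coord 4} (hy : y ∈ e.target) :
    f y = f' y := by
  by_contra hne
  have ho : IsOpen (e.target ∩ (fun z => f z - f' z) ⁻¹' {0}ᶜ) :=
    (hf.sub hf').isOpen_inter_preimage e.open_target isOpen_compl_singleton
  obtain ⟨_, hx, z, hz, rfl⟩ := hζ.exists_mem_open
    (e.isOpen_image_symm_of_subset_target ho inter_subset_left) ⟨_, y, ⟨hy, sub_ne_zero.2 hne⟩, rfl⟩
  exact hz.2 (sub_eq_zero.2 (h z hz.1 hx))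

variable {M : Type*} [TopologicalSpace M] [ChartedSpace (Coord 4) M]
  {g : LorentzMetric M} {T : Tensor2 M} {φ ζ : M → ℝ} {V : ℝ → ℝ}
  [IsManifold (𝓡 4) ∞ M]

/-- If the mimetic tensor is Codazzi, the multiplier depends on time only. -/
theorem IsMimeticSolution.dependsOnlyOnTime_of_isCodazzi (h : IsMimeticSolution g T φ ζ V)
    (hC : IsCodazzi g (mimeticTensor g φ ζ V)) : DependsOnlyOnTime φ ζ := by
  intro p
  obtain ⟨e, c, ε, hε, hp, hpc, het, he⟩ := h.exists_isGaussianChart p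
  -- The function of time is `ζ` along the time axis through the centre; each point is compared with
  -- the axis point of equal time.
  refine ⟨fun t => (ζ ∘ e.symm) (spaceTime t (spatial c)), ?_⟩
  filter_upwards [e.open_source.mem_nhds hp] with x hx
  have hy := e.map_source hx
  have hyc : e x ∈ cube c ε := het ▸ hy
  have hz : spaceTime (e x 0) (spatial c) ∈ e.target :=
    het ▸ spaceTime_mem_cube hyc (mem_cube_self c hε)
  have h1 : ζ x = (ζ ∘ e.symm) (e x) := congrArg ζ (e.left_inv hx).symm
  have h2 : φ x = e x 0 := by rw [← he.time_eq _ hy, e.left_inv hx]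
  rw [h1, h2]
  refine eq_of_pd_eq_zero e.open_target (het ▸ convex_cube c ε)
    (contDiffOn_comp_symm he.mem_charts h.smooth_multiplier) hy hz fun i hi z hz => ?_
  obtain ⟨μ, rfl⟩ := Fin.exists_succ_eq.2 (fun h0 : i = 0 => hi (by rw [h0, spaceTime_zero]))
  exact ((he.codazzi_iff h hz fun μ => he.pd_succ_potential hz μ).1
    (hC.2.2 e he.mem_charts z hz)).1 μ

/-- If the mimetic tensor is Codazzi and the multiplier is nowhere locally zero, the space-time is a
generalized Robertson-Walker space-time. -/
theorem IsMimeticSolution.isGRW_of_isCodazzi (h : IsMimeticSolution g T φ ζ V)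
    (hζ : Dense {x : M | ζ x ≠ 0}) (hC : IsCodazzi g (mimeticTensor g φ ζ V)) : IsGRW g φ := by
  intro p
  obtain ⟨e, c, ε, hε, hp, hpc, het, he⟩ := h.exists_isGaussianChart p
  have hco : Convex ℝ e.target := het ▸ convex_cube c ε
  have hc : c ∈ e.target := het ▸ mem_cube_self c hε
  have hmem : ∀ {y z}, y ∈ e.target → z ∈ e.target →
      spaceTime (y 0) (spatial z) ∈ e.target := fun hy hz => by
    rw [het] at *
    exact spaceTime_mem_cube hy hz
  have hZ := contDiffOn_comp_symm he.mem_charts h.smooth_multiplier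
  have hβ := h.contDiffOn_isotropicPart he.mem_charts
  have hg : ∀ μ ν : Fin 3, ContDiffOn ℝ ∞ (fun z => g.mat e z μ.succ ν.succ) e.target :=
    fun μ ν => g.smooth e he.mem_charts μ.succ ν.succ
  have hcod := fun y hy => (he.codazzi_iff h hy fun μ => he.pd_succ_potential hy μ).1
    (hC.2.2 e he.mem_charts y hy)
  have hpos : ∀ y ∈ e.target, 0 < g.mat e y (Fin.succ (0 : Fin 3)) (Fin.succ (0 : Fin 3)) :=
    fun y hy => (he.posDef_space hy).diag_pos (i := 0)
  -- the multiplier and the isotropic part are functions of time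
  have hZt : ∀ y ∈ e.target, ∀ z ∈ e.target, y 0 = z 0 → (ζ ∘ e.symm) y = (ζ ∘ e.symm) z :=
    fun y hy z hz h0 => eq_of_pd_eq_zero e.open_target hco hZ hy hz fun i hi x hx => by
      obtain ⟨μ, rfl⟩ := Fin.exists_succ_eq.2 (fun h1 : i = 0 => hi (h1 ▸ h0))
      exact (hcod x hx).1 μ
  have hβt : ∀ y ∈ e.target, ∀ z ∈ e.target, y 0 = z 0 →
      (isotropicPart φ ζ V ∘ e.symm) y = (isotropicPart φ ζ V ∘ e.symm) z :=
    fun y hy z hz h0 => by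
      have := hZt y hy z hz h0
      simp only [Function.comp_apply] at this
      simp only [Function.comp_apply, isotropicPart, this, he.time_eq y hy, he.time_eq z hz, h0]
  have hβ' : ∀ y ∈ e.target, ∀ z ∈ e.target, y 0 = z 0 →
      pd 0 (isotropicPart φ ζ V ∘ e.symm) y = pd 0 (isotropicPart φ ζ V ∘ e.symm) z :=
    fun y hy z hz h0 => by
      have hd : ∀ x ∈ e.target, HasDerivAt
          (fun s => (isotropicPart φ ζ V ∘ e.symm) (spaceTime s (spatial x)))
          (pd 0 (isotropicPart φ ζ V ∘ e.symm) x) (x 0) := fun x hx => by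
        have := hasDerivAt_comp_spaceTime (t := x 0) (x := spatial x)
          (differentiableAt_of_contDiffOn e.open_target hβ (hmem hx hx))
        rwa [spaceTime_spatial] at this
      -- The restrictions of `β` to the two time lines agree near the common time, so their
      -- derivatives agree.
      refine (hd y hy).unique ((h0 ▸ hd z hz).congr_of_eventuallyEq ?_)
      filter_upwards [(isOpenMap_time _ e.open_target).mem_nhds (mem_image_of_mem _ hy)]
      rintro _ ⟨x, hx, rfl⟩
      exact hβt _ (hmem hx hy) _ (hmem hx hz) rfl
  set x₀ := spatial c with hx₀
  -- One positive diagonal component on the central time line, which will be `a²` up to a constant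
  -- factor.
  set H : ℝ → ℝ := fun t =>
    g.mat e (spaceTime t x₀) (Fin.succ (0 : Fin 3)) (Fin.succ (0 : Fin 3)) with hH
  have hsec : ContDiffOn ℝ ∞ (fun t => spaceTime t x₀) ((fun y : Coord 4 => y 0) '' e.target) :=
    (contDiff_spaceTime.comp (contDiff_id.prodMk contDiff_const)).contDiffOn
  have hsecm : MapsTo (fun t => spaceTime t x₀) ((fun y : Coord 4 => y 0) '' e.target) e.target := by
    rintro _ ⟨y, hy, rfl⟩
    exact hmem hy hc
  have hHs : ContDiffOn ℝ ∞ H ((fun y : Coord 4 => y 0) '' e.target) :=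
    (hg 0 0).comp hsec hsecm
  have hHp : ∀ y ∈ e.target, 0 < H (y 0) := fun y hy => hpos _ (hmem hy hc)
  have hHd : ∀ y ∈ e.target, HasDerivAt H
      (pd 0 (fun z => g.mat e z (Fin.succ (0 : Fin 3)) (Fin.succ (0 : Fin 3)))
        (spaceTime (y 0) x₀)) (y 0) := fun y hy => hasDerivAt_comp_spaceTime
      (differentiableAt_of_contDiffOn e.open_target (hg 0 0) (hmem hy hc))
  -- the logarithmic time derivative of the spatial metric is a function of time
  have hlog : ∀ μ ν : Fin 3, ∀ y ∈ e.target,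
      pd 0 (fun z => g.mat e z μ.succ ν.succ) y * H (y 0) =
        deriv H (y 0) * g.mat e y μ.succ ν.succ := fun μ ν y hy => by
    have hproj : ContinuousOn (fun y : Coord 4 => y 0) e.target := by fun_prop
    have hm := mapsTo_image (fun y : Coord 4 => y 0) e.target
    have hH' : ContDiffOn ℝ ∞ (deriv H) ((fun y : Coord 4 => y 0) '' e.target) :=
      hHs.deriv_of_isOpen (isOpenMap_time _ e.open_target) (by simp)
    -- Eliminating `∂ₜβ` between the Codazzi relations at `z` and at the axis point of equal time
    -- leaves the claim multiplied by `ζ`. It is cancelled where nonzero; the resulting relation is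
    -- free of `ζ` and extends by density.
    refine eq_of_dense_multiplier (e := e) hζ
      (f := fun y => pd 0 (fun z => g.mat e z μ.succ ν.succ) y * H (y 0))
      (f' := fun y => deriv H (y 0) * g.mat e y μ.succ ν.succ)
      ((contDiffOn_pd e.open_target (hg μ ν) 0).continuousOn.mul
        (hHs.continuousOn.comp hproj hm))
      ((hH'.continuousOn.comp hproj hm).mul (hg μ ν).continuousOn) (fun z hz hne => ?_) hy
    have h1 := (hcod z hz).2 μ ν
    have h2 := (hcod _ (hmem hz hc)).2 0 0
    have h3 : ζ (e.symm (spaceTime (z 0) x₀)) = ζ (e.symm z) := hZt _ (hmem hz hc) z hz rfl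
    rw [hβ' _ (hmem hz hc) z hz rfl, h3] at h2
    simp only [(hHd z hz).deriv]
    refine mul_left_cancel₀ hne ?_
    linear_combination H (z 0) * h1 - g.mat e z μ.succ ν.succ * h2
  have hprod : ∀ μ ν : Fin 3, ∀ y ∈ e.target, g.mat e y μ.succ ν.succ =
      H (y 0) / H (c 0) * g.mat e (spaceTime (c 0) (spatial y)) μ.succ ν.succ :=
    fun μ ν y hy => by
    have hs := hmem hc hy
    -- By `hlog` the quotient `h_{μν}/H` has zero time derivative, so it keeps its value on the
    -- slice `t = c 0`.
    have h1 : g.mat e y μ.succ ν.succ / H (y 0) =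
        g.mat e (spaceTime (c 0) (spatial y)) μ.succ ν.succ / H (c 0) := by
      refine eq_of_pd_eq_zero (f := fun z => g.mat e z μ.succ ν.succ / H (z 0)) e.open_target hco
        ?_ hy hs fun i hi z hz => ?_
      · refine (hg μ ν).div (hHs.comp (EuclideanSpace.proj 0 : Coord 4 →L[ℝ] ℝ).contDiff.contDiffOn
          (mapsTo_image _ _)) fun z hz => (hHp z hz).ne'
      · have hi0 : i = 0 := by
          by_contra hi0
          obtain ⟨μ, rfl⟩ := Fin.exists_succ_eq.2 hi0
          exact hi rfl
        subst hi0
        have hd := (hHd z hz).differentiableAt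
        have hI : DifferentiableAt ℝ (fun t => (H t)⁻¹) (z 0) := hd.fun_inv (hHp z hz).ne'
        have hgd := differentiableAt_of_contDiffOn e.open_target (hg μ ν) hz
        simp only [div_eq_mul_inv]
        rw [pd_mul hgd (hasFDerivAt_comp_time hI).differentiableAt, pd_zero_comp_time hI,
          deriv_fun_inv'' hd (hHp z hz).ne']
        have := hlog μ ν z hz
        have hne := (hHp z hz).ne'
        field_simp
        linear_combination this
    rw [div_eq_div_iff (hHp y hy).ne' (hHp c hc).ne'] at h1
    rw [div_mul_eq_mul_div, eq_div_iff (hHp c hc).ne', h1]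
    ring
  have hquot : ∀ y ∈ e.target, 0 < H (y 0) / H (c 0) := fun y hy =>
    div_pos (hHp y hy) (hHp c hc)
  -- The scale factor is normalized to `1` at time `c 0`, so that `g⋆` is the metric induced on that
  -- slice.
  refine ⟨e, fun t => Real.sqrt (H t / H (c 0)),
    fun x => (g.mat e (spaceTime (c 0) x)).submatrix Fin.succ Fin.succ, hp, ?_⟩
  refine ⟨he.mem_charts, he.time_eq, ?_, fun y hy => Real.sqrt_pos.2 (hquot y hy), fun μ ν => ?_,
    fun y hy => he.posDef_space (hmem hc hy), he.metric_time, he.metric_mixed, fun y hy μ ν => ?_⟩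
  · refine (hHs.div_const _).sqrt ?_
    rintro _ ⟨y, hy, rfl⟩
    exact (hquot y hy).ne'
  · refine (hg μ ν).comp
      (contDiff_spaceTime.comp (contDiff_const.prodMk contDiff_id)).contDiffOn ?_
    rintro _ ⟨y, hy, rfl⟩
    exact hmem hc hy
  · rw [Real.sq_sqrt (hquot y hy).le]
    exact hprod μ ν y hy

end CottonToWarped

end MimeticCotton

end

theorem mainTheorem1 {M : Type*} [TopologicalSpace M]
    [ChartedSpace (EuclideanSpace ℝ (Fin 4)) M] [IsManifold (𝓡 4) ∞ M]
    (g : MimeticCotton.LorentzMetric M) (T : MimeticCotton.Tensor2 M) (φ ζ : M → ℝ) (V : ℝ → ℝ)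
    (hsol : MimeticCotton.IsMimeticSolution g T φ ζ V) :
    (Dense {x : M | ζ x ≠ 0} →
      (MimeticCotton.IsCottonEquation g T (MimeticCotton.mimeticTensor g φ ζ V) ↔
        MimeticCotton.IsGRW g φ ∧ MimeticCotton.DependsOnlyOnTime φ (V ∘ φ) ∧
          MimeticCotton.DependsOnlyOnTime φ ζ)) ∧
    (MimeticCotton.IsFRW g φ →
      (MimeticCotton.IsCottonEquation g T (MimeticCotton.mimeticTensor g φ ζ V) ↔
        MimeticCotton.DependsOnlyOnTime φ ζ) ∧
      ((∃ μ : M → ℝ, MimeticCotton.IsEnergyDensity g T φ μ ∧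
          MimeticCotton.DependsOnlyOnTime φ μ) →
        MimeticCotton.IsCottonEquation g T (MimeticCotton.mimeticTensor g φ ζ V))) := by
  rw [hsol.isCottonEquation_iff]
  refine ⟨fun hζ => ⟨fun hC => ⟨hsol.isGRW_of_isCodazzi hζ hC,
      fun _ => ⟨V, Filter.Eventually.of_forall fun _ => rfl⟩,
      hsol.dependsOnlyOnTime_of_isCodazzi hC⟩,
    fun h => hsol.isCodazzi_of_isGRW h.1 h.2.2⟩,
    fun hF => ⟨⟨hsol.dependsOnlyOnTime_of_isCodazzi, hsol.isCodazzi_of_isGRW hF.isGRW⟩, ?_⟩⟩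
  rintro ⟨μ, hμ, hμt⟩
  exact hsol.isCodazzi_of_isGRW hF.isGRW (hsol.dependsOnlyOnTime_of_isFRW hF hμ hμt)
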